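/- **Theorem (local law for the centered 0/1 adjacency model).** Fix $\kappa\in(0,\tfrac12]$, an integer $r\ge 1$ and $M>0$, and put $q=q_N=N^{\kappa}$. For every sufficiently large $N$ let $\gamma^{(k)}_i$ ($1\le k\le r$, $1\le i\le N$) be real numbers, which may depend on $N$, such that $$\gamma^{(k)}_i\ge 1,\qquad \frac1N\sum_{k=1}^r\sum_{i=1}^N(\gamma_i^{(k)})^2\le M,\qquad q\,s_{ij}\le 1,\qquad\text{where } s_{ij}=\frac1N\sum_{k=1}^r\gamma^{(k)}_i\gamma^{(k)}_j .$$ Let $H=H^{(N)}=(h_{ij})$ be a random real symmetric $N\times N$ matrix whose entries $h_{ij}$, $i\le j$, are independent with $$\mathbb P\Big[h_{ij}=\tfrac{1}{\sqrt q}(1-q s_{ij})\Big]=q s_{ij},\qquad \mathbb P\Big[h_{ij}=-\tfrac1{\sqrt q}\,q s_{ij}\Big]=1-q s_{ij}.$$ For $z\in\mathbb C^+=\{z\in\mathbb C:\operatorname{Im}z>0\}$ let $(u^{(1)}(z),\dots,u^{(r)}(z))\in(\mathbb C^+)^r$ be the (unique) solution of $$u^{(k)}(z)=-\frac1N\sum_{i=1}^N\frac{\gamma_i^{(k)}}{z+\sum_{j=1}^r\gamma_i^{(j)}u^{(j)}(z)},\qquad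 1\le k\le r,$$ and set $$g_i(z)=-\frac{1}{z+\sum_{j}\gamma_i^{(j)}u^{(j)}(z)},\qquad m(z)=\frac1N\sum_{i=1}^N g_i(z).$$ Let $\theta_i=\sum_{k=1}^r\gamma_i^{(k)}$, $G(z)=(H-z)^{-1}$, and for $z=E+\mathrm i\eta$ $$\Lambda(z)=\max\Big\{\max_i\theta_i|G_{ii}(z)-g_i(z)|,\ \max_{i\ne j}\sqrt{\theta_i\theta_j}\,|G_{ij}(z)|\Big\},\qquad \Phi(z)=\frac1{\sqrt q}+\frac1{\sqrt{N\eta}} .$$ Let $I\subset\mathbb R$ be a bulk interval, that is, a bounded interval for which there is a constant $c_I>0$ independent of $N$ such that, for all sufficiently large $N$, $\operatorname{Im}m(E+\mathrm i\eta)>c_I$ for all $E\in I$ and $0<\eta\le1$. Fix $\delta>0$ and let $$\mathcal D_\delta^I=\{E+\mathrm i\eta:\ E\in I,\ N^{\delta-1}\le\eta\le10\}.$$ Then $\Lambda\prec\Phi$ uniformly on $\mathcal D_\delta^I$; that is, for all $\varepsilon>0$ and $D>0$ we have, for all sufficiently large $N$, $$\sup_{z\in\mathcal D_\delta^I}\mathbb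 P\big[\Lambda(z)>N^{\varepsilon}\,\Phi(z)\big]\le N^{-D}.$$ -/

import Mathlib

open Filter MeasureTheory ProbabilityTheory

noncomputable section

namespace ChungLu

/-- The low-rank variance profile `s i j = N⁻¹ ∑ₖ γₖ(i) γₖ(j)`. -/
def profile {r N : ℕ} (γ : Fin r → Fin N → ℝ) (i j : Fin N) : ℝ :=
  (1 / (N : ℝ)) * ∑ k, γ k i * γ k j

/-- The weights `θ i = ∑ₖ γₖ(i)`. -/
def theta {r N : ℕ} (γ : Fin r → Fin N → ℝ) (i : Fin N) : ℝ := ∑ k, γ k i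

/-- The standing assumptions on the vectors `γₖ`: entries at least one, mean square at most `M`,
and all edge probabilities `q * s i j` at most one. -/
structure IsAdmissible {r N : ℕ} (M q : ℝ) (γ : Fin r → Fin N → ℝ) : Prop where
  one_le : ∀ k i, 1 ≤ γ k i
  mean_sq_le : (1 / (N : ℝ)) * ∑ k, ∑ i, γ k i ^ 2 ≤ M
  prob_le_one : ∀ i j, q * profile γ i j ≤ 1

/-- `h` is the centred and rescaled adjacency matrix `(A - 𝔼 A) / √q` of a random graph with
independent edges, the edge (or loop, if `i = j`) `i j` being present with probability
`p i j = q * s i j`. -/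
structure IsCenteredAdjacency {Ω : Type*} [MeasurableSpace Ω] (P : Measure Ω) {r N : ℕ} (q : ℝ)
    (γ : Fin r → Fin N → ℝ) (h : Fin N → Fin N → Ω → ℝ) : Prop where
  measurable : ∀ i j, Measurable (h i j)
  symm : ∀ i j ω, h i j ω = h j i ω
  indep : iIndepFun (fun e : {e : Fin N × Fin N // e.1 ≤ e.2} => h e.1.1 e.1.2) P
  prob_edge : ∀ i j, P {ω | h i j ω = (1 - q * profile γ i j) / √q} =
    ENNReal.ofReal (q * profile γ i j)
  prob_no_edge : ∀ i j, P {ω | h i j ω = -(q * profile γ i j) / √q} =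
    ENNReal.ofReal (1 - q * profile γ i j)

/-- `u ∈ (ℂ⁺)^r` solves the self-consistent system at the spectral parameter `z`. -/
def IsSolution {r N : ℕ} (γ : Fin r → Fin N → ℝ) (z : ℂ) (u : Fin r → ℂ) : Prop :=
  (∀ k, 0 < (u k).im) ∧
    ∀ k, u k = -(1 / (N : ℂ)) * ∑ i, (γ k i : ℂ) / (z + ∑ j, (γ j i : ℂ) * u j)

/-- The solution of the self-consistent system at `z` (it exists and is unique for `z ∈ ℂ⁺`). -/
def solution {r N : ℕ} (γ : Fin r → Fin N → ℝ) (z : ℂ) : Fin r → ℂ :=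
  Classical.epsilon (IsSolution γ z)

/-- `g i = -1 / (z + ∑ⱼ γⱼ(i) uⱼ(z))`. -/
def gLim {r N : ℕ} (γ : Fin r → Fin N → ℝ) (z : ℂ) (i : Fin N) : ℂ :=
  -1 / (z + ∑ j, (γ j i : ℂ) * solution γ z j)

/-- `m(z) = -N⁻¹ ∑ᵢ 1 / (z + ∑ⱼ γⱼ(i) uⱼ(z))`. -/
def mLim {r N : ℕ} (γ : Fin r → Fin N → ℝ) (z : ℂ) : ℂ :=
  -(1 / (N : ℂ)) * ∑ i, 1 / (z + ∑ j, (γ j i : ℂ) * solution γ z j)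

/-- A bounded interval above which `Im m` is bounded below, uniformly in (large) `N`. -/
def IsBulkInterval {r : ℕ} (γ : ∀ N : ℕ, Fin r → Fin N → ℝ) (I : Set ℝ) : Prop :=
  I.OrdConnected ∧ Bornology.IsBounded I ∧
    ∃ c : ℝ, 0 < c ∧ ∀ᶠ N in atTop, ∀ z : ℂ, z.re ∈ I → 0 < z.im → z.im ≤ 1 →
      c < (mLim (γ N) z).im

/-- The resolvent `G(z) = (H - z)⁻¹` of a real matrix. -/
def resolvent {N : ℕ} (H : Matrix (Fin N) (Fin N) ℝ) (z : ℂ) : Matrix (Fin N) (Fin N) ℂ :=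
  (H.map (fun x : ℝ => (x : ℂ)) - z • (1 : Matrix (Fin N) (Fin N) ℂ))⁻¹

/-- `Λ_d = maxᵢ θ i |G i i - g i|`. -/
def lambdaD {r N : ℕ} (γ : Fin r → Fin N → ℝ) (H : Matrix (Fin N) (Fin N) ℝ) (z : ℂ) : ℝ :=
  ⨆ i : Fin N, theta γ i * ‖resolvent H z i i - gLim γ z i‖

/-- `Λ_o = max_{i ≠ j} √(θ i θ j) |G i j|`. -/
def lambdaO {r N : ℕ} (γ : Fin r → Fin N → ℝ) (H : Matrix (Fin N) (Fin N) ℝ) (z : ℂ) : ℝ :=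
  ⨆ e : {e : Fin N × Fin N // e.1 ≠ e.2},
    √(theta γ e.1.1 * theta γ e.1.2) * ‖resolvent H z e.1.1 e.1.2‖

/-- `Λ = max {Λ_d, Λ_o}`. -/
def lambda {r N : ℕ} (γ : Fin r → Fin N → ℝ) (H : Matrix (Fin N) (Fin N) ℝ) (z : ℂ) : ℝ :=
  max (lambdaD γ H z) (lambdaO γ H z)

/-- The control parameter `Φ = 1 / √q + 1 / √(N η)`, with `η = Im z`. -/
def controlPhi (N : ℕ) (q : ℝ) (z : ℂ) : ℝ := 1 / √q + 1 / √((N : ℝ) * z.im)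

/-- The spectral domain `{E + iη : E ∈ I, N^(δ-1) ≤ η ≤ 10}`. -/
def spectralDomain (I : Set ℝ) (δ : ℝ) (N : ℕ) : Set ℂ :=
  {z | z.re ∈ I ∧ (N : ℝ) ^ (δ - 1) ≤ z.im ∧ z.im ≤ 10}

/-- Stochastic domination `X ≺ Y`, uniformly in the parameter `u ∈ U N`: for all `ε, D > 0`, for
all large `N`, `sup_{u ∈ U N} ℙ(|X N u| > N^ε Y N u) ≤ N^(-D)`. -/
def StochDom {ι : Type*} {Ω : ℕ → Type*} [∀ N, MeasurableSpace (Ω N)]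
    (P : ∀ N, Measure (Ω N)) (U : ℕ → Set ι) (X Y : ∀ N, ι → Ω N → ℝ) : Prop :=
  ∀ ε : ℝ, 0 < ε → ∀ D : ℝ, 0 < D → ∀ᶠ N in atTop, ∀ u ∈ U N,
    P N {ω | |X N u ω| > (N : ℝ) ^ ε * Y N u ω} ≤ ENNReal.ofReal ((N : ℝ) ^ (-D))

end ChungLu

end

/-! ### The self-consistent system: contraction and existence of a solution -/

namespace ChungLu

/-! Schur's formula writes `-1 / G i i` as `z` plus a quadratic form in row `i`, minus the entry `h
i i`; the coefficients of the form come from the minor without row and column `i`, which is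
independent of that row. A large deviation estimate replaces the form by its mean, up to an error `θ
i * Φ`. The mean is essentially `∑ₖ s i k * G k k`, and since `s` has rank `r` this equals `∑ⱼ γⱼ(i)
Uⱼ`, where `U` is the vector of `γ`-weighted averages of the diagonal (`sum_profile_mul`). So `U`
nearly solves the self-consistent system (`Setting.exists_diag_error`). Off-diagonal entries are
treated by removing two rows, which gives a bilinear form.

Nearness to the exact solution `u` follows from a weighted maximum principle for `‖uₖ - Uₖ‖ / √(Im
uₖ Im Uₖ)` (`stability_core`). The fixed point map contracts this quantity. The strictness coming
from `Im z` degenerates at the real axis, so the usable gap comes from phases: `|g g'| - Re (g g') ≥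
2 Im g Im g'`. In the bulk `Im uₖ ≥ c`, because `γ ≥ 1`. Then the denominators have imaginary part
at least `c * θ i`, so `g i` is of size `1 / θ i`. This is why an error `θ i * Φ` in the denominator
yields accuracy `Φ / θ i` in `G i i`, and why the weights in `Λ` are natural.

The variance of the forms is controlled by the Ward identity. After symmetrising, `∑ θₖ θₗ |Gₖₗ|² ≤
∑ θₖ² Im Gₖₖ / η`, which is of order `N / η` since the weights have bounded mean square
(`Setting.frobenius_of_sum_le`).

These estimates presuppose bounds on the minors. To break the circle, the good event `IsGood` is a
family of implications "if the minor is bounded by `C`, then its forms concentrate", so its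
probability can be bounded without any a priori information (`prob_not_isGood_le`). On the good
events for `N ^ 4 + 1` points of a vertical line the rest is deterministic (`local_law_of_grid`): at
`Im z ≥ 1` the bounds are trivial; closeness at one grid point passes to the next by Lipschitz
continuity, gives the a priori bounds there (`Setting.isReg_of_isClose`), and the local law with the
same constants (`local_law_of_isGood`). A union bound finishes the proof. -/

/-- The denominators `z + ∑ⱼ γⱼ(i) uⱼ` of the self-consistent system. -/
noncomputable def den {r N : ℕ} (γ : Fin r → Fin N → ℝ) (z : ℂ) (u : Fin r → ℂ) (i : Fin N) : ℂ :=
  z + ∑ j, (γ j i : ℂ) * u j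

/-- The weighted averages `N⁻¹ ∑ᵢ γₖ(i) gᵢ`. -/
noncomputable def avg {r N : ℕ} (γ : Fin r → Fin N → ℝ) (g : Fin N → ℂ) (k : Fin r) : ℂ :=
  (1 / (N : ℂ)) * ∑ i, (γ k i : ℂ) * g i

/-- The fixed point map of the self-consistent system. -/
noncomputable def dysonMap {r N : ℕ} (γ : Fin r → Fin N → ℝ) (z : ℂ) (u : Fin r → ℂ) :
    Fin r → ℂ :=
  avg γ fun i => -1 / den γ z u i

variable {r N : ℕ} {γ : Fin r → Fin N → ℝ} {z : ℂ} {u U : Fin r → ℂ}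

lemma den_im (i : Fin N) : (den γ z u i).im = z.im + ∑ j, γ j i * (u j).im := by
  simp [den, Complex.im_sum]

lemma avg_im (g : Fin N → ℂ) (k : Fin r) :
    (avg γ g k).im = (1 / (N : ℝ)) * ∑ i, γ k i * (g i).im := by
  have : (1 / (N : ℂ)) = ((1 / (N : ℝ) : ℝ) : ℂ) := by push_cast; rfl
  rw [avg, this, Complex.im_ofReal_mul, Complex.im_sum]
  simp

lemma avg_re (g : Fin N → ℂ) (k : Fin r) :
    (avg γ g k).re = (1 / (N : ℝ)) * ∑ i, γ k i * (g i).re := by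
  have : (1 / (N : ℂ)) = ((1 / (N : ℝ) : ℝ) : ℂ) := by push_cast; rfl
  rw [avg, this, Complex.re_ofReal_mul, Complex.re_sum]
  simp

lemma norm_avg_le (hγ : ∀ k i, 0 ≤ γ k i) (g : Fin N → ℂ) (k : Fin r) :
    ‖avg γ g k‖ ≤ (1 / (N : ℝ)) * ∑ i, γ k i * ‖g i‖ := by
  rw [avg, norm_mul]
  have h1 : ‖(1 / (N : ℂ))‖ = 1 / (N : ℝ) := by simp
  rw [h1]
  gcongr
  refine (norm_sum_le _ _).trans (Finset.sum_le_sum fun i _ => ?_)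
  rw [norm_mul, Complex.norm_real, Real.norm_of_nonneg (hγ k i)]

lemma avg_sub (g g' : Fin N → ℂ) (k : Fin r) :
    avg γ g k - avg γ g' k = avg γ (fun i => g i - g' i) k := by
  simp only [avg, mul_sub, Finset.sum_sub_distrib]

lemma neg_one_div_im (a : ℂ) : (-1 / a).im = a.im / ‖a‖ ^ 2 := by
  rw [Complex.div_im, Complex.normSq_eq_norm_sq]; simp; ring

lemma norm_neg_one_div_mul_sqrt (a : ℂ) (ha : 0 < a.im) :
    ‖-1 / a‖ * √a.im = √(-1 / a).im := by
  rw [neg_one_div_im, Real.sqrt_div ha.le, Real.sqrt_sq (norm_nonneg _)]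
  simp; ring

lemma ne_zero_of_im_pos {a : ℂ} (ha : 0 < a.im) : a ≠ 0 := by
  rintro rfl; simp at ha

lemma neg_one_div_im_pos {a : ℂ} (ha : 0 < a.im) : 0 < (-1 / a).im := by
  rw [neg_one_div_im]
  have := norm_pos_iff.2 (ne_zero_of_im_pos ha)
  positivity

lemma neg_one_div_sub {a b : ℂ} (ha : a ≠ 0) (hb : b ≠ 0) :
    -1 / a - -1 / b = (-1 / a) * (-1 / b) * (a - b) := by
  field_simp; ring

lemma den_im_pos (hγ : ∀ k i, 0 ≤ γ k i) (hz : 0 < z.im) (hu : ∀ k, 0 ≤ (u k).im) (i : Fin N) :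
    0 < (den γ z u i).im := by
  rw [den_im]
  have : 0 ≤ ∑ j, γ j i * (u j).im :=
    Finset.sum_nonneg fun j _ => mul_nonneg (hγ j i) (hu j)
  linarith

/-- The weights `√(Im uⱼ Im Uⱼ)` are strictly contracted by the products of the inverse
denominators. -/
lemma weight_lt (hγ : ∀ k i, 0 ≤ γ k i) (hz : 0 < z.im) (hu : ∀ k, 0 ≤ (u k).im)
    (hU : ∀ k, 0 ≤ (U k).im) (i : Fin N) :
    ‖-1 / den γ z u i‖ * ‖-1 / den γ z U i‖ * ∑ j, γ j i * √((u j).im * (U j).im) <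
      √(-1 / den γ z u i).im * √(-1 / den γ z U i).im := by
  have h1 := den_im_pos hγ hz hu i
  have h2 := den_im_pos hγ hz hU i
  have hs : ∑ j, γ j i * √((u j).im * (U j).im) ≤
      √(∑ j, γ j i * (u j).im) * √(∑ j, γ j i * (U j).im) := by
    refine le_trans (le_of_eq ?_) (Real.sum_sqrt_mul_sqrt_le Finset.univ
      (f := fun j => γ j i * (u j).im) (g := fun j => γ j i * (U j).im)
      (fun j => mul_nonneg (hγ j i) (hu j)) (fun j => mul_nonneg (hγ j i) (hU j)))
    refine Finset.sum_congr rfl fun j _ => ?_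
    rw [← Real.sqrt_mul (mul_nonneg (hγ j i) (hu j)),
      show γ j i * (u j).im * (γ j i * (U j).im) = γ j i ^ 2 * ((u j).im * (U j).im) by ring,
      Real.sqrt_mul (sq_nonneg _), Real.sqrt_sq (hγ j i)]
  -- The imaginary part of each denominator exceeds the weighted sum by `Im z > 0`; strictness comes
  -- from there.
  have hlt : ∑ j, γ j i * √((u j).im * (U j).im) <
      √(den γ z u i).im * √(den γ z U i).im := by
    refine hs.trans_lt ?_
    have e1 : √(∑ j, γ j i * (u j).im) < √(den γ z u i).im := by
      apply Real.sqrt_lt_sqrt (Finset.sum_nonneg fun j _ => mul_nonneg (hγ j i) (hu j))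
      rw [den_im]; linarith
    have e2 : √(∑ j, γ j i * (U j).im) < √(den γ z U i).im := by
      apply Real.sqrt_lt_sqrt (Finset.sum_nonneg fun j _ => mul_nonneg (hγ j i) (hU j))
      rw [den_im]; linarith
    exact mul_lt_mul'' e1 e2 (Real.sqrt_nonneg _) (Real.sqrt_nonneg _)
  have p1 : 0 < ‖-1 / den γ z u i‖ := norm_pos_iff.2 (ne_zero_of_im_pos (neg_one_div_im_pos h1))
  have p2 : 0 < ‖-1 / den γ z U i‖ := norm_pos_iff.2 (ne_zero_of_im_pos (neg_one_div_im_pos h2))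
  calc _ < ‖-1 / den γ z u i‖ * ‖-1 / den γ z U i‖ * (√(den γ z u i).im * √(den γ z U i).im) := by
        gcongr
    _ = (‖-1 / den γ z u i‖ * √(den γ z u i).im) *
        (‖-1 / den γ z U i‖ * √(den γ z U i).im) := by ring
    _ = _ := by rw [norm_neg_one_div_mul_sqrt _ h1, norm_neg_one_div_mul_sqrt _ h2]

/-- Cauchy–Schwarz in the average over `i`. It turns the output of `weight_lt` back into weights of
the form `√(Im · Im ·)`, now for the image of the fixed point map. -/
lemma avg_sqrt_le (hγ : ∀ k i, 0 ≤ γ k i) (g g' : Fin N → ℂ) (hg : ∀ i, 0 ≤ (g i).im)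
    (hg' : ∀ i, 0 ≤ (g' i).im) (k : Fin r) :
    (1 / (N : ℝ)) * ∑ i, γ k i * (√(g i).im * √(g' i).im) ≤
      √((avg γ g k).im * (avg γ g' k).im) := by
  have hs : ∑ i, γ k i * (√(g i).im * √(g' i).im) ≤
      √(∑ i, γ k i * (g i).im) * √(∑ i, γ k i * (g' i).im) := by
    refine le_trans (le_of_eq ?_) (Real.sum_sqrt_mul_sqrt_le Finset.univ
      (f := fun i => γ k i * (g i).im) (g := fun i => γ k i * (g' i).im)
      (fun i => mul_nonneg (hγ k i) (hg i)) (fun i => mul_nonneg (hγ k i) (hg' i)))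
    refine Finset.sum_congr rfl fun i _ => ?_
    rw [Real.sqrt_mul (hγ k i), Real.sqrt_mul (hγ k i)]
    have := Real.mul_self_sqrt (hγ k i)
    linear_combination (-(√(g i).im * √(g' i).im)) * this
  rw [avg_im, avg_im, show 1 / (N : ℝ) * (∑ i, γ k i * (g i).im) *
      (1 / (N : ℝ) * ∑ i, γ k i * (g' i).im) = (1 / (N : ℝ)) ^ 2 *
      ((∑ i, γ k i * (g i).im) * ∑ i, γ k i * (g' i).im) by ring,
    Real.sqrt_mul (sq_nonneg _), Real.sqrt_sq (by positivity),
    Real.sqrt_mul (Finset.sum_nonneg fun i _ => mul_nonneg (hγ k i) (hg i))]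
  gcongr

lemma den_sub (i : Fin N) : den γ z u i - den γ z U i = ∑ j, (γ j i : ℂ) * (u j - U j) := by
  simp [den, mul_sub, Finset.sum_sub_distrib]

/-- The ratio `‖u - U‖ / √(Im u Im U)` is `2 sinh (d / 2)` for the hyperbolic distance `d`.
Differences of inverse denominators factor through `neg_one_div_sub`, and two Cauchy–Schwarz
inequalities, over `j` and then over `i`, carry the weights through. The contraction is strict but
not uniform, so existence needs a compactness argument. -/
lemma dysonMap_contraction (hN : 0 < N) (hγ : ∀ k i, 0 < γ k i) (hz : 0 < z.im)
    (hu : ∀ k, 0 ≤ (u k).im) (hU : ∀ k, 0 ≤ (U k).im) {D : ℝ} (hD : 0 < D)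
    (h : ∀ j, ‖u j - U j‖ ≤ D * √((u j).im * (U j).im)) (k : Fin r) :
    ‖dysonMap γ z u k - dysonMap γ z U k‖ <
      D * √((dysonMap γ z u k).im * (dysonMap γ z U k).im) := by
  have hγ0 : ∀ k i, 0 ≤ γ k i := fun k i => (hγ k i).le
  have hN' : (0 : ℝ) < N := by exact_mod_cast hN
  rw [dysonMap, dysonMap, avg_sub]
  refine (norm_avg_le hγ0 _ k).trans_lt ?_
  calc _ < (1 / (N : ℝ)) * ∑ i, γ k i * (D * (√(-1 / den γ z u i).im * √(-1 / den γ z U i).im)) := by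
        refine mul_lt_mul_of_pos_left (Finset.sum_lt_sum_of_nonempty ⟨⟨0, hN⟩, Finset.mem_univ _⟩
          fun i _ => mul_lt_mul_of_pos_left ?_ (hγ k i)) (by positivity)
        have h1 := den_im_pos hγ0 hz hu i
        have h2 := den_im_pos hγ0 hz hU i
        rw [neg_one_div_sub (ne_zero_of_im_pos h1) (ne_zero_of_im_pos h2), norm_mul, norm_mul,
          den_sub]
        have := weight_lt hγ0 hz hu hU i
        calc _ ≤ ‖-1 / den γ z u i‖ * ‖-1 / den γ z U i‖ *
              (D * ∑ j, γ j i * √((u j).im * (U j).im)) := by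
              gcongr
              rw [Finset.mul_sum]
              refine (norm_sum_le _ _).trans (Finset.sum_le_sum fun j _ => ?_)
              rw [norm_mul, Complex.norm_real, Real.norm_of_nonneg (hγ0 j i)]
              nlinarith [h j, hγ j i]
          _ = D * (‖-1 / den γ z u i‖ * ‖-1 / den γ z U i‖ *
              ∑ j, γ j i * √((u j).im * (U j).im)) := by ring
          _ < _ := mul_lt_mul_of_pos_left this hD
    _ = D * ((1 / (N : ℝ)) * ∑ i, γ k i * (√(-1 / den γ z u i).im * √(-1 / den γ z U i).im)) := by
        simp only [Finset.mul_sum]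
        exact Finset.sum_congr rfl fun i _ => by ring
    _ ≤ _ := by
        gcongr
        exact avg_sqrt_le hγ0 _ _ (fun i => (neg_one_div_im_pos (den_im_pos hγ0 hz hu i)).le)
          (fun i => (neg_one_div_im_pos (den_im_pos hγ0 hz hU i)).le) k

lemma isSolution_of_fixed (hu : ∀ k, 0 < (u k).im) (h : dysonMap γ z u = u) :
    IsSolution γ z u := by
  refine ⟨hu, fun k => ?_⟩
  conv_lhs => rw [← h]
  simp only [dysonMap, avg, den]
  rw [neg_mul, ← mul_neg, ← Finset.sum_neg_distrib]
  congr 1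
  exact Finset.sum_congr rfl fun i _ => by ring

lemma IsSolution.dysonMap_eq (h : IsSolution γ z u) : dysonMap γ z u = u := by
  funext k
  rw [h.2 k]
  simp only [dysonMap, avg, den]
  rw [neg_mul, ← mul_neg, ← Finset.sum_neg_distrib]
  congr 1
  exact Finset.sum_congr rfl fun i _ => by ring

lemma norm_neg_one_div_le {a : ℂ} {η : ℝ} (hη : 0 < η) (ha : η ≤ a.im) : ‖-1 / a‖ ≤ 1 / η := by
  rw [norm_div, norm_neg, norm_one]
  exact one_div_le_one_div_of_le hη (ha.trans ((le_abs_self _).trans (Complex.abs_im_le_norm a)))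

lemma continuous_den (i : Fin N) : Continuous fun u : Fin r → ℂ => den γ z u i := by
  unfold den; fun_prop

/-- Existence of a solution of the self-consistent system in the upper half plane. -/
theorem exists_isSolution (hr : 0 < r) (hN : 0 < N) (hγ : ∀ k i, 0 < γ k i) (hz : 0 < z.im) :
    ∃ u, IsSolution γ z u := by
  have hγ0 : ∀ k i, 0 ≤ γ k i := fun k i => (hγ k i).le
  have hN' : (0 : ℝ) < N := by exact_mod_cast hN
  have : Nonempty (Fin r) := ⟨⟨0, hr⟩⟩
  set C : ℝ := ∑ k, (1 / (N : ℝ)) * ∑ i, γ k i * (1 / z.im) with hC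
  have hCk : ∀ u : Fin r → ℂ, (∀ k, 0 ≤ (u k).im) → ∀ k, ‖dysonMap γ z u k‖ ≤ C := by
    intro u hu k
    refine (norm_avg_le hγ0 _ k).trans ?_
    calc _ ≤ (1 / (N : ℝ)) * ∑ i, γ k i * (1 / z.im) := by
          gcongr with i _
          · exact hγ0 k i
          · refine norm_neg_one_div_le hz ?_
            rw [den_im]
            have : 0 ≤ ∑ j, γ j i * (u j).im :=
              Finset.sum_nonneg fun j _ => mul_nonneg (hγ0 j i) (hu j)
            linarith
      _ ≤ C := Finset.single_le_sum (f := fun k => (1 / (N : ℝ)) * ∑ i, γ k i * (1 / z.im))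
          (fun k _ => by
            have : 0 ≤ ∑ i, γ k i * (1 / z.im) :=
              Finset.sum_nonneg fun i _ => mul_nonneg (hγ0 k i) (by positivity)
            positivity) (Finset.mem_univ k)
  have hC0 : 0 ≤ C := (norm_nonneg _).trans (hCk (fun _ => 0) (by simp) ⟨0, hr⟩)
  set B : ℝ := ‖z‖ + ∑ i, theta γ i * C with hB
  have hθ : ∀ i, 0 ≤ theta γ i := fun i => Finset.sum_nonneg fun k _ => hγ0 k i
  have hden : ∀ u : Fin r → ℂ, (∀ k, ‖u k‖ ≤ C) → ∀ i, ‖den γ z u i‖ ≤ B := by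
    intro u hu i
    refine (norm_add_le _ _).trans (add_le_add le_rfl ?_)
    refine le_trans ?_ (Finset.single_le_sum (f := fun i => theta γ i * C)
      (fun i _ => mul_nonneg (hθ i) hC0) (Finset.mem_univ i))
    simp only [theta, Finset.sum_mul]
    refine (norm_sum_le _ _).trans (Finset.sum_le_sum fun j _ => ?_)
    rw [norm_mul, Complex.norm_real, Real.norm_of_nonneg (hγ0 j i)]
    exact mul_le_mul_of_nonneg_left (hu j) (hγ0 j i)
  have hB0 : 0 < B := by
    have : 0 < ‖z‖ := norm_pos_iff.2 (ne_zero_of_im_pos hz)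
    have : 0 ≤ ∑ i, theta γ i * C := Finset.sum_nonneg fun i _ => mul_nonneg (hθ i) hC0
    linarith
  set γm : ℝ := ∑ k, (1 / ((1 / (N : ℝ)) * ∑ i, γ k i)) with hγm
  have hS : ∀ k, 0 < (1 / (N : ℝ)) * ∑ i, γ k i := fun k =>
    mul_pos (by positivity) (Finset.sum_pos (fun i _ => hγ k i) ⟨⟨0, hN⟩, Finset.mem_univ _⟩)
  have hγm0 : 0 < γm := Finset.sum_pos (fun k _ => one_div_pos.2 (hS k)) Finset.univ_nonempty
  set c : ℝ := z.im / B ^ 2 / γm with hc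
  have hc0 : 0 < c := by positivity
  -- A compact set mapped into itself. The norm bound comes from `|1 / den| ≤ 1 / Im z`; the lower
  -- bound `c` comes from `Im (-1 / den) ≥ Im z / B ^ 2`.
  set K : Set (Fin r → ℂ) := {u | ∀ k, ‖u k‖ ≤ C ∧ c ≤ (u k).im} with hK
  have hmaps : ∀ u : Fin r → ℂ, (∀ k, ‖u k‖ ≤ C) → (∀ k, 0 ≤ (u k).im) → dysonMap γ z u ∈ K := by
    intro u hu hu0 k
    refine ⟨hCk u hu0 k, ?_⟩
    rw [dysonMap, avg_im]
    calc c ≤ z.im / B ^ 2 * ((1 / (N : ℝ)) * ∑ i, γ k i) := by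
          rw [hc, div_eq_mul_one_div _ γm]
          gcongr
          rw [div_le_iff₀ hγm0, ← div_le_iff₀' (hS k)]
          exact Finset.single_le_sum (f := fun k => (1 / ((1 / (N : ℝ)) * ∑ i, γ k i)))
            (fun k _ => (one_div_pos.2 (hS k)).le) (Finset.mem_univ k)
      _ = (1 / (N : ℝ)) * ∑ i, γ k i * (z.im / B ^ 2) := by rw [← Finset.sum_mul]; ring
      _ ≤ _ := by
          gcongr with i _
          · exact hγ0 k i
          · rw [neg_one_div_im]
            have h1 := den_im_pos hγ0 hz hu0 i
            have h2 : 0 < ‖den γ z u i‖ := norm_pos_iff.2 (ne_zero_of_im_pos h1)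
            have h3 : z.im ≤ (den γ z u i).im := by
              rw [den_im]
              have : 0 ≤ ∑ j, γ j i * (u j).im :=
                Finset.sum_nonneg fun j _ => mul_nonneg (hγ0 j i) (hu0 j)
              linarith
            gcongr
            exact hden u hu i
  have hKim : ∀ u ∈ K, ∀ k, 0 < (u k).im := fun u hu k => hc0.trans_le (hu k).2
  have hKmaps : ∀ u ∈ K, dysonMap γ z u ∈ K := fun u hu =>
    hmaps u (fun k => (hu k).1) (fun k => (hKim u hu k).le)
  have hKne : K.Nonempty := ⟨_, hmaps (fun _ => 0) (by simpa using hC0) (by simp)⟩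
  have hKc : IsCompact K := by
    have : K = Set.univ.pi fun _ : Fin r => Metric.closedBall (0 : ℂ) C ∩ {w | c ≤ w.im} := by
      ext u; simp [hK]
    rw [this]
    exact isCompact_univ_pi fun _ => (isCompact_closedBall _ _).inter_right
      (isClosed_le continuous_const Complex.continuous_im)
  -- The displacement of `u` under the map, in the contracted quantity. At a minimiser that is not
  -- fixed, one application of the map would decrease it strictly.
  set φ : (Fin r → ℂ) → ℝ := fun u => Finset.univ.sup' Finset.univ_nonempty fun k =>
    ‖u k - dysonMap γ z u k‖ / √((u k).im * (dysonMap γ z u k).im) with hφ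
  have hFc : ∀ k, ContinuousOn (fun u => dysonMap γ z u k) K := by
    intro k
    simp only [dysonMap, avg]
    refine continuousOn_const.mul (continuousOn_finsetSum _ fun i _ => continuousOn_const.mul
      (continuousOn_const.div (continuous_den i).continuousOn fun u hu => ?_))
    exact ne_zero_of_im_pos (den_im_pos hγ0 hz (fun k => (hKim u hu k).le) i)
  have hφc : ContinuousOn φ K := by
    refine ContinuousOn.finset_sup'_apply _ fun k _ => ?_
    refine ContinuousOn.div ?_ ?_ ?_
    · exact ((continuous_apply k).continuousOn.sub (hFc k)).norm
    · exact Real.continuous_sqrt.comp_continuousOn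
        ((Complex.continuous_im.comp (continuous_apply k)).continuousOn.mul
          (Complex.continuous_im.comp_continuousOn (hFc k)))
    · intro u hu
      have := hKim u hu k
      have := hKim _ (hKmaps u hu) k
      positivity
  obtain ⟨u, huK, hmin⟩ := hKc.exists_isMinOn hKne hφc
  refine ⟨u, isSolution_of_fixed (hKim u huK) ?_⟩
  by_contra hne
  have hle : ∀ k, ‖u k - dysonMap γ z u k‖ ≤ φ u * √((u k).im * (dysonMap γ z u k).im) := by
    intro k
    have h1 := hKim u huK k
    have h2 := hKim _ (hKmaps u huK) k
    rw [← div_le_iff₀ (by positivity)]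
    exact Finset.le_sup' (fun k => ‖u k - dysonMap γ z u k‖ /
      √((u k).im * (dysonMap γ z u k).im)) (Finset.mem_univ k)
  have hpos : 0 < φ u := by
    obtain ⟨k, hk⟩ := Function.ne_iff.1 hne
    have h0 : 0 < ‖u k - dysonMap γ z u k‖ := norm_pos_iff.2 (sub_ne_zero.2 (Ne.symm hk))
    by_contra hcon
    have := hle k
    have h3 := Real.sqrt_nonneg ((u k).im * (dysonMap γ z u k).im)
    nlinarith
  have hlt : φ (dysonMap γ z u) < φ u := by
    rw [hφ]
    simp only [Finset.sup'_lt_iff]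
    intro k _
    have h1 := hKim _ (hKmaps u huK) k
    have h2 := hKim _ (hKmaps _ (hKmaps u huK)) k
    rw [div_lt_iff₀ (by positivity)]
    exact dysonMap_contraction hN hγ hz (fun k => (hKim u huK k).le)
      (fun k => (hKim _ (hKmaps u huK) k).le) hpos hle k
  exact absurd (hmin (hKmaps u huK)) (not_le.2 hlt)

/-- Existence is enough: the comparison with the resolvent works for any solution with imaginary
parts bounded below, so uniqueness plays no role. -/
theorem solution_isSolution (hr : 0 < r) (hN : 0 < N) (hγ : ∀ k i, 0 < γ k i) (hz : 0 < z.im) :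
    IsSolution γ z (solution γ z) :=
  Classical.epsilon_spec (exists_isSolution hr hN hγ hz)

end ChungLu

/-! ### Estimates on the weights and the core stability inequality -/

namespace ChungLu

variable {r N : ℕ} {γ : Fin r → Fin N → ℝ} {z : ℂ} {u U : Fin r → ℂ} {M q : ℝ}

section Weights

lemma IsAdmissible.pos (h : IsAdmissible M q γ) (k : Fin r) (i : Fin N) : 0 < γ k i :=
  zero_lt_one.trans_le (h.one_le k i)

lemma IsAdmissible.nonneg (h : IsAdmissible M q γ) (k : Fin r) (i : Fin N) : 0 ≤ γ k i :=
  (h.pos k i).le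

lemma IsAdmissible.le_theta (h : IsAdmissible M q γ) (k : Fin r) (i : Fin N) :
    γ k i ≤ theta γ i :=
  Finset.single_le_sum (f := fun k => γ k i) (fun k _ => h.nonneg k i) (Finset.mem_univ k)

lemma IsAdmissible.one_le_theta (h : IsAdmissible M q γ) (hr : 0 < r) (i : Fin N) :
    1 ≤ theta γ i :=
  (h.one_le ⟨0, hr⟩ i).trans (h.le_theta _ i)

lemma theta_sq_le (i : Fin N) : theta γ i ^ 2 ≤ r * ∑ k, γ k i ^ 2 := by
  simpa [theta] using sq_sum_le_card_mul_sum_sq (s := Finset.univ) (f := fun k => γ k i)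

lemma IsAdmissible.mean_theta_sq_le (h : IsAdmissible M q γ) :
    (1 / (N : ℝ)) * ∑ i, theta γ i ^ 2 ≤ r * M := by
  calc _ ≤ (1 / (N : ℝ)) * ∑ i, (r * ∑ k, γ k i ^ 2) := by
        gcongr with i _; exact theta_sq_le i
    _ = r * ((1 / (N : ℝ)) * ∑ k, ∑ i, γ k i ^ 2) := by
        rw [← Finset.mul_sum, Finset.sum_comm]; ring
    _ ≤ _ := by gcongr; exact h.mean_sq_le

lemma IsAdmissible.mean_sq_single_le (h : IsAdmissible M q γ) (k : Fin r) :
    (1 / (N : ℝ)) * ∑ i, γ k i ^ 2 ≤ M := by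
  refine le_trans ?_ h.mean_sq_le
  gcongr
  exact Finset.single_le_sum (f := fun k => ∑ i, γ k i ^ 2)
    (fun k _ => Finset.sum_nonneg fun i _ => sq_nonneg _) (Finset.mem_univ k)

lemma IsAdmissible.mean_le (h : IsAdmissible M q γ) (k : Fin r) :
    (1 / (N : ℝ)) * ∑ i, γ k i ≤ M := by
  refine le_trans ?_ (h.mean_sq_single_le k)
  gcongr with i _
  nlinarith [h.one_le k i]

lemma IsAdmissible.one_le_M (h : IsAdmissible M q γ) (hr : 0 < r) (hN : 0 < N) : 1 ≤ M := by
  have hN' : (0 : ℝ) < N := by exact_mod_cast hN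
  refine le_trans ?_ (h.mean_le ⟨0, hr⟩)
  calc (1 : ℝ) = (1 / (N : ℝ)) * ∑ _i : Fin N, 1 := by simp [hN'.ne']
    _ ≤ _ := by gcongr with i _; exact h.one_le _ i

lemma IsAdmissible.profile_nonneg (h : IsAdmissible M q γ) (i j : Fin N) :
    0 ≤ profile γ i j :=
  mul_nonneg (by positivity) (Finset.sum_nonneg fun k _ => mul_nonneg (h.nonneg k i) (h.nonneg k j))

lemma IsAdmissible.profile_le (h : IsAdmissible M q γ) (i j : Fin N) :
    profile γ i j ≤ theta γ i * theta γ j / N := by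
  rw [profile, one_div, inv_mul_eq_div, theta, Finset.sum_mul]
  gcongr with k _
  · exact h.nonneg k i
  · exact h.le_theta k j

/-- Uses `γ ≥ 1` in the second index. It bounds the imaginary part of the self-energy of row `i`
below by `θ i` times that of the normalised trace. -/
lemma IsAdmissible.theta_div_le_profile (h : IsAdmissible M q γ) (i j : Fin N) :
    theta γ i / N ≤ profile γ i j := by
  rw [profile, one_div, inv_mul_eq_div, theta]
  gcongr with k _
  nlinarith [h.one_le k j, h.pos k i]

lemma IsAdmissible.sum_profile_le (h : IsAdmissible M q γ) (i : Fin N) :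
    ∑ j, profile γ i j ≤ M * theta γ i := by
  have : ∑ j, profile γ i j = ∑ k, γ k i * ((1 / (N : ℝ)) * ∑ j, γ k j) := by
    simp only [profile, Finset.mul_sum]
    rw [Finset.sum_comm]
    exact Finset.sum_congr rfl fun k _ => Finset.sum_congr rfl fun j _ => by ring
  rw [this, theta, Finset.mul_sum]
  refine Finset.sum_le_sum fun k _ => ?_
  rw [mul_comm M]
  exact mul_le_mul_of_nonneg_left (h.mean_le k) (h.nonneg k i)

/-- The diagonal case of the probability bound says `q * ∑ₖ γₖ(i)² ≤ N`. All pointwise upper bounds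
on the weights derive from it. -/
lemma IsAdmissible.mul_theta_sq_le (h : IsAdmissible M q γ) (hq : 0 ≤ q) (hN : 0 < N)
    (i : Fin N) : q * theta γ i ^ 2 ≤ r * N := by
  have hN' : (0 : ℝ) < N := by exact_mod_cast hN
  have h1 := h.prob_le_one i i
  have h2 : profile γ i i = (1 / (N : ℝ)) * ∑ k, γ k i ^ 2 := by
    simp [profile, sq]
  rw [h2, ← mul_assoc, mul_one_div, div_mul_eq_mul_div, div_le_one hN'] at h1
  calc q * theta γ i ^ 2 ≤ q * (r * ∑ k, γ k i ^ 2) := by gcongr; exact theta_sq_le i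
    _ = r * (q * ∑ k, γ k i ^ 2) := by ring
    _ ≤ _ := by gcongr

/-- Cauchy–Schwarz for `∑ θ * θ⁻¹ = N` against the mean square bound. Imaginary parts of diagonal
entries are only bounded below by multiples of `θ⁻²`, and this keeps their average away from zero.
-/
lemma IsAdmissible.sum_inv_theta_sq (h : IsAdmissible M q γ) (hr : 0 < r) (hN : 0 < N) :
    1 / (r * M) ≤ (1 / (N : ℝ)) * ∑ i, 1 / theta γ i ^ 2 := by
  have hN' : (0 : ℝ) < N := by exact_mod_cast hN
  have hM := h.one_le_M hr hN
  have hr' : (0 : ℝ) < r := by exact_mod_cast hr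
  have hθ : ∀ i, 0 < theta γ i := fun i => zero_lt_one.trans_le (h.one_le_theta hr i)
  have hcs := Finset.sum_mul_sq_le_sq_mul_sq Finset.univ (fun i => theta γ i)
    (fun i => 1 / theta γ i)
  have e1 : ∑ i, theta γ i * (1 / theta γ i) = N := by
    rw [Finset.sum_congr rfl fun i _ => mul_one_div_cancel (hθ i).ne']; simp
  rw [e1] at hcs
  have e2 := h.mean_theta_sq_le
  rw [one_div, inv_mul_le_iff₀ hN'] at e2
  simp only [one_div_pow] at hcs
  set X := ∑ i, 1 / theta γ i ^ 2
  have hX : 0 ≤ X := Finset.sum_nonneg fun i _ => by positivity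
  rw [div_le_iff₀ (by positivity), one_div, inv_mul_eq_div, div_mul_eq_mul_div, le_div_iff₀ hN',
    one_mul]
  have : (N : ℝ) ^ 2 ≤ N * (r * M) * X := hcs.trans (by gcongr)
  nlinarith

end Weights

/-- Quantitative stability of the self-consistent system. -/
lemma stability_core (hN : 0 < N) (hγ : ∀ k i, 0 ≤ γ k i) (hz : 0 < z.im)
    (hu : dysonMap γ z u = u) {β c c₁ T : ℝ} (hc : 0 < c) (hc₁ : 0 < c₁)
    (hU : ∀ k, ‖U k - dysonMap γ z U k‖ ≤ β) (hcu : ∀ k, c ≤ (u k).im) (hcU : ∀ k, c ≤ (U k).im)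
    (hT : ∀ k, √((u k).im * (U k).im) ≤ T)
    (hgap : ∀ k, c₁ ≤ (1 / (N : ℝ)) * ∑ i, γ k i ^ 2 *
      (2 * ((-1 / den γ z u i).im * (-1 / den γ z U i).im)))
    (hβ : β / c ≤ c₁ / 2) (j : Fin r) : ‖u j - U j‖ ≤ 2 * β / (c₁ * c) * T := by
  have hN' : (0 : ℝ) < N := by exact_mod_cast hN
  have : Nonempty (Fin r) := ⟨j⟩
  set τ : Fin r → ℝ := fun k => √((u k).im * (U k).im) with hτ
  have hu0 : ∀ k, 0 < (u k).im := fun k => hc.trans_le (hcu k)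
  have hU0 : ∀ k, 0 < (U k).im := fun k => hc.trans_le (hcU k)
  have hτ0 : ∀ k, 0 < τ k := fun k => Real.sqrt_pos.2 (mul_pos (hu0 k) (hU0 k))
  have hβ0 : 0 ≤ β := (norm_nonneg _).trans (hU j)
  -- Maximum principle: the argument is run in the coordinate where the weighted difference is
  -- largest.
  obtain ⟨k, hk⟩ := Finite.exists_max fun k => ‖u k - U k‖ / τ k
  set D := ‖u k - U k‖ / τ k with hD
  have hD0 : 0 ≤ D := div_nonneg (norm_nonneg _) (hτ0 k).le
  have hDj : ∀ j, ‖u j - U j‖ ≤ D * τ j := fun j => (div_le_iff₀ (hτ0 j)).1 (hk j)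
  have hDk : ‖u k - U k‖ = D * τ k := (div_mul_cancel₀ _ (hτ0 k).ne').symm
  set g : Fin N → ℂ := fun i => -1 / den γ z u i with hg
  set g' : Fin N → ℂ := fun i => -1 / den γ z U i with hg'
  have hda : ∀ i, 0 < (den γ z u i).im := den_im_pos hγ hz fun k => (hu0 k).le
  have hdA : ∀ i, 0 < (den γ z U i).im := den_im_pos hγ hz fun k => (hU0 k).le
  -- `a` is the diagonal coefficient of the linearised system in coordinate `k`, and `Q` is what the
  -- weighted Cauchy–Schwarz bound charges for it. The gain is `Q - Re a`.
  set a : ℂ := avg γ (fun i => (γ k i : ℂ) * (g i * g' i)) k with ha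
  set Q : ℝ := (1 / (N : ℝ)) * ∑ i, γ k i ^ 2 * (‖g i‖ * ‖g' i‖) with hQ
  have hgapQ : c₁ ≤ Q - a.re := by
    refine (hgap k).trans ?_
    rw [hQ, ha, avg_re, ← mul_sub, ← Finset.sum_sub_distrib]
    gcongr with i _
    rw [Complex.re_ofReal_mul, ← mul_assoc (γ k i), ← sq, ← mul_sub]
    gcongr
    rw [Complex.mul_re]
    -- The left side is the real part of `conj g * g'`. It exceeds `Re (g * g')` by `2 Im g Im g'`,
    -- so both numbers in the upper half plane forces a gap between `‖g g'‖` and `Re (g g')`.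
    have h1 : ((g i).re * (g' i).re + (g i).im * (g' i).im) ≤ ‖g i‖ * ‖g' i‖ := by
      rw [← norm_mul]
      have := (abs_le.1 (Complex.abs_re_le_norm ((starRingEnd ℂ (g i)) * g' i))).2
      rw [norm_mul, Complex.norm_conj, Complex.mul_re, Complex.conj_re, Complex.conj_im] at this
      rw [norm_mul]
      linarith
    change 2 * ((g i).im * (g' i).im) ≤ _
    linarith
  -- The diagonal term is moved to the left exactly, with its phase; only the other terms will be
  -- estimated by absolute values.
  have hid : (1 - a) * (u k - U k) =
      avg γ (fun i => (g i * g' i) * ∑ j ∈ Finset.univ.erase k, (γ j i : ℂ) * (u j - U j)) k -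
        (U k - dysonMap γ z U k) := by
    have e1 : u k - dysonMap γ z U k =
        avg γ (fun i => (g i * g' i) * ∑ j, (γ j i : ℂ) * (u j - U j)) k := by
      conv_lhs => rw [← hu]
      rw [dysonMap, dysonMap, avg_sub]
      congr 1
      funext i
      rw [neg_one_div_sub (ne_zero_of_im_pos (hda i)) (ne_zero_of_im_pos (hdA i)), den_sub]
    have e2 : a * (u k - U k) =
        avg γ (fun i => (g i * g' i) * ((γ k i : ℂ) * (u k - U k))) k := by
      simp only [ha, avg, mul_assoc, Finset.sum_mul]
      congr 1
      exact Finset.sum_congr rfl fun i _ => by ring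
    have e3 : avg γ (fun i => (g i * g' i) * ∑ j ∈ Finset.univ.erase k, (γ j i : ℂ) * (u j - U j)) k =
        avg γ (fun i => (g i * g' i) * ∑ j, (γ j i : ℂ) * (u j - U j)) k -
        avg γ (fun i => (g i * g' i) * ((γ k i : ℂ) * (u k - U k))) k := by
      rw [avg_sub]
      congr 1
      funext i
      rw [← mul_sub, Finset.sum_erase_eq_sub (Finset.mem_univ k)]
    rw [e3, ← e1, ← e2]; ring
  have hoff : ‖avg γ (fun i => (g i * g' i) *
      ∑ j ∈ Finset.univ.erase k, (γ j i : ℂ) * (u j - U j)) k‖ ≤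
      D * √((u k).im * (dysonMap γ z U k).im) - D * τ k * Q := by
    refine (norm_avg_le hγ _ k).trans ?_
    calc _ ≤ (1 / (N : ℝ)) * ∑ i, γ k i *
          (D * (√(g i).im * √(g' i).im) - D * τ k * (γ k i * (‖g i‖ * ‖g' i‖))) := by
          gcongr with i _
          · exact hγ k i
          have hw := (weight_lt hγ hz (fun k => (hu0 k).le) (fun k => (hU0 k).le) i).le
          calc _ ≤ ‖g i‖ * ‖g' i‖ * ∑ j ∈ Finset.univ.erase k, γ j i * (D * τ j) := by
                rw [norm_mul, norm_mul]
                gcongr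
                refine (norm_sum_le _ _).trans (Finset.sum_le_sum fun j _ => ?_)
                rw [norm_mul, Complex.norm_real, Real.norm_of_nonneg (hγ j i)]
                exact mul_le_mul_of_nonneg_left (hDj j) (hγ j i)
            _ = D * (‖g i‖ * ‖g' i‖ * ∑ j, γ j i * τ j) -
                D * τ k * (γ k i * (‖g i‖ * ‖g' i‖)) := by
                rw [Finset.sum_erase_eq_sub (Finset.mem_univ k)]
                have : ∑ j, γ j i * (D * τ j) = D * ∑ j, γ j i * τ j := by
                  rw [Finset.mul_sum]; exact Finset.sum_congr rfl fun _ _ => by ring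
                rw [this]; ring
            _ ≤ _ := by gcongr
      _ = D * ((1 / (N : ℝ)) * ∑ i, γ k i * (√(g i).im * √(g' i).im)) - D * τ k * Q := by
          rw [hQ]
          simp only [Finset.mul_sum, ← Finset.sum_sub_distrib]
          exact Finset.sum_congr rfl fun i _ => by ring
      _ ≤ _ := by
          gcongr
          have := avg_sqrt_le hγ g g' (fun i => (neg_one_div_im_pos (hda i)).le)
            (fun i => (neg_one_div_im_pos (hdA i)).le) k
          have h2 : avg γ g k = u k := congrFun hu k
          rw [h2] at this
          exact this
  -- The averaged Cauchy–Schwarz bound produces the imaginary part of the image of `U`. Replacing it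
  -- by `Im Uₖ ≥ c` costs a factor `1 + β / c`.
  have hsq : √((u k).im * (dysonMap γ z U k).im) ≤ τ k * (1 + β / c) := by
    apply Real.sqrt_le_iff.2
    have hτsq : τ k ^ 2 = (u k).im * (U k).im := Real.sq_sqrt (mul_pos (hu0 k) (hU0 k)).le
    refine ⟨by positivity, ?_⟩
    rw [mul_pow, hτsq]
    have h1 : (dysonMap γ z U k).im ≤ (U k).im + β := by
      have := (abs_le.1 ((Complex.abs_im_le_norm (U k - dysonMap γ z U k)).trans (hU k))).1
      rw [Complex.sub_im] at this; linarith
    have h2 : (U k).im + β ≤ (U k).im * (1 + β / c) := by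
      have : β ≤ (U k).im * (β / c) := by
        rw [← mul_div_assoc, le_div_iff₀ hc]; nlinarith [hcU k]
      linarith
    have h3 : 0 ≤ β / c := by positivity
    calc _ ≤ (u k).im * ((U k).im * (1 + β / c)) := by
          have := (hu0 k).le; gcongr; exact h1.trans h2
      _ ≤ (u k).im * (U k).im * (1 + β / c) ^ 2 := by
          have : (u k).im * (U k).im * (1 + β / c) ≤ (u k).im * (U k).im * (1 + β / c) ^ 2 := by
            gcongr
            · exact (mul_pos (hu0 k) (hU0 k)).le
            · nlinarith
          linarith
  have hmain : (1 - a.re) * (D * τ k) ≤ D * (τ k * (1 + β / c)) - D * τ k * Q + β := by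
    calc _ ≤ ‖1 - a‖ * ‖u k - U k‖ := by
          rw [hDk]
          gcongr
          have := Complex.re_le_norm (1 - a)
          simpa using this
      _ = ‖(1 - a) * (u k - U k)‖ := (norm_mul _ _).symm
      _ ≤ _ := by
          rw [hid]
          refine (norm_sub_le _ _).trans (add_le_add (hoff.trans ?_) (hU k))
          gcongr
  -- After cancelling `D * τ k`, the gap `Q - Re a ≥ c₁` beats the loss `β / c ≤ c₁ / 2`.
  have hfin : D * τ k * (c₁ / 2) ≤ β := by
    have h1 : D * τ k * (c₁ / 2) ≤ D * τ k * (Q - a.re - β / c) := by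
      gcongr; linarith
    nlinarith
  have hτk : c ≤ τ k := by
    rw [hτ]; apply Real.le_sqrt_of_sq_le; rw [sq]
    exact mul_le_mul (hcu k) (hcU k) hc.le (hu0 k).le
  have hDle : D ≤ 2 * β / (c₁ * c) := by
    rw [le_div_iff₀ (by positivity)]
    have : D * c * (c₁ / 2) ≤ D * τ k * (c₁ / 2) := by gcongr
    linarith
  exact (hDj j).trans (by gcongr; exact hT j)

end ChungLu

/-! ### Stability for approximate solutions; lower bounds on the exact solution -/

namespace ChungLu

variable {r N : ℕ} {γ : Fin r → Fin N → ℝ} {z : ℂ} {u U : Fin r → ℂ} {M q : ℝ}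

lemma norm_sum_mul_le (hγ : ∀ k i, 0 ≤ γ k i) {C : ℝ} (hu : ∀ k, ‖u k‖ ≤ C) (i : Fin N) :
    ‖∑ j, (γ j i : ℂ) * u j‖ ≤ theta γ i * C := by
  rw [theta, Finset.sum_mul]
  refine (norm_sum_le _ _).trans (Finset.sum_le_sum fun j _ => ?_)
  rw [norm_mul, Complex.norm_real, Real.norm_of_nonneg (hγ j i)]
  exact mul_le_mul_of_nonneg_left (hu j) (hγ j i)

lemma IsAdmissible.norm_den_le (h : IsAdmissible M q γ) (hr : 0 < r) {C Z : ℝ} (hZ : ‖z‖ ≤ Z)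
    (hu : ∀ k, ‖u k‖ ≤ C) (i : Fin N) : ‖den γ z u i‖ ≤ theta γ i * (Z + C) := by
  refine (norm_add_le _ _).trans ?_
  have h1 := norm_sum_mul_le h.nonneg hu i
  have h2 := h.one_le_theta hr i
  have h3 : ‖z‖ ≤ theta γ i * Z := hZ.trans (by nlinarith [(norm_nonneg z).trans hZ])
  linarith

lemma IsAdmissible.le_den_im (h : IsAdmissible M q γ) (hz : 0 ≤ z.im) {c : ℝ}
    (hu : ∀ k, c ≤ (u k).im) (i : Fin N) : theta γ i * c ≤ (den γ z u i).im := by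
  rw [den_im, theta, Finset.sum_mul]
  have : ∑ j, γ j i * c ≤ ∑ j, γ j i * (u j).im :=
    Finset.sum_le_sum fun j _ => mul_le_mul_of_nonneg_left (hu j) (h.nonneg j i)
  linarith

lemma IsAdmissible.norm_inv_den_le (h : IsAdmissible M q γ) (hr : 0 < r) (hz : 0 ≤ z.im) {c : ℝ}
    (hc : 0 < c) (hu : ∀ k, c ≤ (u k).im) (i : Fin N) :
    ‖-1 / den γ z u i‖ ≤ 1 / (theta γ i * c) :=
  norm_neg_one_div_le (mul_pos (zero_lt_one.trans_le (h.one_le_theta hr i)) hc)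
    (h.le_den_im hz hu i)

lemma le_neg_one_div_im {a : ℂ} {x y : ℝ} (hx : 0 < x) (ha : x ≤ a.im) (hy : ‖a‖ ≤ y) :
    x / y ^ 2 ≤ (-1 / a).im := by
  rw [neg_one_div_im]
  have h1 : 0 < ‖a‖ := norm_pos_iff.2 (ne_zero_of_im_pos (hx.trans_le ha))
  have h2 : 0 ≤ a.im := hx.le.trans ha
  gcongr

lemma IsAdmissible.norm_avg_le_of_le (h : IsAdmissible M q γ) (hN : 0 < N)
    {g : Fin N → ℂ} {C : ℝ} (hg : ∀ i, theta γ i * ‖g i‖ ≤ C) (k : Fin r) : ‖avg γ g k‖ ≤ C := by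
  have hN' : (0 : ℝ) < N := by exact_mod_cast hN
  refine (norm_avg_le h.nonneg g k).trans ?_
  calc _ ≤ (1 / (N : ℝ)) * ∑ _i : Fin N, C := by
        gcongr with i _
        exact (mul_le_mul_of_nonneg_right (h.le_theta k i) (norm_nonneg _)).trans (hg i)
    _ = C := by simp [hN'.ne']

/-- Stability of the self-consistent system: approximate solutions with imaginary part bounded
below are close to the exact one. -/
theorem stability (hr : 0 < r) {c Z : ℝ} (hM : 1 ≤ M) (hc : 0 < c) (hZ : 0 ≤ Z) :
    ∃ ψ₀ C : ℝ, 0 < ψ₀ ∧ 0 < C ∧ ∀ (N : ℕ) (γ : Fin r → Fin N → ℝ) (q : ℝ) (z : ℂ)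
      (u : Fin r → ℂ) (G err : Fin N → ℂ) (ψ : ℝ), 0 < N → IsAdmissible M q γ → 0 < z.im →
      ‖z‖ ≤ Z → dysonMap γ z u = u → (∀ k, c ≤ (u k).im) → (∀ k, c ≤ (avg γ G k).im) →
      (∀ i, G i * (den γ z (avg γ G) i + err i) = -1) → (∀ i, ‖err i‖ ≤ theta γ i * ψ) → 
      ψ ≤ ψ₀ → ∀ i, theta γ i * ‖G i - -1 / den γ z u i‖ ≤ C * ψ := by
  have hr' : (0 : ℝ) < r := by exact_mod_cast hr
  set B : ℝ := Z + 2 / c with hB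
  have hB0 : 0 < B := by positivity
  -- `B` bounds the denominators divided by `θ i`, hence `Im g i ≥ c / (B ^ 2 * θ i)`. With `γ ≥ 1`
  -- and `sum_inv_theta_sq`, `c₁` is a lower bound for the phase gap.
  set c₁ : ℝ := 2 * (c / B ^ 2) ^ 2 * (1 / (r * M)) with hc₁
  have hM0 : 0 < M := by linarith
  have hc₁0 : 0 < c₁ := by positivity
  -- The threshold `c / 2` keeps the perturbed denominators' imaginary parts above `θ i * c / 2`;
  -- the other one is `β / c ≤ c₁ / 2` for `β = 2 * ψ / c ^ 2`. In the constant, `2 / c ^ 2`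
  -- accounts for removing `err` from the denominator and `8 / (c₁ * c ^ 6)` for passing from `U` to
  -- `u`.
  refine ⟨min (c / 2) (c₁ * c ^ 3 / 4), 2 / c ^ 2 + 8 / (c₁ * c ^ 6),
    by positivity, by positivity, ?_⟩
  intro N γ q z u G err ψ hN h hz hzZ hu hcu hcG hG herr hψ i
  have hψ1 : ψ ≤ c / 2 := hψ.trans (min_le_left _ _)
  have hψ2 : ψ ≤ c₁ * c ^ 3 / 4 := hψ.trans (min_le_right _ _)
  have hθ1 := h.one_le_theta hr
  have hθ0 : ∀ i, 0 < theta γ i := fun i => zero_lt_one.trans_le (hθ1 i)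
  have hψ0 : 0 ≤ ψ := by
    have := (norm_nonneg _).trans (herr i)
    exact nonneg_of_mul_nonneg_right this (hθ0 i)
  set U := avg γ G with hU
  set g : Fin N → ℂ := fun i => -1 / den γ z u i with hg
  set g' : Fin N → ℂ := fun i => -1 / den γ z U i with hg'
  have hgn : ∀ i, theta γ i * ‖g i‖ ≤ 1 / c := fun i => by
    have h1 := h.norm_inv_den_le hr hz.le hc hcu i
    calc _ ≤ theta γ i * (1 / (theta γ i * c)) := by gcongr; exact (hθ0 i).le
      _ = 1 / c := by field_simp [(hθ0 i).ne']
  have hgn' : ∀ i, theta γ i * ‖g' i‖ ≤ 1 / c := fun i => by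
    have h1 := h.norm_inv_den_le hr hz.le hc hcG i
    calc _ ≤ theta γ i * (1 / (theta γ i * c)) := by gcongr; exact (hθ0 i).le
      _ = 1 / c := by field_simp [(hθ0 i).ne']
  have hGeq : ∀ i, G i = -1 / (den γ z U i + err i) := fun i => by
    have h0 : den γ z U i + err i ≠ 0 := by
      intro h0; have := hG i; rw [h0, mul_zero] at this; norm_num at this
    rw [eq_div_iff h0, hG i]
  have herrim : ∀ i, theta γ i * (c / 2) ≤ (den γ z U i + err i).im := fun i => by
    rw [Complex.add_im]
    have h1 := h.le_den_im hz.le hcG i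
    have h2 := (abs_le.1 ((Complex.abs_im_le_norm (err i)).trans (herr i))).1
    nlinarith [hθ0 i]
  have hGn : ∀ i, theta γ i * ‖G i‖ ≤ 2 / c := fun i => by
    have h1 := norm_neg_one_div_le (mul_pos (hθ0 i) (half_pos hc)) (herrim i)
    rw [← hGeq i] at h1
    calc _ ≤ theta γ i * (1 / (theta γ i * (c / 2))) := by gcongr; exact (hθ0 i).le
      _ = 2 / c := by field_simp [(hθ0 i).ne']
  -- The difference is `G * g' * err`: each of the two resolvent factors supplies `1 / θ i`, one of
  -- which cancels the `θ i` in the error and the other the outer weight.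
  have hGg' : ∀ i, theta γ i * ‖G i - g' i‖ ≤ 2 * ψ / c ^ 2 := fun i => by
    have e : G i - g' i = G i * g' i * err i := by
      have h1 : den γ z U i + err i ≠ 0 := ne_zero_of_im_pos
        ((mul_pos (hθ0 i) (half_pos hc)).trans_le (herrim i))
      have h2 : den γ z U i ≠ 0 := ne_zero_of_im_pos
        ((mul_pos (hθ0 i) hc).trans_le (h.le_den_im hz.le hcG i))
      rw [hGeq i, hg', neg_one_div_sub h1 h2]; ring
    rw [e, norm_mul, norm_mul]
    calc _ ≤ theta γ i * (‖G i‖ * ‖g' i‖ * (theta γ i * ψ)) := by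
          gcongr
          · exact (hθ0 i).le
          · exact herr i
      _ = (theta γ i * ‖G i‖) * (theta γ i * ‖g' i‖) * ψ := by ring
      _ ≤ (2 / c) * (1 / c) * ψ := by
          gcongr
          · have := hθ0 i; positivity
          · exact hGn i
          · exact hgn' i
      _ = _ := by field_simp
  have hUn : ∀ k, ‖U k‖ ≤ 2 / c := h.norm_avg_le_of_le hN hGn
  have hun : ∀ k, ‖u k‖ ≤ 2 / c := fun k => by
    have := h.norm_avg_le_of_le hN hgn k
    rw [show avg γ g k = u k from congrFun hu k] at this
    refine this.trans ?_
    gcongr; norm_num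
  have hUF : ∀ k, ‖U k - dysonMap γ z U k‖ ≤ 2 * ψ / c ^ 2 := fun k => by
    rw [dysonMap, hU, avg_sub]
    exact h.norm_avg_le_of_le hN hGg' k
  have himlow : ∀ (w : Fin r → ℂ), (∀ k, ‖w k‖ ≤ 2 / c) → (∀ k, c ≤ (w k).im) → ∀ i,
      c / B ^ 2 / theta γ i ≤ (-1 / den γ z w i).im := by
    intro w hw hwc i
    refine le_trans (le_of_eq ?_) (le_neg_one_div_im (mul_pos (hθ0 i) hc)
      (h.le_den_im hz.le hwc i) (h.norm_den_le hr hzZ hw i))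
    have := hθ0 i
    rw [← hB]
    field_simp
  have hgap : ∀ k, c₁ ≤ (1 / (N : ℝ)) * ∑ i, γ k i ^ 2 *
      (2 * ((-1 / den γ z u i).im * (-1 / den γ z U i).im)) := by
    intro k
    calc c₁ ≤ 2 * (c / B ^ 2) ^ 2 * ((1 / (N : ℝ)) * ∑ i, 1 / theta γ i ^ 2) := by
          rw [hc₁]; gcongr; exact h.sum_inv_theta_sq hr hN
      _ = (1 / (N : ℝ)) * ∑ i, 1 * (2 * ((c / B ^ 2 / theta γ i) * (c / B ^ 2 / theta γ i))) := by
          simp only [Finset.mul_sum]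
          exact Finset.sum_congr rfl fun i _ => by have := hθ0 i; field_simp
      _ ≤ _ := by
          gcongr with i _
          · have := hθ0 i; positivity
          · nlinarith [h.one_le k i]
          · have := hθ0 i; positivity
          · exact (le_trans (by have := hθ0 i; positivity) (himlow u hun hcu i))
          · exact himlow u hun hcu i
          · exact himlow U hUn hcG i
  have hT : ∀ k, √((u k).im * (U k).im) ≤ 2 / c := fun k => by
    have h1 : (u k).im ≤ 2 / c := (le_abs_self _).trans ((Complex.abs_im_le_norm _).trans (hun k))
    have h2 : (U k).im ≤ 2 / c := (le_abs_self _).trans ((Complex.abs_im_le_norm _).trans (hUn k))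
    refine Real.sqrt_le_iff.2 ⟨by positivity, ?_⟩
    rw [sq]
    exact mul_le_mul h1 h2 (hc.le.trans (hcG k)) (by positivity)
  have hβ : 2 * ψ / c ^ 2 / c ≤ c₁ / 2 := by
    rw [div_div, div_le_iff₀ (by positivity)]
    nlinarith
  have hcore := stability_core hN h.nonneg hz hu hc hc₁0 hUF hcu hcG hT hgap hβ
  have hgg' : theta γ i * ‖g' i - g i‖ ≤ 8 / (c₁ * c ^ 6) * ψ := by
    have h1 : den γ z U i ≠ 0 := ne_zero_of_im_pos
        ((mul_pos (hθ0 i) hc).trans_le (h.le_den_im hz.le hcG i))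
    have h2 : den γ z u i ≠ 0 := ne_zero_of_im_pos
        ((mul_pos (hθ0 i) hc).trans_le (h.le_den_im hz.le hcu i))
    rw [hg, hg', neg_one_div_sub h1 h2, den_sub, norm_mul, norm_mul]
    have h3 : ‖∑ j, (γ j i : ℂ) * (U j - u j)‖ ≤
        theta γ i * (2 * (2 * ψ / c ^ 2) / (c₁ * c) * (2 / c)) :=
      norm_sum_mul_le (u := fun j => U j - u j) h.nonneg
        (fun k => by rw [norm_sub_rev]; exact hcore k) i
    calc _ ≤ theta γ i * (‖g' i‖ * ‖g i‖ *
          (theta γ i * (2 * (2 * ψ / c ^ 2) / (c₁ * c) * (2 / c)))) := by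
          gcongr
          exact (hθ0 i).le
      _ = (theta γ i * ‖g' i‖) * (theta γ i * ‖g i‖) *
          (2 * (2 * ψ / c ^ 2) / (c₁ * c) * (2 / c)) := by ring
      _ ≤ (1 / c) * (1 / c) * (2 * (2 * ψ / c ^ 2) / (c₁ * c) * (2 / c)) := by
          gcongr
          · have := hθ0 i; positivity
          · exact hgn' i
          · exact hgn i
      _ = _ := by field_simp; ring
  calc _ ≤ theta γ i * (‖G i - g' i‖ + ‖g' i - g i‖) := by
        gcongr
        · exact (hθ0 i).le
        · exact norm_sub_le_norm_sub_add_norm_sub _ _ _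
    _ = theta γ i * ‖G i - g' i‖ + theta γ i * ‖g' i - g i‖ := by ring
    _ ≤ 2 * ψ / c ^ 2 + 8 / (c₁ * c ^ 6) * ψ := add_le_add (hGg' i) hgg'
    _ = _ := by ring

/-- Lower bound on `Im uₖ` at macroscopic distance from the real axis. -/
theorem exists_le_im_of_one_le_im (hr : 0 < r) {Z : ℝ} (hM : 1 ≤ M) (hZ : 0 ≤ Z) :
    ∃ c : ℝ, 0 < c ∧ ∀ (N : ℕ) (γ : Fin r → Fin N → ℝ) (q : ℝ) (z : ℂ) (u : Fin r → ℂ), 0 < N →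
      IsAdmissible M q γ → 1 ≤ z.im → ‖z‖ ≤ Z → IsSolution γ z u → ∀ k, c ≤ (u k).im := by
  have hr' : (0 : ℝ) < r := by exact_mod_cast hr
  have hM0 : 0 < M := by linarith
  refine ⟨1 / (Z + M) ^ 2 * (1 / (r * M)), by positivity, ?_⟩
  intro N γ q z u hN h hz hzZ hu k
  have hθ1 := h.one_le_theta hr
  have hθ0 : ∀ i, 0 < theta γ i := fun i => zero_lt_one.trans_le (hθ1 i)
  have hden : ∀ i, 1 ≤ (den γ z u i).im := fun i => by
    rw [den_im]
    have : 0 ≤ ∑ j, γ j i * (u j).im :=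
      Finset.sum_nonneg fun j _ => mul_nonneg (h.nonneg j i) (hu.1 j).le
    linarith
  have hfix : ∀ k, avg γ (fun i => -1 / den γ z u i) k = u k := congrFun hu.dysonMap_eq
  -- Denominators have imaginary part at least `1` here, so `u` is bounded. This bounds the
  -- denominators above, and hence the imaginary parts of their inverses below.
  have hun : ∀ k, ‖u k‖ ≤ M := fun k => by
    rw [← hfix k]
    refine (norm_avg_le h.nonneg _ k).trans (le_trans ?_ (h.mean_le k))
    gcongr with i _
    have := norm_neg_one_div_le zero_lt_one (hden i)
    nlinarith [h.pos k i]
  rw [← hfix k, avg_im]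
  calc _ ≤ 1 / (Z + M) ^ 2 * ((1 / (N : ℝ)) * ∑ i, 1 / theta γ i ^ 2) := by
        gcongr; exact h.sum_inv_theta_sq hr hN
    _ = (1 / (N : ℝ)) * ∑ i, 1 * (1 / (theta γ i * (Z + M)) ^ 2) := by
        simp only [Finset.mul_sum]
        exact Finset.sum_congr rfl fun i _ => by have := hθ0 i; field_simp
    _ ≤ _ := by
        gcongr with i _
        · exact h.nonneg k i
        · exact h.one_le k i
        · exact le_neg_one_div_im zero_lt_one (hden i) (h.norm_den_le hr hzZ hun i)

lemma mLim_eq (z : ℂ) :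
    mLim γ z = (1 / (N : ℂ)) * ∑ i, -1 / den γ z (solution γ z) i := by
  simp only [mLim, den]
  rw [neg_mul, ← mul_neg, ← Finset.sum_neg_distrib]
  congr 1
  exact Finset.sum_congr rfl fun i _ => by ring

/-- As `γ ≥ 1`, a `γ`-weighted average of positive numbers dominates the plain one. The bulk
hypothesis on `m` thus bounds every `Im uₖ` below. -/
lemma IsAdmissible.mLim_im_le (h : IsAdmissible M q γ) (hz : 0 < z.im)
    (hu : IsSolution γ z (solution γ z)) (k : Fin r) : (mLim γ z).im ≤ (solution γ z k).im := by
  have hfix := congrFun hu.dysonMap_eq k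
  rw [← hfix, dysonMap, avg_im, mLim_eq]
  have : (1 / (N : ℂ)) = ((1 / (N : ℝ) : ℝ) : ℂ) := by push_cast; rfl
  rw [this, Complex.im_ofReal_mul, Complex.im_sum]
  gcongr with i _
  have := neg_one_div_im_pos (den_im_pos h.nonneg hz (fun k => (hu.1 k).le) i)
  nlinarith [h.one_le k i]

end ChungLu

/-! ### Large deviations: Bernstein's inequality, linear and bilinear forms -/

namespace ChungLu

/-- A family of independent, centred, bounded random variables with given variance bounds. -/
structure IsNoise {Ω ι : Type*} [MeasurableSpace Ω] (P : Measure Ω) (X : ι → Ω → ℝ) (R : ℝ)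
    (v : ι → ℝ) : Prop where
  measurable : ∀ k, Measurable (X k)
  indep : iIndepFun X P
  bdd : ∀ k, ∀ᵐ ω ∂P, |X k ω| ≤ R
  mean : ∀ k, ∫ ω, X k ω ∂P = 0
  var : ∀ k, ∫ ω, X k ω ^ 2 ∂P ≤ v k

lemma IsNoise.var_nonneg {Ω ι : Type*} [MeasurableSpace Ω] {P : Measure Ω} {X : ι → Ω → ℝ}
    {R : ℝ} {v : ι → ℝ} (hX : IsNoise P X R v) (k : ι) : 0 ≤ v k :=
  (integral_nonneg fun _ => sq_nonneg _).trans (hX.var k)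

section LargeDeviation

variable {Ω ι ι' : Type*} [MeasurableSpace Ω] {P : Measure Ω} [IsProbabilityMeasure P]
  [Fintype ι] [Fintype ι'] {X : ι → Ω → ℝ} {Y : ι' → Ω → ℝ} {R : ℝ} {v : ι → ℝ} {w : ι' → ℝ}

lemma integrable_of_abs_le {f : Ω → ℝ} (hf : Measurable f) {C : ℝ} (h : ∀ᵐ ω ∂P, |f ω| ≤ C) :
    Integrable f P :=
  Integrable.of_bound hf.aestronglyMeasurable C (by simpa using h)

/-- `exp x ≤ 1 + x + x ^ 2` for `|x| ≤ 1`; centring removes the linear term. -/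
lemma mgf_le_exp {f : Ω → ℝ} (hf : Measurable f) {R v b : ℝ} (hbdd : ∀ᵐ ω ∂P, |f ω| ≤ R)
    (hmean : ∫ ω, f ω ∂P = 0) (hvar : ∫ ω, f ω ^ 2 ∂P ≤ v) (hb : |b| * R ≤ 1) :
    mgf (fun ω => b * f ω) P 1 ≤ Real.exp (v * b ^ 2) := by
  have hle : ∀ᵐ ω ∂P, |b * f ω| ≤ 1 := by
    filter_upwards [hbdd] with ω hω
    rw [abs_mul]
    exact (mul_le_mul_of_nonneg_left hω (abs_nonneg b)).trans hb
  have hi1 : Integrable (fun ω => b * f ω) P := integrable_of_abs_le (by fun_prop) hle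
  have hi2 : Integrable (fun ω => (b * f ω) ^ 2) P := by
    refine integrable_of_abs_le (C := 1) (by fun_prop) ?_
    filter_upwards [hle] with ω hω
    rw [abs_pow]
    exact pow_le_one₀ (abs_nonneg _) hω
  have hi3 : Integrable (fun ω => Real.exp (1 * (b * f ω))) P := by
    refine integrable_of_abs_le (C := Real.exp 1) (by fun_prop) ?_
    filter_upwards [hle] with ω hω
    rw [Real.abs_exp, one_mul]
    exact Real.exp_le_exp.2 ((le_abs_self _).trans hω)
  calc mgf (fun ω => b * f ω) P 1 ≤ ∫ ω, (1 + b * f ω + (b * f ω) ^ 2) ∂P := by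
        refine integral_mono_ae hi3 (((integrable_const _).add hi1).add hi2) ?_
        filter_upwards [hle] with ω hω
        have := (abs_le.1 (Real.abs_exp_sub_one_sub_id_le hω)).2
        simp only [one_mul]
        linarith
    _ = 1 + b ^ 2 * ∫ ω, f ω ^ 2 ∂P := by
        rw [integral_add (by exact (integrable_const _).add hi1) hi2,
          integral_add (integrable_const _) hi1, integral_const_mul, hmean]
        simp only [mul_pow, integral_const_mul]
        simp
    _ ≤ v * b ^ 2 + 1 := by nlinarith [sq_nonneg b]
    _ ≤ _ := Real.add_one_le_exp _

/-- Bernstein's inequality. -/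
lemma IsNoise.chernoff (hX : IsNoise P X R v) (a : ι → ℝ) {A t : ℝ} (hA : 0 < A)
    (ha : ∀ k, |a k| * R ≤ A) (hv : ∑ k, v k * a k ^ 2 ≤ A ^ 2) :
    P.real {ω | t * A ≤ ∑ k, a k * X k ω} ≤ Real.exp (1 - t) := by
  -- After division by `A`, which dominates both the sup and the standard deviation, the exponential
  -- parameter can be `1`: the moment generating function is at most `e`, whence the bound `exp (1 -
  -- t)`.
  set Z : ι → Ω → ℝ := fun k ω => a k / A * X k ω with hZ
  have hZm : ∀ k, Measurable (Z k) := fun k => (hX.measurable k).const_mul _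
  have hZi : iIndepFun Z P := hX.indep.comp (fun k x => a k / A * x) fun k => by fun_prop
  have hb : ∀ k, |a k / A| * R ≤ 1 := fun k => by
    rw [abs_div, abs_of_pos hA, div_mul_eq_mul_div, div_le_one hA]; exact ha k
  have hmgf : mgf (∑ k, Z k) P 1 ≤ Real.exp 1 := by
    rw [hZi.mgf_sum hZm]
    calc _ ≤ ∏ k, Real.exp (v k * (a k / A) ^ 2) :=
          Finset.prod_le_prod (fun k _ => mgf_nonneg) fun k _ =>
            mgf_le_exp (hX.measurable k) (hX.bdd k) (hX.mean k) (hX.var k) (hb k)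
      _ = Real.exp (∑ k, v k * (a k / A) ^ 2) := (Real.exp_sum _ _).symm
      _ ≤ _ := by
          apply Real.exp_le_exp.2
          rw [← div_self (pow_pos hA 2).ne', le_div_iff₀ (pow_pos hA 2), Finset.sum_mul]
          refine le_trans (le_of_eq (Finset.sum_congr rfl fun k _ => ?_)) hv
          field_simp
  have hint : Integrable (fun ω => Real.exp (1 * (∑ k, Z k) ω)) P := by
    have hall : ∀ᵐ ω ∂P, ∀ k, |X k ω| ≤ R := ae_all_iff.2 hX.bdd
    refine integrable_of_abs_le (C := Real.exp (∑ k, |a k / A| * R)) ?_ ?_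
    · simp only [Finset.sum_apply]; fun_prop
    · filter_upwards [hall] with ω hω
      rw [Real.abs_exp, one_mul, Finset.sum_apply]
      refine Real.exp_le_exp.2 (Finset.sum_le_sum fun k _ => (le_abs_self _).trans ?_)
      rw [hZ, abs_mul]
      exact mul_le_mul_of_nonneg_left (hω k) (abs_nonneg _)
  have hset : {ω | t * A ≤ ∑ k, a k * X k ω} = {ω | t ≤ (∑ k, Z k) ω} := by
    ext ω
    simp only [Set.mem_ofPred_eq, Finset.sum_apply, hZ]
    rw [← le_div_iff₀ hA, Finset.sum_div]
    simp only [div_mul_eq_mul_div]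
  rw [hset]
  refine (measure_ge_le_exp_mul_mgf t zero_le_one hint).trans ?_
  rw [show 1 - t = -1 * t + 1 by ring, Real.exp_add]
  gcongr

/-- Large deviation estimate for linear forms with deterministic complex coefficients. -/
lemma IsNoise.linear (hX : IsNoise P X R v) (hR : 0 < R) {C t : ℝ} (hC : 0 < C)
    (a : ι → ℂ) (ha : ∀ k, ‖a k‖ ≤ C) :
    P.real {ω | 2 * t * (√(∑ k, v k * ‖a k‖ ^ 2) + C * R) ≤ ‖∑ k, a k * (X k ω : ℂ)‖} ≤
      4 * Real.exp (1 - t) := by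
  set A := √(∑ k, v k * ‖a k‖ ^ 2) + C * R with hA
  have hs0 : 0 ≤ ∑ k, v k * ‖a k‖ ^ 2 :=
    Finset.sum_nonneg fun k _ => mul_nonneg (hX.var_nonneg k) (sq_nonneg _)
  have hA0 : 0 < A := by positivity
  have key : ∀ b : ι → ℝ, (∀ k, |b k| ≤ ‖a k‖) →
      P.real {ω | t * A ≤ ∑ k, b k * X k ω} ≤ Real.exp (1 - t) := by
    intro b hb
    refine hX.chernoff b hA0 (fun k => ?_) ?_
    · calc |b k| * R ≤ C * R := by gcongr; exact (hb k).trans (ha k)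
        _ ≤ A := le_add_of_nonneg_left (Real.sqrt_nonneg _)
    · calc ∑ k, v k * b k ^ 2 ≤ ∑ k, v k * ‖a k‖ ^ 2 := by
            refine Finset.sum_le_sum fun k _ => mul_le_mul_of_nonneg_left ?_ (hX.var_nonneg k)
            rw [← sq_abs (b k)]; exact pow_le_pow_left₀ (abs_nonneg _) (hb k) 2
        _ = √(∑ k, v k * ‖a k‖ ^ 2) ^ 2 := (Real.sq_sqrt hs0).symm
        _ ≤ A ^ 2 := by gcongr; exact le_add_of_nonneg_right (by positivity)
  -- Real and imaginary parts, each with both signs: four events, and a factor `2` from `‖w‖ ≤ |Re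
  -- w| + |Im w|`.
  have h1 := key (fun k => (a k).re) fun k => Complex.abs_re_le_norm _
  have h2 := key (fun k => (a k).im) fun k => Complex.abs_im_le_norm _
  have h3 := key (fun k => -(a k).re) fun k => by rw [abs_neg]; exact Complex.abs_re_le_norm _
  have h4 := key (fun k => -(a k).im) fun k => by rw [abs_neg]; exact Complex.abs_im_le_norm _
  set S1 := {ω | t * A ≤ ∑ k, (a k).re * X k ω}
  set S2 := {ω | t * A ≤ ∑ k, (a k).im * X k ω}
  set S3 := {ω | t * A ≤ ∑ k, -(a k).re * X k ω}
  set S4 := {ω | t * A ≤ ∑ k, -(a k).im * X k ω}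
  have hsub : {ω | 2 * t * A ≤ ‖∑ k, a k * (X k ω : ℂ)‖} ⊆ (S1 ∪ S3) ∪ (S2 ∪ S4) := by
    intro ω hω
    simp only [Set.mem_ofPred_eq] at hω
    by_contra hcon
    simp only [Set.mem_union, not_or, S1, S2, S3, S4, Set.mem_ofPred_eq, not_le, neg_mul,
      Finset.sum_neg_distrib] at hcon
    obtain ⟨⟨c1, c3⟩, c2, c4⟩ := hcon
    have e1 : (∑ k, a k * (X k ω : ℂ)).re = ∑ k, (a k).re * X k ω := by simp [Complex.re_sum]
    have e2 : (∑ k, a k * (X k ω : ℂ)).im = ∑ k, (a k).im * X k ω := by simp [Complex.im_sum]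
    have := Complex.norm_le_abs_re_add_abs_im (∑ k, a k * (X k ω : ℂ))
    rw [e1, e2] at this
    have d1 : |∑ k, (a k).re * X k ω| < t * A := abs_lt.2 ⟨by linarith, c1⟩
    have d2 : |∑ k, (a k).im * X k ω| < t * A := abs_lt.2 ⟨by linarith, c2⟩
    linarith
  calc _ ≤ P.real ((S1 ∪ S3) ∪ (S2 ∪ S4)) := measureReal_mono hsub
    _ ≤ (P.real S1 + P.real S3) + (P.real S2 + P.real S4) :=
        (measureReal_union_le _ _).trans
          (add_le_add (measureReal_union_le _ _) (measureReal_union_le _ _))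
    _ ≤ _ := by linarith

/-- A bound on the probability of an event, uniform in the value of an independent variable. -/
lemma measureReal_le_of_indepFun {α β : Type*} [MeasurableSpace α] [MeasurableSpace β]
    {f : Ω → α} {g : Ω → β} (hf : Measurable f) (hg : Measurable g) (hfg : IndepFun f g P)
    {S : Set (α × β)} (hS : MeasurableSet S) {p : ℝ} 
    (h : ∀ y, P.real {ω | (f ω, y) ∈ S} ≤ p) : P.real {ω | (f ω, g ω) ∈ S} ≤ p := by
  have hp : 0 ≤ p := by
    obtain ⟨ω⟩ : Nonempty Ω := nonempty_of_isProbabilityMeasure P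
    exact measureReal_nonneg.trans (h (g ω))
  rw [measureReal_def]
  refine ENNReal.toReal_le_of_le_ofReal hp ?_
  have e : P {ω | (f ω, g ω) ∈ S} = (P.map fun ω => (f ω, g ω)) S := by
    rw [Measure.map_apply (hf.prodMk hg) hS]; rfl
  rw [e, (indepFun_iff_map_prod_eq_prod_map_map hf.aemeasurable hg.aemeasurable).1 hfg]
  have : IsProbabilityMeasure (P.map f) := Measure.isProbabilityMeasure_map hf.aemeasurable
  have : IsProbabilityMeasure (P.map g) := Measure.isProbabilityMeasure_map hg.aemeasurable
  rw [Measure.prod_apply_symm hS]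
  calc _ ≤ ∫⁻ _y, ENNReal.ofReal p ∂(P.map g) := by
        refine lintegral_mono fun y => ?_
        rw [Measure.map_apply hf (measurable_prodMk_right hS)]
        refine (ENNReal.le_ofReal_iff_toReal_le (measure_ne_top _ _) hp).2 (h y)
    _ = _ := by simp

/-- Large deviation estimate for linear forms with independent random coefficients. -/
lemma IsNoise.linear_random (hX : IsNoise P X R v) (hR : 0 < R) {C t : ℝ} (hC : 0 < C)
    {a : ι → Ω → ℂ} (ham : ∀ k, Measurable (a k))
    (hind : IndepFun (fun ω k => X k ω) (fun ω k => a k ω) P) :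
    P.real {ω | (∀ k, ‖a k ω‖ ≤ C) ∧
      2 * t * (√(∑ k, v k * ‖a k ω‖ ^ 2) + C * R) ≤ ‖∑ k, a k ω * (X k ω : ℂ)‖} ≤
      4 * Real.exp (1 - t) := by
  -- The coefficient bound belongs to the event, so that for frozen coefficients the slice is either
  -- empty or covered by the deterministic estimate.
  set S : Set ((ι → ℝ) × (ι → ℂ)) := {p | (∀ k, ‖p.2 k‖ ≤ C) ∧
      2 * t * (√(∑ k, v k * ‖p.2 k‖ ^ 2) + C * R) ≤ ‖∑ k, p.2 k * (p.1 k : ℂ)‖} with hSdef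
  have hS : MeasurableSet S := by
    have e : S = (⋂ k, {p : (ι → ℝ) × (ι → ℂ) | ‖p.2 k‖ ≤ C}) ∩
        {p | 2 * t * (√(∑ k, v k * ‖p.2 k‖ ^ 2) + C * R) ≤ ‖∑ k, p.2 k * (p.1 k : ℂ)‖} := by
      ext p; simp [hSdef]
    rw [e]
    exact (MeasurableSet.iInter fun k => measurableSet_le (by fun_prop) (by fun_prop)).inter
      (measurableSet_le (by fun_prop) (by fun_prop))
  refine measureReal_le_of_indepFun (S := S) (measurable_pi_iff.2 hX.measurable)
    (measurable_pi_iff.2 ham) hind hS fun y => ?_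
  by_cases hy : ∀ k, ‖y k‖ ≤ C
  · refine le_trans (measureReal_mono fun ω hω => hω.2) (hX.linear hR hC y hy)
  · have : {ω | ((fun k => X k ω), y) ∈ S} = ∅ := by
      ext ω; simp [hSdef, hy]
    rw [this]; simp [Real.exp_nonneg]

set_option maxHeartbeats 400000 in
/-- Large deviation estimate for bilinear forms in two independent families. -/
lemma IsNoise.bilinear (hX : IsNoise P X R v) (hY : IsNoise P Y R w) (hR : 0 < R) {C t : ℝ}
    (hC : 0 < C) (ht : 0 < t) (hind : IndepFun (fun ω k => X k ω) (fun ω k => Y k ω) P)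
    (B : ι → ι' → ℂ) (hB : ∀ k l, ‖B k l‖ ≤ C) :
    P.real {ω | 6 * t ^ 2 * (√(∑ k, ∑ l, v k * w l * ‖B k l‖ ^ 2) + C * R * √(∑ k, v k) +
      C * R * √(∑ l, w l) + C * R ^ 2) ≤ ‖∑ k, ∑ l, B k l * (X k ω * Y l ω : ℂ)‖} ≤
      (Fintype.card ι + 1) * (4 * Real.exp (1 - t)) := by
  set F := √(∑ k, ∑ l, v k * w l * ‖B k l‖ ^ 2)
  set V := ∑ k, v k
  set W := ∑ l, w l
  have hV : 0 ≤ V := Finset.sum_nonneg fun k _ => hX.var_nonneg k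
  have hW : 0 ≤ W := Finset.sum_nonneg fun k _ => hY.var_nonneg k
  set σ : ι → ℝ := fun k => √(∑ l, w l * ‖B k l‖ ^ 2) with hσ
  have hσsq : ∀ k, σ k ^ 2 = ∑ l, w l * ‖B k l‖ ^ 2 := fun k =>
    Real.sq_sqrt (Finset.sum_nonneg fun l _ => mul_nonneg (hY.var_nonneg l) (sq_nonneg _))
  have hσle : ∀ k, σ k ≤ C * √W := fun k => by
    refine Real.sqrt_le_iff.2 ⟨by positivity, ?_⟩
    rw [mul_pow, Real.sq_sqrt hW, mul_comm, Finset.sum_mul]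
    gcongr with l _
    · exact hY.var_nonneg l
    · exact hB k l
  have hFsq : F ^ 2 = ∑ k, v k * σ k ^ 2 := by
    rw [Real.sq_sqrt]
    · refine Finset.sum_congr rfl fun k _ => ?_
      rw [hσsq, Finset.mul_sum]
      exact Finset.sum_congr rfl fun l _ => by ring
    · exact Finset.sum_nonneg fun k _ => Finset.sum_nonneg fun l _ =>
        mul_nonneg (mul_nonneg (hX.var_nonneg k) (hY.var_nonneg l)) (sq_nonneg _)
  set a : ι → Ω → ℂ := fun k ω => ∑ l, B k l * (Y l ω : ℂ) with ha
  have ham : ∀ k, Measurable (a k) := fun k => by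
    have := hY.measurable
    simp only [ha]; fun_prop
  have hinda : IndepFun (fun ω k => X k ω) (fun ω k => a k ω) P := by
    have := hind.comp (φ := id) (ψ := fun (y : ι' → ℝ) k => ∑ l, B k l * (y l : ℂ)) measurable_id
      (by fun_prop)
    exact this
  -- The form is linear in `X` with the inner sums over `Y` as random coefficients. Off the events
  -- `E1` these are bounded by `C'`, which serves as the sup bound in the outer estimate; the count
  -- `card ι + 1` is one event per inner sum plus the outer one.
  set C' := 2 * t * (C * √W + C * R) with hC'
  have hC'0 : 0 < C' := by positivity
  set E1 : ι → Set Ω := fun k => {ω | 2 * t * (σ k + C * R) ≤ ‖a k ω‖}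
  set E2 : Set Ω := {ω | (∀ k, ‖a k ω‖ ≤ C') ∧
      2 * t * (√(∑ k, v k * ‖a k ω‖ ^ 2) + C' * R) ≤ ‖∑ k, a k ω * (X k ω : ℂ)‖}
  have h1 : ∀ k, P.real (E1 k) ≤ 4 * Real.exp (1 - t) := fun k =>
    hY.linear hR hC (B k) (hB k)
  have h2 : P.real E2 ≤ 4 * Real.exp (1 - t) := hX.linear_random hR hC'0 ham hinda
  have hsub : {ω | 6 * t ^ 2 * (F + C * R * √V + C * R * √W + C * R ^ 2) ≤
      ‖∑ k, ∑ l, B k l * (X k ω * Y l ω : ℂ)‖} ⊆ (⋃ k, E1 k) ∪ E2 := by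
    intro ω hω
    by_contra hcon
    simp only [Set.mem_union, Set.mem_iUnion, not_or, not_exists, E1, Set.mem_ofPred_eq,
      not_le] at hcon
    obtain ⟨c1, c2⟩ := hcon
    have hsum : ∑ k, ∑ l, B k l * (X k ω * Y l ω : ℂ) = ∑ k, a k ω * (X k ω : ℂ) := by
      refine Finset.sum_congr rfl fun k _ => ?_
      simp only [ha, Finset.sum_mul]
      exact Finset.sum_congr rfl fun l _ => by ring
    simp only [Set.mem_ofPred_eq, hsum] at hω
    have c2' : ∀ k, ‖a k ω‖ ≤ C' := fun k => (c1 k).le.trans (by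
      rw [hC']; gcongr; exact hσle k)
    have c3 : ‖∑ k, a k ω * (X k ω : ℂ)‖ < 2 * t * (√(∑ k, v k * ‖a k ω‖ ^ 2) + C' * R) := by
      by_contra h; exact c2 ⟨c2', not_lt.1 h⟩
    have hF0 : 0 ≤ F := Real.sqrt_nonneg _
    have c4 : √(∑ k, v k * ‖a k ω‖ ^ 2) ≤ 3 * t * (F + C * R * √V) := by
      refine Real.sqrt_le_iff.2 ⟨by positivity, ?_⟩
      calc ∑ k, v k * ‖a k ω‖ ^ 2 ≤ ∑ k, v k * (8 * t ^ 2 * (σ k ^ 2 + (C * R) ^ 2)) := by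
            gcongr with k _
            · exact hX.var_nonneg k
            · calc ‖a k ω‖ ^ 2 ≤ (2 * t * (σ k + C * R)) ^ 2 := by gcongr; exact (c1 k).le
                _ = 4 * t ^ 2 * (σ k + C * R) ^ 2 := by ring
                _ ≤ 4 * t ^ 2 * (2 * (σ k ^ 2 + (C * R) ^ 2)) := by
                    gcongr; nlinarith [sq_nonneg (σ k - C * R)]
                _ = _ := by ring
        _ = 8 * t ^ 2 * (∑ k, v k * σ k ^ 2 + (C * R) ^ 2 * V) := by
            simp only [V, Finset.mul_sum, mul_add, ← Finset.sum_add_distrib]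
            exact Finset.sum_congr rfl fun k _ => by ring
        _ = 8 * t ^ 2 * (F ^ 2 + (C * R * √V) ^ 2) := by
            rw [hFsq, mul_pow (C * R), Real.sq_sqrt hV]
        _ ≤ _ := by
            have h0 : 0 ≤ F * (C * R * √V) := by positivity
            have h5 : F ^ 2 + (C * R * √V) ^ 2 ≤ (F + C * R * √V) ^ 2 := by nlinarith
            rw [mul_pow (3 * t)]
            refine mul_le_mul ?_ h5 (by positivity) (by positivity)
            rw [mul_pow]
            exact mul_le_mul_of_nonneg_right (by norm_num) (sq_nonneg t)
    have c5 : 2 * t * (√(∑ k, v k * ‖a k ω‖ ^ 2) + C' * R) ≤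
        6 * t ^ 2 * (F + C * R * √V + C * R * √W + C * R ^ 2) := by
      calc _ ≤ 2 * t * (3 * t * (F + C * R * √V) + C' * R) := by gcongr
        _ = 6 * t ^ 2 * (F + C * R * √V) + 4 * t ^ 2 * (C * R * √W + C * R ^ 2) := by
            rw [hC']; ring
        _ ≤ 6 * t ^ 2 * (F + C * R * √V) + 6 * t ^ 2 * (C * R * √W + C * R ^ 2) := by
            gcongr; norm_num
        _ = _ := by ring
    linarith
  calc _ ≤ P.real ((⋃ k, E1 k) ∪ E2) := measureReal_mono hsub
    _ ≤ ∑ k, P.real (E1 k) + P.real E2 :=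
        (measureReal_union_le _ _).trans (add_le_add (measureReal_iUnion_fintype_le _) le_rfl)
    _ ≤ ∑ _k : ι, 4 * Real.exp (1 - t) + 4 * Real.exp (1 - t) :=
        add_le_add (Finset.sum_le_sum fun k _ => h1 k) h2
    _ = _ := by simp; ring

end LargeDeviation

end ChungLu

/-! ### Large deviations: decoupling and quadratic forms -/

namespace ChungLu

section Indicator

variable {Ω ι : Type*} [MeasurableSpace Ω] {P : Measure Ω} {X : ι → Ω → ℝ} {R : ℝ} {v : ι → ℝ}

/-- The variances in `IsNoise` are only upper bounds, so entries may be set to zero. Sub-families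
thereby keep the same index type. -/
lemma IsNoise.indicator (hX : IsNoise P X R v) (hR : 0 ≤ R) (p : ι → Prop) [DecidablePred p] :
    IsNoise P (fun k ω => if p k then X k ω else 0) R v where
  measurable k := by split_ifs <;> [exact hX.measurable k; exact measurable_const]
  indep := hX.indep.comp (fun k x => if p k then x else 0) fun k => by
    by_cases h : p k <;> simp only [h, if_true, if_false] <;> fun_prop
  bdd k := by
    by_cases h : p k
    · simpa [h] using hX.bdd k
    · simp [h, hR]
  mean k := by
    by_cases h : p k
    · simpa [h] using hX.mean k
    · simp [h]
  var k := by
    by_cases h : p k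
    · simpa [h] using hX.var k
    · simpa [h] using hX.var_nonneg k

/-- Both zero-extended vectors are measurable functions of disjoint blocks of an independent family.
-/
lemma IsNoise.indepFun_indicator [Fintype ι] (hX : IsNoise P X R v) (p p' : ι → Prop) [DecidablePred p]
    [DecidablePred p'] (h : ∀ k, p k → ¬ p' k) :
    IndepFun (fun ω k => if p k then X k ω else 0) (fun ω k => if p' k then X k ω else 0) P := by
  classical
  have hdisj : Disjoint (Finset.univ.filter p) (Finset.univ.filter p') := by
    rw [Finset.disjoint_left]; simpa using h
  have h1 := hX.indep.indepFun_finset _ _ hdisj hX.measurable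
  have key : ∀ (s : ι → Prop) [DecidablePred s], ∃ φ : (Finset.univ.filter s → ℝ) → ι → ℝ,
      Measurable φ ∧ ∀ ω, φ (fun k => X k ω) = fun k => if s k then X k ω else 0 := by
    intro s _
    refine ⟨fun y k => if hk : s k then y ⟨k, by simpa using hk⟩ else 0, ?_, ?_⟩
    · refine measurable_pi_iff.2 fun k => ?_
      by_cases hk : s k
      · simp only [hk, dif_pos]; fun_prop
      · simp only [hk, dif_neg, not_false_eq_true]; fun_prop
    · intro ω; funext k
      by_cases hk : s k <;> simp [hk]
  obtain ⟨φ, hφm, hφ⟩ := key p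
  obtain ⟨ψ, hψm, hψ⟩ := key p'
  have h2 := h1.comp hφm hψm
  have e1 : φ ∘ (fun ω (k : Finset.univ.filter p) => X k ω) =
      fun ω k => if p k then X k ω else 0 := funext hφ
  have e2 : ψ ∘ (fun ω (k : Finset.univ.filter p') => X k ω) =
      fun ω k => if p' k then X k ω else 0 := funext hψ
  rwa [e1, e2] at h2

end Indicator

section LargeDeviation

variable {Ω ι ι' : Type*} [MeasurableSpace Ω] {P : Measure Ω} [IsProbabilityMeasure P]
  [Fintype ι] [Fintype ι'] {X : ι → Ω → ℝ} {Y : ι' → Ω → ℝ} {R : ℝ} {v : ι → ℝ} {w : ι' → ℝ}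

/-- Large deviation estimate for bilinear forms with independent random coefficients. -/
lemma IsNoise.bilinear_random (hX : IsNoise P X R v) (hY : IsNoise P Y R w) (hR : 0 < R) {C t : ℝ}
    (hC : 0 < C) (ht : 0 < t) (hind : IndepFun (fun ω k => X k ω) (fun ω k => Y k ω) P)
    {B : ι → ι' → Ω → ℂ} (hBm : ∀ k l, Measurable (B k l))
    (hindB : IndepFun (fun ω => (fun k => X k ω, fun k => Y k ω)) (fun ω k l => B k l ω) P) :
    P.real {ω | (∀ k l, ‖B k l ω‖ ≤ C) ∧
      6 * t ^ 2 * (√(∑ k, ∑ l, v k * w l * ‖B k l ω‖ ^ 2) + C * R * √(∑ k, v k) +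
      C * R * √(∑ l, w l) + C * R ^ 2) ≤ ‖∑ k, ∑ l, B k l ω * (X k ω * Y l ω : ℂ)‖} ≤
      (Fintype.card ι + 1) * (4 * Real.exp (1 - t)) := by
  set S : Set (((ι → ℝ) × (ι' → ℝ)) × (ι → ι' → ℂ)) := {p | (∀ k l, ‖p.2 k l‖ ≤ C) ∧
      6 * t ^ 2 * (√(∑ k, ∑ l, v k * w l * ‖p.2 k l‖ ^ 2) + C * R * √(∑ k, v k) +
      C * R * √(∑ l, w l) + C * R ^ 2) ≤ ‖∑ k, ∑ l, p.2 k l * (p.1.1 k * p.1.2 l : ℂ)‖} with hSdef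
  have hS : MeasurableSet S := by
    have e : S = (⋂ k, ⋂ l, {p : ((ι → ℝ) × (ι' → ℝ)) × (ι → ι' → ℂ) | ‖p.2 k l‖ ≤ C}) ∩
        {p | 6 * t ^ 2 * (√(∑ k, ∑ l, v k * w l * ‖p.2 k l‖ ^ 2) + C * R * √(∑ k, v k) +
      C * R * √(∑ l, w l) + C * R ^ 2) ≤ ‖∑ k, ∑ l, p.2 k l * (p.1.1 k * p.1.2 l : ℂ)‖} := by
      ext p; simp [hSdef]
    rw [e]
    exact (MeasurableSet.iInter fun k => MeasurableSet.iInter fun l =>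
      measurableSet_le (by fun_prop) (by fun_prop)).inter
      (measurableSet_le (by fun_prop) (by fun_prop))
  refine measureReal_le_of_indepFun (S := S)
    ((measurable_pi_iff.2 hX.measurable).prodMk (measurable_pi_iff.2 hY.measurable))
    (measurable_pi_iff.2 fun k => measurable_pi_iff.2 (hBm k)) hindB hS fun y => ?_
  by_cases hy : ∀ k l, ‖y k l‖ ≤ C
  · refine le_trans (measureReal_mono fun ω hω => hω.2) (hX.bilinear hY hR hC ht hind y hy)
  · have : {ω | (((fun k => X k ω), fun k => Y k ω), y) ∈ S} = ∅ := by
      ext ω; simp only [hSdef, Set.mem_ofPred_eq, Set.mem_empty_iff_false, iff_false]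
      exact fun h => hy h.1
    have h0 : 0 ≤ (Fintype.card ι + 1) * (4 * Real.exp (1 - t)) := by positivity
    rw [this]; simpa using h0

/-- Digits from position `L` on vanish for numbers below `2 ^ L`, so about `log₂ N` digits separate
all indices; this is the price of decoupling. -/
lemma exists_testBit_ne {L : ℕ} {k l : ℕ} (hk : k < 2 ^ L) (hl : l < 2 ^ L) (h : k ≠ l) :
    ∃ b < L, k.testBit b ≠ l.testBit b := by
  by_contra! hcon
  refine h (Nat.eq_of_testBit_eq fun b => ?_)
  rcases lt_or_ge b L with hb | hb
  · exact hcon b hb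
  · rw [Nat.testBit_lt_two_pow (hk.trans_le (Nat.pow_le_pow_right (by norm_num) hb)),
      Nat.testBit_lt_two_pow (hl.trans_le (Nat.pow_le_pow_right (by norm_num) hb))]

/-- Large deviation estimate for off-diagonal quadratic forms: each pair of distinct indices
differs in some binary digit, and for each digit the form becomes bilinear in two independent
families. -/
lemma IsNoise.offDiag {N L : ℕ} {X : Fin N → Ω → ℝ} {v : Fin N → ℝ} (hL : N ≤ 2 ^ L)
    (hX : IsNoise P X R v) (hR : 0 < R) {C t : ℝ} (hC : 0 < C) (ht : 0 < t)
    (B : Fin N → Fin N → ℂ) (hB : ∀ k l, ‖B k l‖ ≤ C) :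
    P.real {ω | L * (12 * t ^ 2 * (√(∑ k, ∑ l, v k * v l * ‖B k l‖ ^ 2) +
      2 * (C * R * √(∑ k, v k)) + C * R ^ 2)) <
      ‖∑ k, ∑ l, (if k ≠ l then B k l else 0) * (X k ω * X l ω : ℂ)‖} ≤
      L * (2 * ((N + 1) * (4 * Real.exp (1 - t)))) := by
  classical
  have hex : ∀ k l : Fin N, ∃ b : ℕ, k ≠ l → b < L ∧ (k : ℕ).testBit b ≠ (l : ℕ).testBit b := by
    intro k l
    by_cases h : k = l
    · exact ⟨0, fun h' => absurd h h'⟩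
    · obtain ⟨b, hb⟩ := exists_testBit_ne (k.2.trans_le hL) (l.2.trans_le hL)
        (fun h' => h (Fin.ext h'))
      exact ⟨b, fun _ => hb⟩
  choose d hd using hex
  set F := √(∑ k, ∑ l, v k * v l * ‖B k l‖ ^ 2)
  set V := ∑ k, v k
  -- Each pair is assigned to one chosen separating digit, so that it is counted once even if
  -- several digits differ.
  set B' : ℕ → Fin N → Fin N → ℂ := fun b k l => if k ≠ l ∧ d k l = b then B k l else 0 with hB'
  set X1 : ℕ → Bool → Fin N → Ω → ℝ :=
    fun b s k ω => if (k : ℕ).testBit b = s then X k ω else 0 with hX1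
  set X2 : ℕ → Bool → Fin N → Ω → ℝ :=
    fun b s k ω => if ¬ (k : ℕ).testBit b = s then X k ω else 0 with hX2
  have hB'n : ∀ b k l, ‖B' b k l‖ ≤ ‖B k l‖ := fun b k l => by
    simp only [hB']; split_ifs <;> simp
  set E : ℕ → Bool → Set Ω := fun b s => {ω | 6 * t ^ 2 * (F + 2 * (C * R * √V) + C * R ^ 2) ≤
    ‖∑ k, ∑ l, B' b k l * (X1 b s k ω * X2 b s l ω : ℂ)‖} with hE
  have hEb : ∀ b s, P.real (E b s) ≤ (N + 1) * (4 * Real.exp (1 - t)) := by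
    intro b s
    have h1 := hX.indicator hR.le (fun k => (k : ℕ).testBit b = s)
    have h2 := hX.indicator hR.le (fun k => ¬ (k : ℕ).testBit b = s)
    have h3 := hX.indepFun_indicator (fun k => (k : ℕ).testBit b = s)
      (fun k => ¬ (k : ℕ).testBit b = s) fun k h h' => h' h
    have h4 := h1.bilinear h2 hR hC ht h3 (B' b) fun k l => (hB'n b k l).trans (hB k l)
    rw [Fintype.card_fin] at h4
    refine le_trans (measureReal_mono fun ω hω => ?_) h4
    simp only [hE, Set.mem_ofPred_eq] at hω ⊢
    refine le_trans ?_ hω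
    have hF : √(∑ k, ∑ l, v k * v l * ‖B' b k l‖ ^ 2) ≤ F := by
      refine Real.sqrt_le_sqrt (Finset.sum_le_sum fun k _ => Finset.sum_le_sum fun l _ => ?_)
      have := mul_nonneg (hX.var_nonneg k) (hX.var_nonneg l)
      gcongr
      exact hB'n b k l
    refine mul_le_mul_of_nonneg_left ?_ (by positivity)
    linarith
  -- For the digit assigned to `(k, l)`, exactly one value `s` puts `k` in the first family and `l`
  -- in the second.
  have hsum : ∀ ω, ∑ k, ∑ l, (if k ≠ l then B k l else 0) * (X k ω * X l ω : ℂ) =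
      ∑ b ∈ Finset.range L, ∑ s : Bool, ∑ k, ∑ l, B' b k l * (X1 b s k ω * X2 b s l ω : ℂ) := by
    intro ω
    have e : ∀ k l, (if k ≠ l then B k l else 0) * (X k ω * X l ω : ℂ) =
        ∑ b ∈ Finset.range L, ∑ s : Bool, B' b k l * (X1 b s k ω * X2 b s l ω : ℂ) := by
      intro k l
      by_cases h : k = l
      · simp [hB', h]
      · obtain ⟨h1, h2⟩ := hd k l h
        rw [Finset.sum_eq_single_of_mem (d k l) (Finset.mem_range.2 h1)]
        · simp only [hB', hX1, hX2, Fintype.sum_bool, ne_eq, h, not_false_eq_true, true_and,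
            if_true]
          cases hk : (k : ℕ).testBit (d k l) <;> cases hl : (l : ℕ).testBit (d k l) <;>
            simp_all
        · intro b _ hb
          simp [hB', Ne.symm hb]
    simp only [e]
    rw [Finset.sum_congr rfl fun k _ => Finset.sum_comm, Finset.sum_comm]
    refine Finset.sum_congr rfl fun b _ => ?_
    rw [Finset.sum_congr rfl fun k _ => Finset.sum_comm, Finset.sum_comm]
  have hsub : {ω | L * (12 * t ^ 2 * (F + 2 * (C * R * √V) + C * R ^ 2)) <
      ‖∑ k, ∑ l, (if k ≠ l then B k l else 0) * (X k ω * X l ω : ℂ)‖} ⊆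
      ⋃ b ∈ Finset.range L, ⋃ s, E b s := by
    intro ω hω
    by_contra hcon
    simp only [Set.mem_iUnion, not_exists, hE, Set.mem_ofPred_eq, not_le] at hcon
    simp only [Set.mem_ofPred_eq, hsum] at hω
    refine absurd hω (not_lt.2 ?_)
    calc _ ≤ ∑ b ∈ Finset.range L, ∑ s : Bool,
          6 * t ^ 2 * (F + 2 * (C * R * √V) + C * R ^ 2) :=
          (norm_sum_le _ _).trans (Finset.sum_le_sum fun b hb =>
            (norm_sum_le _ _).trans (Finset.sum_le_sum fun s _ => (hcon b hb s).le))
      _ = _ := by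
          simp only [Finset.sum_const, Finset.card_range, Finset.card_univ, Fintype.card_bool,
            nsmul_eq_mul]
          push_cast; ring
  calc _ ≤ P.real (⋃ b ∈ Finset.range L, ⋃ s, E b s) := measureReal_mono hsub (measure_ne_top _ _)
    _ ≤ ∑ b ∈ Finset.range L, ∑ s, P.real (E b s) :=
        (measureReal_biUnion_finset_le _ _).trans (Finset.sum_le_sum fun b _ =>
          measureReal_iUnion_fintype_le _)
    _ ≤ ∑ b ∈ Finset.range L, ∑ _s : Bool, (N + 1) * (4 * Real.exp (1 - t)) :=
        Finset.sum_le_sum fun b _ => Finset.sum_le_sum fun s _ => hEb b s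
    _ = _ := by simp

/-- Makes the diagonal part of a quadratic form a linear form in new noise: the variance of `X ^ 2`
is at most `E X ^ 4 ≤ R ^ 2 * E X ^ 2`. -/
lemma IsNoise.sq (hX : IsNoise P X R v) :
    IsNoise P (fun k ω => X k ω ^ 2 - ∫ ω', X k ω' ^ 2 ∂P) (R ^ 2) (fun k => R ^ 2 * v k) := by
  have hle : ∀ k, ∀ᵐ ω ∂P, X k ω ^ 2 ≤ R ^ 2 := fun k => by
    filter_upwards [hX.bdd k] with ω hω
    rw [← sq_abs]; exact pow_le_pow_left₀ (abs_nonneg _) hω 2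
  have hm := hX.measurable
  have hi : ∀ k, Integrable (fun ω => X k ω ^ 2) P := fun k => by
    refine integrable_of_abs_le (C := R ^ 2) (by fun_prop) ?_
    filter_upwards [hle k] with ω hω
    rwa [abs_of_nonneg (sq_nonneg _)]
  have hmu : ∀ k, ∫ ω, X k ω ^ 2 ∂P ≤ R ^ 2 := fun k => by
    calc _ ≤ ∫ _, R ^ 2 ∂P := integral_mono_ae (hi k) (integrable_const _) (hle k)
      _ = _ := by simp
  have hmu0 : ∀ k, 0 ≤ ∫ ω, X k ω ^ 2 ∂P := fun k => integral_nonneg fun _ => sq_nonneg _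
  refine ⟨fun k => by fun_prop,
    hX.indep.comp (fun k x => x ^ 2 - ∫ ω', X k ω' ^ 2 ∂P) fun k => by fun_prop, fun k => ?_,
    fun k => ?_, fun k => ?_⟩
  · filter_upwards [hle k] with ω hω
    rw [abs_le]
    constructor <;> nlinarith [sq_nonneg (X k ω), hmu k, hmu0 k]
  · rw [integral_sub (hi k) (integrable_const _)]; simp
  · set m := ∫ ω, X k ω ^ 2 ∂P with hmdef
    have hi4 : Integrable (fun ω => R ^ 2 * X k ω ^ 2) P := (hi k).const_mul _
    calc ∫ ω, (X k ω ^ 2 - m) ^ 2 ∂P ≤ ∫ ω, (R ^ 2 * X k ω ^ 2 - 2 * m * X k ω ^ 2 + m ^ 2) ∂P := by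
          refine integral_mono_ae ?_ ((hi4.sub ((hi k).const_mul _)).add (integrable_const _)) ?_
          · refine integrable_of_abs_le (C := (R ^ 2) ^ 2) (by fun_prop) ?_
            filter_upwards [hle k] with ω hω
            rw [abs_pow]
            refine pow_le_pow_left₀ (abs_nonneg _) ?_ 2
            rw [abs_le]
            constructor <;> nlinarith [sq_nonneg (X k ω), hmu k, hmu0 k]
          · filter_upwards [hle k] with ω hω
            nlinarith [sq_nonneg (X k ω)]
      _ = R ^ 2 * m - 2 * m * m + m ^ 2 := by
          rw [integral_add (by exact hi4.sub ((hi k).const_mul _)) (integrable_const _),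
            integral_sub hi4 (by exact (hi k).const_mul _), integral_const_mul,
            integral_const_mul, ← hmdef]
          simp
      _ ≤ R ^ 2 * v k := by
          have := hX.var k
          nlinarith [sq_nonneg m, sq_nonneg R, mul_le_mul_of_nonneg_left (hX.var k) (sq_nonneg R)]

/-- Large deviation estimate for quadratic forms. -/
lemma IsNoise.quadratic {N L : ℕ} {X : Fin N → Ω → ℝ} {v : Fin N → ℝ} (hL : N ≤ 2 ^ L)
    (hX : IsNoise P X R v) (hR : 0 < R) {C t : ℝ} (hC : 0 < C) (ht : 1 ≤ t)
    (B : Fin N → Fin N → ℂ) (hB : ∀ k l, ‖B k l‖ ≤ C) :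
    P.real {ω | (12 * L + 2) * t ^ 2 * (√(∑ k, ∑ l, v k * v l * ‖B k l‖ ^ 2) +
      2 * (C * R * √(∑ k, v k)) + C * R ^ 2) ≤
      ‖∑ k, ∑ l, B k l * (X k ω * X l ω : ℂ) -
        ∑ k, ((∫ ω', X k ω' ^ 2 ∂P : ℝ) : ℂ) * B k k‖} ≤
      (8 * L * (N + 1) + 4) * Real.exp (1 - t) := by
  have ht0 : 0 < t := zero_lt_one.trans_le ht
  have h1 := hX.offDiag hL hR hC ht0 B hB
  have h2 := hX.sq.linear (pow_pos hR 2) hC (t := t) (fun k => B k k) fun k => hB k k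
  set F := √(∑ k, ∑ l, v k * v l * ‖B k l‖ ^ 2) with hF
  set V := ∑ k, v k with hV
  have hV0 : 0 ≤ V := Finset.sum_nonneg fun k _ => hX.var_nonneg k
  set S1 := {ω | L * (12 * t ^ 2 * (F + 2 * (C * R * √V) + C * R ^ 2)) <
      ‖∑ k, ∑ l, (if k ≠ l then B k l else 0) * (X k ω * X l ω : ℂ)‖} with hS1
  set S2 := {ω | 2 * t * (√(∑ k, R ^ 2 * v k * ‖B k k‖ ^ 2) + C * R ^ 2) ≤
    ‖∑ k, B k k * ((X k ω ^ 2 - ∫ ω', X k ω' ^ 2 ∂P : ℝ) : ℂ)‖} with hS2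
  have hsub : {ω | (12 * L + 2) * t ^ 2 * (F + 2 * (C * R * √V) + C * R ^ 2) ≤
      ‖∑ k, ∑ l, B k l * (X k ω * X l ω : ℂ) -
        ∑ k, ((∫ ω', X k ω' ^ 2 ∂P : ℝ) : ℂ) * B k k‖} ⊆ S1 ∪ S2 := by
    intro ω hω
    by_contra hcon
    simp only [Set.mem_union, not_or, hS1, hS2, Set.mem_ofPred_eq, not_le, not_lt] at hcon
    obtain ⟨c1, c2⟩ := hcon
    simp only [Set.mem_ofPred_eq] at hω
    have e : ∑ k, ∑ l, B k l * (X k ω * X l ω : ℂ) -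
        ∑ k, ((∫ ω', X k ω' ^ 2 ∂P : ℝ) : ℂ) * B k k =
        ∑ k, ∑ l, (if k ≠ l then B k l else 0) * (X k ω * X l ω : ℂ) +
        ∑ k, B k k * ((X k ω ^ 2 - ∫ ω', X k ω' ^ 2 ∂P : ℝ) : ℂ) := by
      have e1 : ∀ k, ∑ l, B k l * (X k ω * X l ω : ℂ) =
          ∑ l, (if k ≠ l then B k l else 0) * (X k ω * X l ω : ℂ) + B k k * (X k ω * X k ω : ℂ) := by
        intro k
        rw [← Finset.sum_erase_add _ _ (Finset.mem_univ k)]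
        congr 1
        rw [← Finset.sum_erase_add _ _ (Finset.mem_univ k)]
        simp only [ne_eq, not_true_eq_false, if_false, zero_mul, add_zero]
        refine Finset.sum_congr rfl fun l hl => ?_
        rw [if_pos (Finset.ne_of_mem_erase hl).symm]
      rw [Finset.sum_congr rfl fun k _ => e1 k, Finset.sum_add_distrib, add_sub_assoc,
        ← Finset.sum_sub_distrib]
      congr 1
      refine Finset.sum_congr rfl fun k _ => ?_
      push_cast; ring
    -- The fluctuation of the diagonal is absorbed by the term `C * R * √V` already present for the
    -- off-diagonal part.
    have hd : √(∑ k, R ^ 2 * v k * ‖B k k‖ ^ 2) ≤ C * R * √V := by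
      refine Real.sqrt_le_iff.2 ⟨by positivity, ?_⟩
      rw [mul_pow, Real.sq_sqrt hV0, hV, Finset.mul_sum]
      refine Finset.sum_le_sum fun k _ => ?_
      have h3 : ‖B k k‖ ^ 2 ≤ C ^ 2 := pow_le_pow_left₀ (norm_nonneg _) (hB k k) 2
      have h4 : 0 ≤ R ^ 2 * v k := mul_nonneg (sq_nonneg _) (hX.var_nonneg k)
      nlinarith
    rw [e] at hω
    have h5 := norm_add_le (∑ k, ∑ l, (if k ≠ l then B k l else 0) * (X k ω * X l ω : ℂ))
      (∑ k, B k k * ((X k ω ^ 2 - ∫ ω', X k ω' ^ 2 ∂P : ℝ) : ℂ))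
    have hF0 : 0 ≤ F := Real.sqrt_nonneg _
    have h6 : 2 * t * (√(∑ k, R ^ 2 * v k * ‖B k k‖ ^ 2) + C * R ^ 2) ≤
        2 * t ^ 2 * (F + 2 * (C * R * √V) + C * R ^ 2) := by
      have h7 : 0 ≤ C * R * √V := by positivity
      refine mul_le_mul (by nlinarith) (by linarith) (by positivity) (by positivity)
    nlinarith
  calc _ ≤ P.real (S1 ∪ S2) := measureReal_mono hsub
    _ ≤ P.real S1 + P.real S2 := measureReal_union_le _ _
    _ ≤ L * (2 * ((N + 1) * (4 * Real.exp (1 - t)))) + 4 * Real.exp (1 - t) := add_le_add h1 h2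
    _ = _ := by ring

/-- Large deviation estimate for quadratic forms with independent random coefficients. -/
lemma IsNoise.quadratic_random {N L : ℕ} {X : Fin N → Ω → ℝ} {v : Fin N → ℝ} (hL : N ≤ 2 ^ L)
    (hX : IsNoise P X R v) (hR : 0 < R) {C t : ℝ} (hC : 0 < C) (ht : 1 ≤ t)
    {B : Fin N → Fin N → Ω → ℂ} (hBm : ∀ k l, Measurable (B k l))
    (hind : IndepFun (fun ω k => X k ω) (fun ω k l => B k l ω) P) :
    P.real {ω | (∀ k l, ‖B k l ω‖ ≤ C) ∧
      (12 * L + 2) * t ^ 2 * (√(∑ k, ∑ l, v k * v l * ‖B k l ω‖ ^ 2) +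
      2 * (C * R * √(∑ k, v k)) + C * R ^ 2) ≤
      ‖∑ k, ∑ l, B k l ω * (X k ω * X l ω : ℂ) -
        ∑ k, ((∫ ω', X k ω' ^ 2 ∂P : ℝ) : ℂ) * B k k ω‖} ≤
      (8 * L * (N + 1) + 4) * Real.exp (1 - t) := by
  set S : Set ((Fin N → ℝ) × (Fin N → Fin N → ℂ)) := {p | (∀ k l, ‖p.2 k l‖ ≤ C) ∧
      (12 * L + 2) * t ^ 2 * (√(∑ k, ∑ l, v k * v l * ‖p.2 k l‖ ^ 2) +
      2 * (C * R * √(∑ k, v k)) + C * R ^ 2) ≤ ‖∑ k, ∑ l, p.2 k l * (p.1 k * p.1 l : ℂ) -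
        ∑ k, ((∫ ω', X k ω' ^ 2 ∂P : ℝ) : ℂ) * p.2 k k‖} with hSdef
  have hS : MeasurableSet S := by
    have e : S = (⋂ k, ⋂ l, {p : (Fin N → ℝ) × (Fin N → Fin N → ℂ) | ‖p.2 k l‖ ≤ C}) ∩
        {p | (12 * L + 2) * t ^ 2 * (√(∑ k, ∑ l, v k * v l * ‖p.2 k l‖ ^ 2) +
      2 * (C * R * √(∑ k, v k)) + C * R ^ 2) ≤ ‖∑ k, ∑ l, p.2 k l * (p.1 k * p.1 l : ℂ) -
        ∑ k, ((∫ ω', X k ω' ^ 2 ∂P : ℝ) : ℂ) * p.2 k k‖} := by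
      ext p; simp [hSdef]
    rw [e]
    exact (MeasurableSet.iInter fun k => MeasurableSet.iInter fun l =>
      measurableSet_le (by fun_prop) (by fun_prop)).inter
      (measurableSet_le (by fun_prop) (by fun_prop))
  refine measureReal_le_of_indepFun (S := S) (measurable_pi_iff.2 hX.measurable)
    (measurable_pi_iff.2 fun k => measurable_pi_iff.2 (hBm k)) hind hS fun y => ?_
  by_cases hy : ∀ k l, ‖y k l‖ ≤ C
  · refine le_trans (measureReal_mono fun ω hω => hω.2) (hX.quadratic hL hR hC ht y hy)
  · have : {ω | ((fun k => X k ω), y) ∈ S} = ∅ := by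
      ext ω; simp only [hSdef, Set.mem_ofPred_eq, Set.mem_empty_iff_false, iff_false]
      exact fun h => hy h.1
    have h0 : 0 ≤ (8 * L * (N + 1) + 4) * Real.exp (1 - t) := by positivity
    rw [this]; simpa using h0

end LargeDeviation

end ChungLu

/-! ### Resolvent identities for symmetric matrices and their minors -/

namespace ChungLu

section Resolvent

variable {N : ℕ} {H : Matrix (Fin N) (Fin N) ℝ} {z : ℂ}

lemma isHermitian_map (hH : H.IsSymm) :
    (H.map (fun x : ℝ => (x : ℂ))).IsHermitian := by
  ext i j
  simp [Matrix.conjTranspose_apply, hH.apply i j]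

/-- For a kernel vector, `z * ‖v‖ ^ 2` would be a value of a Hermitian form, hence real. -/
lemma isUnit_det (hH : H.IsSymm) (hz : 0 < z.im) :
    IsUnit (H.map (fun x : ℝ => (x : ℂ)) - z • (1 : Matrix (Fin N) (Fin N) ℂ)).det := by
  rw [isUnit_iff_ne_zero]
  intro h0
  obtain ⟨v, hv, hv0⟩ := Matrix.exists_mulVec_eq_zero_iff.2 h0
  have h1 : star v ⬝ᵥ ((H.map (fun x : ℝ => (x : ℂ))).mulVec v) = z * (star v ⬝ᵥ v) := by
    rw [Matrix.sub_mulVec, sub_eq_zero, Matrix.smul_mulVec, Matrix.one_mulVec] at hv0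
    rw [hv0, dotProduct_smul, smul_eq_mul]
  have h2 := (isHermitian_map hH).im_star_dotProduct_mulVec_self v
  rw [h1] at h2
  have h3 : star v ⬝ᵥ v = ((∑ i, ‖v i‖ ^ 2 : ℝ) : ℂ) := by
    simp [dotProduct, Complex.conj_mul']
  rw [h3] at h2
  simp only [RCLike.im_to_complex, Complex.im_mul_ofReal] at h2
  obtain ⟨i, hi⟩ := Function.ne_iff.1 hv
  have : 0 < ∑ i, ‖v i‖ ^ 2 := Finset.sum_pos' (fun _ _ => sq_nonneg _)
    ⟨i, Finset.mem_univ _, pow_pos (norm_pos_iff.2 hi) 2⟩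
  have := mul_pos hz this
  linarith

lemma mul_resolvent (hH : H.IsSymm) (hz : 0 < z.im) :
    (H.map (fun x : ℝ => (x : ℂ)) - z • (1 : Matrix (Fin N) (Fin N) ℂ)) * resolvent H z = 1 :=
  Matrix.mul_nonsing_inv _ (isUnit_det hH hz)

lemma resolvent_mul (hH : H.IsSymm) (hz : 0 < z.im) :
    resolvent H z * (H.map (fun x : ℝ => (x : ℂ)) - z • (1 : Matrix (Fin N) (Fin N) ℂ)) = 1 :=
  Matrix.nonsing_inv_mul _ (isUnit_det hH hz)

lemma sum_mul_resolvent (hH : H.IsSymm) (hz : 0 < z.im) (i j : Fin N) :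
    ∑ k, (H i k : ℂ) * resolvent H z k j - z * resolvent H z i j = if i = j then 1 else 0 := by
  have := congrFun (congrFun (mul_resolvent hH hz) i) j
  rw [sub_mul, Matrix.smul_mul, one_mul, Matrix.sub_apply, Matrix.mul_apply, Matrix.smul_apply,
    smul_eq_mul, Matrix.one_apply] at this
  simpa using this

lemma resolvent_symm (hH : H.IsSymm) (i j : Fin N) :
    resolvent H z i j = resolvent H z j i := by
  have : (resolvent H z).transpose = resolvent H z := by
    rw [resolvent, Matrix.transpose_nonsing_inv, Matrix.transpose_sub, Matrix.transpose_smul,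
      Matrix.transpose_one, ← Matrix.transpose_map, hH.eq]
  exact congrFun (congrFun this j) i

/-- The Ward identity. -/
lemma ward (hH : H.IsSymm) (hz : 0 < z.im) (i : Fin N) :
    ∑ k, ‖resolvent H z k i‖ ^ 2 = (resolvent H z i i).im / z.im := by
  set A := H.map (fun x : ℝ => (x : ℂ)) - z • (1 : Matrix (Fin N) (Fin N) ℂ) with hA
  set G := resolvent H z with hG
  have h1 : A * G = 1 := mul_resolvent hH hz
  have h2 : G.conjTranspose * A.conjTranspose = 1 := by
    rw [← Matrix.conjTranspose_mul, h1, Matrix.conjTranspose_one]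
  have h3 : A.conjTranspose = A + (z - star z) • (1 : Matrix (Fin N) (Fin N) ℂ) := by
    rw [hA, Matrix.conjTranspose_sub, (isHermitian_map hH).eq, Matrix.conjTranspose_smul,
      Matrix.conjTranspose_one, sub_smul]
    abel
  have h4 : G - G.conjTranspose = (z - star z) • (G.conjTranspose * G) := by
    calc G - G.conjTranspose = (G.conjTranspose * A.conjTranspose) * G -
          G.conjTranspose * (A * G) := by rw [h2, h1, one_mul, mul_one]
      _ = _ := by
          rw [h3, mul_add, add_mul, mul_assoc]; simp
  have h5 := congrFun (congrFun h4 i) i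
  rw [Matrix.sub_apply, Matrix.conjTranspose_apply, Matrix.smul_apply, Matrix.mul_apply] at h5
  have h6 : ∑ k, G.conjTranspose i k * G k i = ((∑ k, ‖G k i‖ ^ 2 : ℝ) : ℂ) := by
    simp [Matrix.conjTranspose_apply, Complex.conj_mul']
  rw [h6] at h5
  have h7 := congrArg Complex.im h5
  rw [smul_eq_mul, Complex.im_mul_ofReal] at h7
  simp only [Complex.sub_im, RCLike.star_def, Complex.conj_im] at h7
  rw [eq_div_iff hz.ne']
  linarith

lemma resolvent_im_nonneg (hH : H.IsSymm) (hz : 0 < z.im) (i : Fin N) :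
    0 ≤ (resolvent H z i i).im := by
  have h := ward hH hz i
  have h1 : 0 ≤ ∑ k, ‖resolvent H z k i‖ ^ 2 := Finset.sum_nonneg fun _ _ => sq_nonneg _
  rw [h] at h1
  by_contra hc
  have := div_neg_of_neg_of_pos (not_le.1 hc) hz
  linarith

lemma norm_sq_resolvent_le (hH : H.IsSymm) (hz : 0 < z.im) (i j : Fin N) :
    ‖resolvent H z i j‖ ^ 2 ≤ (resolvent H z j j).im / z.im := by
  rw [← ward hH hz j]
  exact Finset.single_le_sum (f := fun k => ‖resolvent H z k j‖ ^ 2) (fun _ _ => sq_nonneg _)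
    (Finset.mem_univ i)

lemma norm_resolvent_diag_le (hH : H.IsSymm) (hz : 0 < z.im) (i : Fin N) :
    ‖resolvent H z i i‖ ≤ 1 / z.im := by
  have h1 := norm_sq_resolvent_le hH hz i i
  have h2 := (le_abs_self _).trans (Complex.abs_im_le_norm (resolvent H z i i))
  rw [le_div_iff₀ hz] at h1 ⊢
  rcases (norm_nonneg (resolvent H z i i)).eq_or_lt with h0 | h0
  · rw [← h0]; simp
  · nlinarith

lemma sum_norm_sq_resolvent_le (hH : H.IsSymm) (hz : 0 < z.im) (j : Fin N) :
    ∑ i, ‖resolvent H z i j‖ ^ 2 ≤ (1 / z.im) ^ 2 := by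
  rw [ward hH hz j, sq, div_eq_mul_one_div]
  gcongr
  exact ((le_abs_self _).trans (Complex.abs_im_le_norm _)).trans (norm_resolvent_diag_le hH hz j)

lemma norm_resolvent_le (hH : H.IsSymm) (hz : 0 < z.im) (i j : Fin N) :
    ‖resolvent H z i j‖ ≤ 1 / z.im := by
  refine (sq_le_sq₀ (norm_nonneg _) (by positivity)).1 ?_
  exact (Finset.single_le_sum (f := fun k => ‖resolvent H z k j‖ ^ 2) (fun _ _ => sq_nonneg _)
    (Finset.mem_univ i)).trans (sum_norm_sq_resolvent_le hH hz j)

/-- By the Ward identity a zero diagonal entry would annihilate its whole column, contradicting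
invertibility. -/
lemma resolvent_diag_ne_zero (hH : H.IsSymm) (hz : 0 < z.im) (i : Fin N) :
    resolvent H z i i ≠ 0 := by
  intro h0
  have hw := ward hH hz i
  rw [h0] at hw
  have h1 : ∀ k, resolvent H z k i = 0 := fun k => by
    have h2 : ‖resolvent H z k i‖ ^ 2 ≤ 0 := by
      have := norm_sq_resolvent_le hH hz k i
      rw [h0] at this; simpa using this
    have := pow_eq_zero_iff (two_ne_zero) |>.1 (le_antisymm h2 (sq_nonneg _))
    exact norm_eq_zero.1 this
  have h3 := sum_mul_resolvent hH hz i i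
  simp [h1] at h3

/-- Lipschitz continuity of the resolvent in the spectral parameter. -/
lemma norm_resolvent_sub_le (hH : H.IsSymm) {z' : ℂ} (hz : 0 < z.im) (hz' : 0 < z'.im)
    (i j : Fin N) :
    ‖resolvent H z i j - resolvent H z' i j‖ ≤ ‖z - z'‖ * (1 / z.im * (1 / z'.im)) := by
  -- The first resolvent identity; the product is then bounded by Cauchy–Schwarz using the `ℓ²` norm
  -- of a row and a column.
  have h1 : resolvent H z - resolvent H z' = (z - z') • (resolvent H z * resolvent H z') := by
    calc _ = resolvent H z * ((H.map (fun x : ℝ => (x : ℂ)) -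
          z' • (1 : Matrix (Fin N) (Fin N) ℂ)) * resolvent H z') - (resolvent H z *
          (H.map (fun x : ℝ => (x : ℂ)) - z • (1 : Matrix (Fin N) (Fin N) ℂ))) *
          resolvent H z' := by rw [mul_resolvent hH hz', resolvent_mul hH hz, mul_one, one_mul]
      _ = _ := by
          rw [← mul_assoc, ← sub_mul, ← mul_sub, sub_sub_sub_cancel_left, mul_sub, sub_mul, sub_smul]
          simp
  have h2 := congrFun (congrFun h1 i) j
  rw [Matrix.sub_apply, Matrix.smul_apply, smul_eq_mul, Matrix.mul_apply] at h2
  rw [h2, norm_mul]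
  gcongr
  refine (norm_sum_le _ _).trans ?_
  simp only [norm_mul]
  refine (sq_le_sq₀ (Finset.sum_nonneg fun _ _ => by positivity) (by positivity)).1
    ((Finset.sum_mul_sq_le_sq_mul_sq _ _ _).trans ?_)
  rw [mul_pow]
  have h3 := sum_norm_sq_resolvent_le hH hz i
  simp only [resolvent_symm hH _ i] at h3
  exact mul_le_mul h3 (sum_norm_sq_resolvent_le hH hz' j)
    (Finset.sum_nonneg fun _ _ => sq_nonneg _) (sq_nonneg _)

/-- The matrix with the rows and columns in `T` replaced by zero. -/
def zeroOut (T : Finset (Fin N)) (H : Matrix (Fin N) (Fin N) ℝ) : Matrix (Fin N) (Fin N) ℝ :=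
  Matrix.of fun k l => if k ∈ T ∨ l ∈ T then 0 else H k l

/-- The resolvent of the minor with rows and columns in `T` removed, extended by zero. -/
noncomputable def minorG (H : Matrix (Fin N) (Fin N) ℝ) (T : Finset (Fin N)) (z : ℂ)
    (k l : Fin N) : ℂ :=
  if k ∈ T ∨ l ∈ T then 0 else resolvent (zeroOut T H) z k l

variable {T : Finset (Fin N)}

lemma zeroOut_isSymm (hH : H.IsSymm) : (zeroOut T H).IsSymm := by
  ext k l
  simp [zeroOut, or_comm, hH.apply k l]

lemma minorG_empty : minorG H ∅ z = resolvent H z := by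
  funext k l
  have : zeroOut ∅ H = H := by ext; simp [zeroOut]
  simp [minorG, this]

lemma minorG_symm (hH : H.IsSymm) (k l : Fin N) : minorG H T z k l = minorG H T z l k := by
  simp only [minorG, or_comm, resolvent_symm (zeroOut_isSymm hH) k l]

lemma minorG_of_notMem {k l : Fin N} (hk : k ∉ T) (hl : l ∉ T) :
    minorG H T z k l = resolvent (zeroOut T H) z k l := by
  simp [minorG, hk, hl]

lemma minorG_left {k l : Fin N} (hk : k ∈ T) : minorG H T z k l = 0 := by simp [minorG, hk]

lemma minorG_right {k l : Fin N} (hl : l ∈ T) : minorG H T z k l = 0 := by simp [minorG, hl]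

/-- The zeroed matrix decouples the indices in `T`, where the resolvent is `-1 / z` times the
identity. So the truncation in `minorG` only discards those diagonal entries. -/
lemma resolvent_zeroOut_left (hH : H.IsSymm) (hz : 0 < z.im) {k l : Fin N} (hk : k ∈ T)
    (hkl : k ≠ l) : resolvent (zeroOut T H) z k l = 0 := by
  have h := sum_mul_resolvent (zeroOut_isSymm (T := T) hH) hz k l
  have h0 : ∀ j, zeroOut T H k j = 0 := fun j => by simp [zeroOut, hk]
  simp only [h0, hkl, if_false] at h
  simpa [ne_zero_of_im_pos hz] using h

lemma resolvent_zeroOut_eq_minorG (hH : H.IsSymm) (hz : 0 < z.im) {k : Fin N} (hk : k ∉ T)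
    (l : Fin N) : resolvent (zeroOut T H) z k l = minorG H T z k l := by
  by_cases hl : l ∈ T
  · rw [minorG_right hl, resolvent_symm (zeroOut_isSymm hH), resolvent_zeroOut_left hH hz hl]
    rintro rfl; exact hk hl
  · rw [minorG_of_notMem hk hl]

lemma minorG_diag_ne_zero (hH : H.IsSymm) (hz : 0 < z.im) {i : Fin N} (hi : i ∉ T) :
    minorG H T z i i ≠ 0 := by
  rw [minorG_of_notMem hi hi]; exact resolvent_diag_ne_zero (zeroOut_isSymm hH) hz i

/-- Expansion of the resolvent in one removed row and column. -/
lemma minorG_expand (hH : H.IsSymm) (hz : 0 < z.im) {i : Fin N} (hi : i ∉ T) {k : Fin N}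
    (hk : k ≠ i) (l : Fin N) : minorG H T z k l = minorG H (insert i T) z k l -
      (∑ a, minorG H (insert i T) z k a * H a i) * minorG H T z i l := by
  by_cases hkT : k ∈ T
  · simp [minorG_left, hkT]
  by_cases hlT : l ∈ T
  · simp [minorG_right, hlT]
  have hki : k ∉ insert i T := by simp [hk, hkT]
  set K := zeroOut T H with hK
  set K' := zeroOut (insert i T) H with hK'
  have h1 : resolvent K z = resolvent K' z -
      resolvent K' z * (K.map (fun x : ℝ => (x : ℂ)) - K'.map (fun x : ℝ => (x : ℂ))) *
      resolvent K z := by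
    have e1 := mul_resolvent (zeroOut_isSymm (T := T) hH) hz
    have e2 := resolvent_mul (zeroOut_isSymm (T := insert i T) hH) hz
    rw [← hK] at e1; rw [← hK'] at e2
    have e3 : K.map (fun x : ℝ => (x : ℂ)) - K'.map (fun x : ℝ => (x : ℂ)) =
        (K.map (fun x : ℝ => (x : ℂ)) - z • (1 : Matrix (Fin N) (Fin N) ℂ)) -
        (K'.map (fun x : ℝ => (x : ℂ)) - z • (1 : Matrix (Fin N) (Fin N) ℂ)) := by abel
    rw [e3, mul_sub, e2, sub_mul, mul_assoc, e1, mul_one, one_mul]; abel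
  have h2 := congrFun (congrFun h1 k) l
  rw [Matrix.sub_apply, Matrix.mul_apply] at h2
  simp only [Matrix.mul_apply, Matrix.sub_apply, Matrix.map_apply] at h2
  rw [minorG_of_notMem hkT hlT, ← hK, h2, ← resolvent_zeroOut_eq_minorG hH hz hki l, ← hK']
  congr 1
  -- The two zeroed matrices differ only in row and column `i`. The row part meets entries of the
  -- smaller minor in column `i`, which vanish, so only column `i` of the perturbation remains.
  rw [Finset.sum_eq_single i]
  · rw [← resolvent_zeroOut_eq_minorG hH hz hi l, ← hK]
    congr 1
    refine Finset.sum_congr rfl fun a _ => ?_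
    rw [resolvent_zeroOut_eq_minorG hH hz hki a]
    by_cases ha : a ∈ insert i T
    · simp [minorG_right ha]
    · have ha' : a ∉ T := fun h => ha (Finset.mem_insert_of_mem h)
      simp [hK, hK', zeroOut, ha', hi]
  · intro b _ hb
    rw [Finset.sum_eq_zero, zero_mul]
    intro a _
    rw [resolvent_zeroOut_eq_minorG hH hz hki a]
    by_cases ha : a ∈ insert i T
    · simp [minorG_right ha]
    · have ha' : a ∉ T := fun h => ha (Finset.mem_insert_of_mem h)
      have ha'' : a ≠ i := fun h => ha (h ▸ Finset.mem_insert_self i T)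
      simp [hK, hK', zeroOut, ha', ha'', hb]
  · simp

lemma minorG_col (hH : H.IsSymm) (hz : 0 < z.im) {i : Fin N} (hi : i ∉ T) {k : Fin N}
    (hk : k ≠ i) : minorG H T z k i =
      -minorG H T z i i * ∑ a, minorG H (insert i T) z k a * H a i := by
  rw [minorG_expand hH hz hi hk i, minorG_right (Finset.mem_insert_self i T)]; ring

/-- The expansion with the entries of `H` eliminated: minors are compared with the resolvent using
resolvent entries alone. -/
lemma minorG_sub (hH : H.IsSymm) (hz : 0 < z.im) {i : Fin N} (hi : i ∉ T) (k l : Fin N) :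
    minorG H T z k l - minorG H (insert i T) z k l =
      minorG H T z k i * minorG H T z i l / minorG H T z i i := by
  have h0 := minorG_diag_ne_zero hH hz hi
  by_cases hk : k = i
  · subst hk
    rw [minorG_left (T := insert k T) (Finset.mem_insert_self k T), eq_div_iff h0]; ring
  · rw [minorG_col hH hz hi hk, minorG_expand hH hz hi hk l]
    field_simp
    ring

/-- The Schur complement formula. -/
lemma minorG_schur (hH : H.IsSymm) (hz : 0 < z.im) {i : Fin N} (hi : i ∉ T) :
    minorG H T z i i * (H i i - z - ∑ k, ∑ l, minorG H (insert i T) z k l * (H i k * H i l)) =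
      1 := by
  have h := sum_mul_resolvent (zeroOut_isSymm (T := T) hH) hz i i
  rw [if_pos rfl, resolvent_zeroOut_eq_minorG hH hz hi, ← Finset.sum_erase_add _ _
    (Finset.mem_univ i), resolvent_zeroOut_eq_minorG hH hz hi] at h
  have e1 : ∑ k ∈ Finset.univ.erase i, (zeroOut T H i k : ℂ) * resolvent (zeroOut T H) z k i =
      -minorG H T z i i * ∑ k, ∑ l, minorG H (insert i T) z k l * (H i k * H i l) := by
    rw [Finset.mul_sum, ← Finset.sum_erase_add (a := i) _ _ (Finset.mem_univ i)]
    have e0 : ∑ l, minorG H (insert i T) z i l * ((H i i : ℂ) * H i l) = 0 :=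
      Finset.sum_eq_zero fun l _ => by rw [minorG_left (Finset.mem_insert_self i T), zero_mul]
    rw [e0, mul_zero, add_zero]
    refine Finset.sum_congr rfl fun k hk => ?_
    have hki := Finset.ne_of_mem_erase hk
    by_cases hkT : k ∈ T
    · have : ∑ l, minorG H (insert i T) z k l * ((H i k : ℂ) * H i l) = 0 :=
        Finset.sum_eq_zero fun l _ => by
          rw [minorG_left (Finset.mem_insert_of_mem hkT), zero_mul]
      rw [this]
      simp [zeroOut, hkT]
    · rw [resolvent_zeroOut_eq_minorG hH hz hkT, minorG_col hH hz hi hki]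
      have : (zeroOut T H i k : ℂ) = H i k := by simp [zeroOut, hi, hkT]
      rw [this, mul_left_comm, Finset.mul_sum]
      congr 1
      refine Finset.sum_congr rfl fun l _ => ?_
      rw [hH.apply i l]; ring
  have e2 : (zeroOut T H i i : ℂ) = H i i := by simp [zeroOut, hi]
  rw [e1, e2] at h
  linear_combination h

/-- Expansion of off-diagonal resolvent entries in two removed rows and columns. -/
lemma resolvent_offDiag (hH : H.IsSymm) (hz : 0 < z.im) {i j : Fin N} (hij : i ≠ j) :
    resolvent H z i j = -resolvent H z i i * minorG H {i} z j j *
      (H i j - ∑ k, ∑ l, minorG H {i, j} z k l * (H i k * H j l)) := by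
  rw [← minorG_empty]
  have h1 := minorG_col (T := ∅) hH hz (i := i) (by simp) hij.symm
  rw [minorG_symm hH i j, h1, show insert i (∅ : Finset (Fin N)) = {i} from rfl, mul_assoc]
  congr 1
  have hj : j ∉ ({i} : Finset (Fin N)) := by simpa using hij.symm
  have hins : insert j ({i} : Finset (Fin N)) = {i, j} := by ext; simp [or_comm]
  have h2 : ∀ l, minorG H {i} z j l * (H l i : ℂ) = minorG H {i} z j j *
      ((if l = j then (H i j : ℂ) else 0) - ∑ m, minorG H {i, j} z l m * (H i l * H j m)) := by
    intro l
    by_cases hl : l = j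
    · subst hl
      have : ∑ m, minorG H {i, l} z l m * ((H i l : ℂ) * H l m) = 0 :=
        Finset.sum_eq_zero fun m _ => by rw [minorG_left (by simp), zero_mul]
      rw [this, hH.apply i l]; simp
    · rw [minorG_symm hH j l, minorG_col hH hz hj hl, hins, if_neg hl, zero_sub, neg_mul, neg_mul,
        mul_neg, mul_assoc, Finset.sum_mul]
      congr 2
      refine Finset.sum_congr rfl fun m _ => ?_
      rw [hH.apply j m, hH.apply i l]; ring
  rw [Finset.sum_congr rfl fun l _ => h2 l, ← Finset.mul_sum, Finset.sum_sub_distrib]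
  simp

lemma sum_norm_sq_minorG_le (hH : H.IsSymm) (hz : 0 < z.im) (k : Fin N) :
    ∑ l, ‖minorG H T z l k‖ ^ 2 ≤ (minorG H T z k k).im / z.im := by
  by_cases hk : k ∈ T
  · simp [minorG_right hk]
  · rw [minorG_of_notMem hk hk, ← ward (zeroOut_isSymm hH) hz k]
    gcongr with l _
    by_cases hl : l ∈ T
    · simp [minorG_left hl]
    · rw [minorG_of_notMem hl hk]

lemma minorG_im_nonneg (hH : H.IsSymm) (hz : 0 < z.im) (k : Fin N) :
    0 ≤ (minorG H T z k k).im := by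
  by_cases hk : k ∈ T
  · simp [minorG_right hk]
  · rw [minorG_of_notMem hk hk]; exact resolvent_im_nonneg (zeroOut_isSymm hH) hz k

lemma norm_minorG_le (hH : H.IsSymm) (hz : 0 < z.im) (k l : Fin N) :
    ‖minorG H T z k l‖ ≤ 1 / z.im := by
  unfold minorG
  split_ifs
  · simpa using hz.le
  · exact norm_resolvent_le (zeroOut_isSymm hH) hz k l

/-- Removing a row and a column changes the trace of the resolvent by at most `1 / η`. -/
lemma norm_trace_minorG_sub_le (hH : H.IsSymm) (hz : 0 < z.im) {i : Fin N} (hi : i ∉ T) :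
    ‖∑ k, minorG H T z k k - ∑ k, minorG H (insert i T) z k k‖ ≤ 1 / z.im := by
  have h0 := norm_pos_iff.2 (minorG_diag_ne_zero hH hz hi)
  rw [← Finset.sum_sub_distrib]
  simp only [minorG_sub hH hz hi]
  refine (norm_sum_le _ _).trans ?_
  calc _ = (∑ k, ‖minorG H T z k i‖ ^ 2) / ‖minorG H T z i i‖ := by
        rw [Finset.sum_div]
        refine Finset.sum_congr rfl fun k _ => ?_
        rw [norm_div, norm_mul, minorG_symm hH i k, sq]
    _ ≤ (minorG H T z i i).im / z.im / ‖minorG H T z i i‖ := by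
        gcongr; exact sum_norm_sq_minorG_le hH hz i
    _ ≤ _ := by
        rw [div_div, div_le_div_iff₀ (by positivity) hz]
        have := (le_abs_self _).trans (Complex.abs_im_le_norm (minorG H T z i i))
        nlinarith

end Resolvent

end ChungLu

/-! ### Error bounds in the Schur formula on the good event -/

namespace ChungLu

section Deterministic

variable {r N : ℕ} {γ : Fin r → Fin N → ℝ} {z : ℂ} {M q C τ : ℝ} {H : Matrix (Fin N) (Fin N) ℝ}

/-- The large deviation bounds for the linear, quadratic and bilinear forms in the rows of `H`
with coefficients in the resolvents of its minors. -/
structure IsGood (γ : Fin r → Fin N → ℝ) (q : ℝ) (H : Matrix (Fin N) (Fin N) ℝ) (z : ℂ)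
    (C τ : ℝ) : Prop where
  symm : H.IsSymm
  entry : ∀ i j, |H i j| ≤ 1 / √q
  linear : ∀ i k, (∀ l, ‖minorG H {i} z k l‖ ≤ C) →
    ‖∑ l, minorG H {i} z k l * (H i l : ℂ)‖ ≤
      τ * (√(∑ l, profile γ i l * ‖minorG H {i} z k l‖ ^ 2) + C * (1 / √q))
  quadratic : ∀ i j, (∀ k l, ‖minorG H {i, j} z k l‖ ≤ C) →
    ‖∑ k, ∑ l, minorG H {i, j} z k l * (H j k * H j l : ℂ) -
      ∑ k, ((profile γ j k * (1 - q * profile γ j k) : ℝ) : ℂ) * minorG H {i, j} z k k‖ ≤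
      τ * (√(∑ k, ∑ l, profile γ j k * profile γ j l * ‖minorG H {i, j} z k l‖ ^ 2) +
        2 * (C * (1 / √q) * √(∑ k, profile γ j k)) + C * (1 / √q) ^ 2)
  bilinear : ∀ i j, i ≠ j → (∀ k l, ‖minorG H {i, j} z k l‖ ≤ C) →
    ‖∑ k, ∑ l, minorG H {i, j} z k l * (H i k * H j l : ℂ)‖ ≤
      τ * (√(∑ k, ∑ l, profile γ i k * profile γ j l * ‖minorG H {i, j} z k l‖ ^ 2) +
        C * (1 / √q) * √(∑ k, profile γ i k) + C * (1 / √q) * √(∑ k, profile γ j k) +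
        C * (1 / √q) ^ 2)

/-- A priori bounds on the resolvents of the minors. -/
structure IsReg (γ : Fin r → Fin N → ℝ) (H : Matrix (Fin N) (Fin N) ℝ) (z : ℂ) (C : ℝ) :
    Prop where
  bound : ∀ i j k l, ‖minorG H {i, j} z k l‖ ≤ C
  frobenius : ∀ i j, ∑ k, ∑ l, theta γ k * theta γ l * ‖minorG H {i, j} z k l‖ ^ 2 ≤
    C ^ 2 * (N / z.im)
  diag : ∀ i, ‖resolvent H z i i‖ ≤ C
  weighted_diag : ∀ i, theta γ i * ‖resolvent H z i i‖ ≤ C * √(N * z.im)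

/-- The standing numerical assumptions. -/
structure Setting (γ : Fin r → Fin N → ℝ) (M q : ℝ) (z : ℂ) : Prop where
  r_pos : 0 < r
  N_pos : 0 < N
  adm : IsAdmissible M q γ
  one_le_q : 1 ≤ q
  q_sq_le : q ^ 2 ≤ N
  im_pos : 0 < z.im

/-- This is where finite rank enters: the self-energy depends on the diagonal only through `r`
averages, which closes the system. -/
lemma sum_profile_mul (g : Fin N → ℂ) (i : Fin N) :
    ∑ k, (profile γ i k : ℂ) * g k = ∑ j, (γ j i : ℂ) * avg γ g j := by
  simp only [profile, avg, Finset.mul_sum]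
  rw [Finset.sum_comm]
  push_cast
  simp only [Finset.sum_mul]
  exact Finset.sum_congr rfl fun k _ => Finset.sum_congr rfl fun j _ => by ring

namespace Setting

variable (hs : Setting γ M q z)
include hs

lemma N_pos' : (0 : ℝ) < N := by exact_mod_cast hs.N_pos

lemma one_le_theta (i : Fin N) : 1 ≤ theta γ i := hs.adm.one_le_theta hs.r_pos i

lemma theta_pos (i : Fin N) : 0 < theta γ i := zero_lt_one.trans_le (hs.one_le_theta i)

lemma one_le_M : 1 ≤ M := hs.adm.one_le_M hs.r_pos hs.N_pos

lemma one_le_r : (1 : ℝ) ≤ r := by exact_mod_cast hs.r_pos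

lemma inv_sqrt_le_one : 1 / √q ≤ 1 := by
  rw [div_le_one (Real.sqrt_pos.2 (by linarith [hs.one_le_q]))]
  exact Real.one_le_sqrt.2 hs.one_le_q

lemma inv_sqrt_pos : 0 < 1 / √q :=
  one_div_pos.2 (Real.sqrt_pos.2 (by linarith [hs.one_le_q]))

lemma rho_pos : 0 < 1 / √(N * z.im) :=
  one_div_pos.2 (Real.sqrt_pos.2 (mul_pos hs.N_pos' hs.im_pos))

lemma phi_pos : 0 < controlPhi N q z := add_pos hs.inv_sqrt_pos hs.rho_pos

lemma inv_sqrt_le_phi : 1 / √q ≤ controlPhi N q z := le_add_of_nonneg_right hs.rho_pos.le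

lemma rho_le_phi : 1 / √(N * z.im) ≤ controlPhi N q z := le_add_of_nonneg_left hs.inv_sqrt_pos.le

lemma rho_sq : (1 / √(N * z.im)) ^ 2 = 1 / (N * z.im) := by
  rw [div_pow, Real.sq_sqrt (mul_pos hs.N_pos' hs.im_pos).le, one_pow]

/-- The weights are small compared to `N / q ^ (3 / 2)`. -/
lemma q_theta_div_le (i : Fin N) : q * theta γ i / N ≤ r * (1 / √q) := by
  have hq : 0 < q := by linarith [hs.one_le_q]
  have h1 := hs.adm.mul_theta_sq_le hq.le hs.N_pos i
  have hN := hs.N_pos'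
  have h2 : (q * theta γ i / N) ^ 2 ≤ (r * (1 / √q)) ^ 2 := by
    rw [mul_pow, div_pow 1, Real.sq_sqrt hq.le, one_pow, div_pow, div_le_iff₀ (by positivity)]
    calc (q * theta γ i) ^ 2 = q * (q * theta γ i ^ 2) := by ring
      _ ≤ q * (r * N) := by gcongr
      _ ≤ r ^ 2 * (1 / q) * N ^ 2 := by
          rw [mul_one_div, div_mul_eq_mul_div, le_div_iff₀ hq]
          -- The exponent restriction `κ ≤ 1 / 2` enters here, as `q ^ 2 ≤ N`.
          have h3 : q ^ 2 * N ≤ N * N := by gcongr; exact hs.q_sq_le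
          have h4 : (r : ℝ) ≤ r ^ 2 := by nlinarith [hs.one_le_r]
          calc q * (r * N) * q = r * (q ^ 2 * N) := by ring
            _ ≤ r ^ 2 * (N * N) := by gcongr
            _ = _ := by ring
  have := hs.theta_pos i
  have := hs.inv_sqrt_pos
  exact (sq_le_sq₀ (by positivity) (by positivity)).1 h2

lemma theta_div_le (i : Fin N) : theta γ i / N ≤ r * (1 / √q) := by
  refine le_trans ?_ (hs.q_theta_div_le i)
  have := hs.N_pos'
  gcongr
  nlinarith [hs.one_le_q, hs.theta_pos i]

lemma sqrt_sum_profile_le (i : Fin N) : √(∑ k, profile γ i k) ≤ M * √(theta γ i) := by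
  have h1 : √(∑ k, profile γ i k) ≤ √(M * theta γ i) :=
    Real.sqrt_le_sqrt (hs.adm.sum_profile_le i)
  have hM := hs.one_le_M
  rw [Real.sqrt_mul (by linarith)] at h1
  refine h1.trans ?_
  gcongr
  rw [Real.sqrt_le_left (by linarith)]
  nlinarith

lemma sqrt_theta_le (i : Fin N) : √(theta γ i) ≤ theta γ i := by
  have := hs.one_le_theta i
  rw [Real.sqrt_le_left (by linarith)]
  nlinarith

/-- The true variance is `s * (1 - q * s)` rather than `s`. The correction `q * s ^ 2`, summed over
a row, is of order `θ i / √q`, within the admissible error. -/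
lemma sum_q_profile_sq_le (i : Fin N) :
    ∑ k, q * profile γ i k ^ 2 ≤ r ^ 2 * M * (1 / √q) * theta γ i := by
  have hN := hs.N_pos'
  have hq : 0 < q := by linarith [hs.one_le_q]
  have hθ := hs.theta_pos i
  calc ∑ k, q * profile γ i k ^ 2 ≤ ∑ k, q * (theta γ i * theta γ k / N) ^ 2 := by
        gcongr with k _
        · exact hs.adm.profile_nonneg i k
        · exact hs.adm.profile_le i k
    _ = theta γ i * (q * theta γ i / N) * ((1 / (N : ℝ)) * ∑ k, theta γ k ^ 2) := by
        simp only [Finset.mul_sum]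
        exact Finset.sum_congr rfl fun k _ => by field_simp
    _ ≤ theta γ i * (r * (1 / √q)) * (r * M) := by
        have h1 := hs.adm.mean_theta_sq_le
        have h2 := hs.inv_sqrt_pos
        gcongr
        exact hs.q_theta_div_le i
    _ = _ := by ring

lemma frobenius_le (hreg : IsReg γ H z C) (a b i j : Fin N) :
    ∑ k, ∑ l, profile γ a k * profile γ b l * ‖minorG H {i, j} z k l‖ ^ 2 ≤
      theta γ a * theta γ b * (C * (1 / √(N * z.im))) ^ 2 := by
  have hN := hs.N_pos'
  have hz := hs.im_pos
  have ha := hs.theta_pos a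
  have hb := hs.theta_pos b
  calc _ ≤ ∑ k, ∑ l, (theta γ a * theta γ k / N) * (theta γ b * theta γ l / N) *
        ‖minorG H {i, j} z k l‖ ^ 2 := by
        gcongr with k _ l _
        · exact hs.adm.profile_nonneg b l
        · have := hs.theta_pos k; positivity
        · exact hs.adm.profile_le a k
        · exact hs.adm.profile_le b l
    _ = theta γ a * theta γ b / N ^ 2 *
        ∑ k, ∑ l, theta γ k * theta γ l * ‖minorG H {i, j} z k l‖ ^ 2 := by
        simp only [Finset.mul_sum]
        exact Finset.sum_congr rfl fun k _ => Finset.sum_congr rfl fun l _ => by field_simp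
    _ ≤ theta γ a * theta γ b / N ^ 2 * (C ^ 2 * (N / z.im)) := by
        gcongr; exact hreg.frobenius i j
    _ = _ := by rw [mul_pow, hs.rho_sq]; field_simp

lemma sqrt_frobenius_le (hreg : IsReg γ H z C) (hC : 0 ≤ C) (a b i j : Fin N) :
    √(∑ k, ∑ l, profile γ a k * profile γ b l * ‖minorG H {i, j} z k l‖ ^ 2) ≤
      √(theta γ a * theta γ b) * (C * (1 / √(N * z.im))) := by
  have h := Real.sqrt_le_sqrt (hs.frobenius_le hreg a b i j)
  have h1 := hs.rho_pos
  have h2 := mul_pos (hs.theta_pos a) (hs.theta_pos b)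
  rwa [Real.sqrt_mul h2.le, Real.sqrt_sq (by positivity)] at h

/-- The Frobenius term gives `θ j / √(N η)`; the other terms are of order `θ j / √q` because `√θ ≤
θ` and `1 / √q ≤ 1`. -/
lemma quadratic_bound (hg : IsGood γ q H z C τ) (hreg : IsReg γ H z C) (hC : 1 ≤ C) (hτ : 1 ≤ τ)
    (i j : Fin N) :
    ‖∑ k, ∑ l, minorG H {i, j} z k l * (H j k * H j l : ℂ) -
      ∑ k, ((profile γ j k * (1 - q * profile γ j k) : ℝ) : ℂ) * minorG H {i, j} z k k‖ ≤
      3 * C * M * τ * theta γ j * controlPhi N q z := by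
  have hR := hs.inv_sqrt_pos
  have hR1 := hs.inv_sqrt_le_one
  have hρ := hs.rho_pos
  have hθ := hs.one_le_theta j
  have hM := hs.one_le_M
  refine (hg.quadratic i j (hreg.bound i j)).trans ?_
  have h1 := hs.sqrt_frobenius_le hreg (by linarith) j j i j
  rw [Real.sqrt_mul_self (by linarith)] at h1
  have h2 := (hs.sqrt_sum_profile_le j).trans
    (mul_le_mul_of_nonneg_left (hs.sqrt_theta_le j) (by linarith : 0 ≤ M))
  unfold controlPhi
  set R := 1 / √q
  set ρ := 1 / √(N * z.im)
  have e1 : theta γ j * (C * ρ) ≤ 3 * C * M * theta γ j * ρ := by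
    have : theta γ j * (C * ρ) * 1 ≤ theta γ j * (C * ρ) * (3 * M) := by gcongr; linarith
    linarith
  have e2 : 2 * (C * R * (M * theta γ j)) + C * R ^ 2 ≤ 3 * C * M * theta γ j * R := by
    have h3 : C * R * R ≤ C * R * (M * theta γ j) := by gcongr; nlinarith
    nlinarith
  calc _ ≤ τ * (theta γ j * (C * ρ) + 2 * (C * R * (M * theta γ j)) + C * R ^ 2) := by gcongr
    _ ≤ τ * (3 * C * M * theta γ j * ρ + 3 * C * M * theta γ j * R) := by
        gcongr τ * ?_; linarith
    _ = _ := by ring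

/-- Since weights are at least one, `√θ i` and `√θ j` are below `√(θ i * θ j)`, so every term has
the scaling required off the diagonal. -/
lemma bilinear_bound (hg : IsGood γ q H z C τ) (hreg : IsReg γ H z C) (hC : 1 ≤ C) (hτ : 1 ≤ τ)
    {i j : Fin N} (hij : i ≠ j) :
    ‖∑ k, ∑ l, minorG H {i, j} z k l * (H i k * H j l : ℂ)‖ ≤
      3 * C * M * τ * √(theta γ i * theta γ j) * controlPhi N q z := by
  have hR := hs.inv_sqrt_pos
  have hR1 := hs.inv_sqrt_le_one
  have hρ := hs.rho_pos
  have hi := hs.one_le_theta i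
  have hj := hs.one_le_theta j
  have hM := hs.one_le_M
  refine (hg.bilinear i j hij (hreg.bound i j)).trans ?_
  have h1 := hs.sqrt_frobenius_le hreg (by linarith) i j i j
  have hp : 1 ≤ √(theta γ i * theta γ j) := Real.one_le_sqrt.2 (by nlinarith)
  have hi' : √(theta γ i) ≤ √(theta γ i * theta γ j) := Real.sqrt_le_sqrt (by nlinarith)
  have hj' : √(theta γ j) ≤ √(theta γ i * theta γ j) := Real.sqrt_le_sqrt (by nlinarith)
  have h2 := (hs.sqrt_sum_profile_le i).trans
    (mul_le_mul_of_nonneg_left hi' (by linarith : 0 ≤ M))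
  have h3 := (hs.sqrt_sum_profile_le j).trans
    (mul_le_mul_of_nonneg_left hj' (by linarith : 0 ≤ M))
  unfold controlPhi
  set R := 1 / √q
  set ρ := 1 / √(N * z.im)
  set p := √(theta γ i * theta γ j)
  have e1 : p * (C * ρ) ≤ 3 * C * M * p * ρ := by
    have : p * (C * ρ) * 1 ≤ p * (C * ρ) * (3 * M) := by gcongr; linarith
    linarith
  have e2 : C * R * (M * p) + C * R * (M * p) + C * R ^ 2 ≤ 3 * C * M * p * R := by
    have h3 : C * R * R ≤ C * R * (M * p) := by gcongr; nlinarith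
    nlinarith
  calc _ ≤ τ * (p * (C * ρ) + C * R * (M * p) + C * R * (M * p) + C * R ^ 2) := by gcongr
    _ ≤ τ * (3 * C * M * p * ρ + 3 * C * M * p * R) := by gcongr τ * ?_; linarith
    _ = _ := by ring

/-- The Schur complement formula with the quadratic form replaced by its expectation. -/
lemma exists_schur_error (hg : IsGood γ q H z C τ) (hreg : IsReg γ H z C) (hC : 1 ≤ C)
    (hτ : 1 ≤ τ) (i j : Fin N) {T : Finset (Fin N)} (hj : j ∉ T) (hT : insert j T = {i, j}) :
    ∃ e : ℂ, ‖e‖ ≤ (1 + 3 * C * M + r ^ 2 * M * C) * τ * theta γ j * controlPhi N q z ∧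
      minorG H T z j j * (z + ∑ k, (profile γ j k : ℂ) * minorG H {i, j} z k k + e) = -1 := by
  -- The condition on `T` covers two uses at once: `T = ∅` with `i = j` for the resolvent itself,
  -- and `T = {i}` for the second factor in the off-diagonal formula.
  have hsch := minorG_schur hg.symm hs.im_pos hj
  rw [hT] at hsch
  have hquad := hs.quadratic_bound hg hreg hC hτ i j
  set B := minorG H {i, j} z with hB
  set Q := ∑ k, ∑ l, B k l * (H j k * H j l : ℂ) with hQ
  set S := ∑ k, ((profile γ j k * (1 - q * profile γ j k) : ℝ) : ℂ) * B k k with hS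
  have hS' : S = ∑ k, (profile γ j k : ℂ) * B k k -
      ∑ k, ((q * profile γ j k ^ 2 : ℝ) : ℂ) * B k k := by
    rw [hS, ← Finset.sum_sub_distrib]
    refine Finset.sum_congr rfl fun k _ => ?_
    push_cast; ring
  set W := ∑ k, ((q * profile γ j k ^ 2 : ℝ) : ℂ) * B k k with hW
  -- Three sources of error: the diagonal entry, the fluctuation of the quadratic form, and the
  -- variance correction.
  refine ⟨-H j j + (Q - S) - W, ?_, ?_⟩
  · have hq : 0 < q := by linarith [hs.one_le_q]
    have hθ := hs.one_le_theta j
    have hR := hs.inv_sqrt_pos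
    have hRΦ := hs.inv_sqrt_le_phi
    have hM := hs.one_le_M
    have hWle : ‖W‖ ≤ r ^ 2 * M * C * τ * theta γ j * controlPhi N q z := by
      calc ‖W‖ ≤ ∑ k, q * profile γ j k ^ 2 * C := by
            refine (norm_sum_le _ _).trans (Finset.sum_le_sum fun k _ => ?_)
            rw [norm_mul, Complex.norm_real, Real.norm_of_nonneg (by positivity)]
            gcongr
            exact hreg.bound i j k k
        _ ≤ (r ^ 2 * M * (1 / √q) * theta γ j) * C := by
            rw [← Finset.sum_mul]; gcongr; exact hs.sum_q_profile_sq_le j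
        _ = r ^ 2 * M * C * 1 * theta γ j * (1 / √q) := by ring
        _ ≤ _ := by gcongr
    have hHle : ‖-(H j j : ℂ)‖ ≤ 1 * τ * theta γ j * controlPhi N q z := by
      rw [norm_neg, Complex.norm_real]
      calc |H j j| ≤ 1 * 1 * 1 * (1 / √q) := by simpa using hg.entry j j
        _ ≤ _ := by gcongr
    calc _ ≤ ‖-(H j j : ℂ)‖ + ‖Q - S‖ + ‖W‖ :=
          (norm_sub_le _ _).trans (add_le_add (norm_add_le _ _) le_rfl)
      _ ≤ 1 * τ * theta γ j * controlPhi N q z + 3 * C * M * τ * theta γ j * controlPhi N q z +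
          r ^ 2 * M * C * τ * theta γ j * controlPhi N q z := by gcongr
      _ = _ := by ring
  · rw [hS']
    linear_combination -hsch

/-- The change of the self-energy under removal of one row and column. -/
lemma norm_sum_profile_sub_le (hg : IsGood γ q H z C τ) (hreg : IsReg γ H z C) (hC : 1 ≤ C)
    (hτ : 1 ≤ τ) (i : Fin N) :
    ‖∑ k, (profile γ i k : ℂ) * (resolvent H z k k - minorG H {i} z k k)‖ ≤
      (r * C + 2 * C ^ 3 * M) * τ ^ 2 * theta γ i * controlPhi N q z := by
  have hθ := hs.one_le_theta i
  have hR := hs.inv_sqrt_pos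
  have hR1 := hs.inv_sqrt_le_one
  have hρ := hs.rho_pos
  have hM := hs.one_le_M
  have hz := hs.im_pos
  have hN := hs.N_pos'
  have hbound : ∀ k l, ‖minorG H {i} z k l‖ ≤ C := by
    have := hreg.bound i i; rwa [Finset.pair_eq_singleton] at this
  have hfrob : ∑ k, ∑ l, profile γ i k * profile γ i l * ‖minorG H {i} z k l‖ ^ 2 ≤ 
      theta γ i * theta γ i * (C * (1 / √(N * z.im))) ^ 2 := by
    have := hs.frobenius_le hreg i i i i
    rwa [Finset.pair_eq_singleton] at this
  set g := ‖resolvent H z i i‖ with hgdef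
  -- The profile weights vary with `k`, so the unweighted trace comparison does not apply. For `k ≠
  -- i` the difference is `G i i` times the square of a linear form in row `i`, to which the linear
  -- estimate applies; for `k = i` the minor entry is zero.
  have hterm : ∀ k, ‖(profile γ i k : ℂ) * (resolvent H z k k - minorG H {i} z k k)‖ ≤
      (if k = i then profile γ i i * C else 0) + profile γ i k * (g * (2 * τ ^ 2 *
        (∑ l, profile γ i l * ‖minorG H {i} z k l‖ ^ 2 + C ^ 2 * (1 / √q) ^ 2))) := by
    intro k
    have hp := hs.adm.profile_nonneg i k
    have hsum0 : 0 ≤ ∑ l, profile γ i l * ‖minorG H {i} z k l‖ ^ 2 :=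
      Finset.sum_nonneg fun l _ => mul_nonneg (hs.adm.profile_nonneg i l) (sq_nonneg _)
    rw [norm_mul, Complex.norm_real, Real.norm_of_nonneg hp]
    by_cases hk : k = i
    · subst hk
      rw [if_pos rfl, minorG_left (by simp), sub_zero]
      have h1 := hreg.diag k
      have h2 : 0 ≤ g * (2 * τ ^ 2 *
        (∑ l, profile γ k l * ‖minorG H {k} z k l‖ ^ 2 + C ^ 2 * (1 / √q) ^ 2)) := by positivity
      nlinarith [mul_nonneg hp h2, mul_le_mul_of_nonneg_left h1 hp]
    · rw [if_neg hk, zero_add]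
      refine mul_le_mul_of_nonneg_left ?_ hp
      have h1 := minorG_sub (T := ∅) hg.symm hz (i := i) (by simp) k k
      have h2 := minorG_col (T := ∅) hg.symm hz (i := i) (by simp) hk
      have h0 := minorG_diag_ne_zero (T := ∅) hg.symm hz (i := i) (by simp)
      rw [show insert i (∅ : Finset (Fin N)) = {i} from rfl, minorG_empty] at h1 h2
      rw [minorG_empty] at h0
      have h3 : resolvent H z k k - minorG H {i} z k k =
          resolvent H z i i * (∑ a, minorG H {i} z k a * (H i a : ℂ)) ^ 2 := by
        rw [h1, resolvent_symm hg.symm i k, h2]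
        simp only [hg.symm.apply i]
        field_simp
      rw [h3, norm_mul, norm_pow]
      gcongr
      set A := √(∑ l, profile γ i l * ‖minorG H {i} z k l‖ ^ 2) with hA
      have hAsq : A ^ 2 = ∑ l, profile γ i l * ‖minorG H {i} z k l‖ ^ 2 := Real.sq_sqrt hsum0
      calc _ ≤ (τ * (A + C * (1 / √q))) ^ 2 := by gcongr; exact hg.linear i k (hbound k)
        _ = τ ^ 2 * (A + C * (1 / √q)) ^ 2 := by ring
        _ ≤ τ ^ 2 * (2 * (A ^ 2 + C ^ 2 * (1 / √q) ^ 2)) := by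
            gcongr; nlinarith [sq_nonneg (A - C * (1 / √q))]
        _ = _ := by rw [hAsq]; ring
  refine (norm_sum_le _ _).trans ((Finset.sum_le_sum fun k _ => hterm k).trans ?_)
  rw [Finset.sum_add_distrib, Finset.sum_ite_eq' Finset.univ i, if_pos (Finset.mem_univ i)]
  have e1 : profile γ i i * C ≤ r * C * τ ^ 2 * theta γ i * (1 / √q) := by
    calc profile γ i i * C ≤ (theta γ i * (theta γ i / N)) * C := by
          gcongr
          refine (hs.adm.profile_le i i).trans (le_of_eq (by ring))
      _ ≤ (theta γ i * (r * (1 / √q))) * C := by gcongr; exact hs.theta_div_le i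
      _ = r * C * 1 * theta γ i * (1 / √q) := by ring
      _ ≤ _ := by gcongr; nlinarith
  have e2 : ∑ k, profile γ i k * (g * (2 * τ ^ 2 *
        (∑ l, profile γ i l * ‖minorG H {i} z k l‖ ^ 2 + C ^ 2 * (1 / √q) ^ 2))) =
      2 * τ ^ 2 * (g * ∑ k, ∑ l, profile γ i k * profile γ i l * ‖minorG H {i} z k l‖ ^ 2 +
        g * C ^ 2 * (1 / √q) ^ 2 * ∑ k, profile γ i k) := by
    simp only [mul_add, Finset.mul_sum, ← Finset.sum_add_distrib]
    refine Finset.sum_congr rfl fun k _ => ?_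
    congr 1
    · exact Finset.sum_congr rfl fun l _ => by ring
    · ring
  have hg0 : 0 ≤ g := norm_nonneg _
  -- One surplus factor `θ i` is absorbed by `weighted_diag`, at the price `√(N η)`. The Frobenius
  -- bound provides two factors `1 / √(N η)`, so one survives.
  have e3 : g * ∑ k, ∑ l, profile γ i k * profile γ i l * ‖minorG H {i} z k l‖ ^ 2 ≤
      C ^ 3 * M * theta γ i * (1 / √(N * z.im)) := by
    have hwd := hreg.weighted_diag i
    have hsq : √(N * z.im) * (1 / √(N * z.im)) = 1 :=
      mul_one_div_cancel (Real.sqrt_pos.2 (mul_pos hN hz)).ne'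
    set ρ := 1 / √(N * z.im)
    calc _ ≤ g * (theta γ i * theta γ i * (C * ρ) ^ 2) := by gcongr
      _ = (theta γ i * g) * (theta γ i * C ^ 2 * ρ ^ 2) := by ring
      _ ≤ (C * √(N * z.im)) * (theta γ i * C ^ 2 * ρ ^ 2) := by gcongr
      _ = C ^ 3 * 1 * theta γ i * ρ * (√(N * z.im) * ρ) := by ring
      _ ≤ _ := by rw [hsq, mul_one]; gcongr
  have e4 : g * C ^ 2 * (1 / √q) ^ 2 * ∑ k, profile γ i k ≤
      C ^ 3 * M * theta γ i * (1 / √q) := by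
    have h1 : (1 / √q) ^ 2 ≤ 1 / √q := by rw [sq]; nlinarith
    have h2 : 0 ≤ ∑ k, profile γ i k := Finset.sum_nonneg fun k _ => hs.adm.profile_nonneg i k
    calc _ ≤ C * C ^ 2 * (1 / √q) * (M * theta γ i) := by
          gcongr
          · exact hreg.diag i
          · exact hs.adm.sum_profile_le i
      _ = _ := by ring
  rw [e2]
  have e5 := mul_le_mul_of_nonneg_left (add_le_add e3 e4) (by positivity : 0 ≤ 2 * τ ^ 2)
  have e6 : r * C * τ ^ 2 * theta γ i * (1 / √q) ≤ r * C * τ ^ 2 * theta γ i * controlPhi N q z := by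
    gcongr; exact hs.inv_sqrt_le_phi
  unfold controlPhi at e6 ⊢
  linarith

end Setting

end Deterministic

end ChungLu

/-! ### The local law from a priori bounds; the macroscopic scale -/

namespace ChungLu

section Deterministic

variable {r N : ℕ} {γ : Fin r → Fin N → ℝ} {z : ℂ} {M q C τ : ℝ} {H : Matrix (Fin N) (Fin N) ℝ}

/-- The constant in the error term of the self-consistent equation. -/
def errConst (r : ℕ) (M C : ℝ) : ℝ :=
  (1 + 3 * C * M + r ^ 2 * M * C) + (r * C + 2 * C ^ 3 * M)

lemma errConst_pos (hM : 1 ≤ M) (hC : 1 ≤ C) (r : ℕ) : 0 < errConst r M C := by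
  unfold errConst; positivity

lemma norm_trace_sub_pair_le (hH : H.IsSymm) (hz : 0 < z.im) (i j : Fin N) :
    ‖∑ k, resolvent H z k k - ∑ k, minorG H {i, j} z k k‖ ≤ 2 * (1 / z.im) := by
  have h1 := norm_trace_minorG_sub_le (T := ∅) hH hz (i := i) (by simp)
  rw [minorG_empty, show insert i (∅ : Finset (Fin N)) = {i} from rfl] at h1
  have h0 : 0 < 1 / z.im := by positivity
  by_cases hij : i = j
  · subst hij
    rw [Finset.pair_eq_singleton]
    linarith
  · have h2 := norm_trace_minorG_sub_le (T := {i}) hH hz (i := j) (by simpa using Ne.symm hij)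
    rw [show insert j ({i} : Finset (Fin N)) = {i, j} by ext; simp [or_comm]] at h2
    have := norm_sub_le_norm_sub_add_norm_sub (∑ k, resolvent H z k k) (∑ k, minorG H {i} z k k)
      (∑ k, minorG H {i, j} z k k)
    linarith

namespace Setting

variable (hs : Setting γ M q z)
include hs

/-- The diagonal resolvent entries solve the self-consistent system up to a small error. -/
lemma exists_diag_error (hg : IsGood γ q H z C τ) (hreg : IsReg γ H z C) (hC : 1 ≤ C)
    (hτ : 1 ≤ τ) (i : Fin N) :
    ∃ e : ℂ, ‖e‖ ≤ theta γ i * (errConst r M C * τ ^ 2 * controlPhi N q z) ∧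
      resolvent H z i i * (den γ z (avg γ fun k => resolvent H z k k) i + e) = -1 := by
  obtain ⟨e, he, heq⟩ := hs.exists_schur_error hg hreg hC hτ i i (T := ∅) (by simp) (by simp)
  rw [minorG_empty, Finset.pair_eq_singleton] at heq
  have h2 := hs.norm_sum_profile_sub_le hg hreg hC hτ i
  refine ⟨e - ∑ k, (profile γ i k : ℂ) * (resolvent H z k k - minorG H {i} z k k), ?_, ?_⟩
  · have hΦ := hs.phi_pos
    have hM := hs.one_le_M
    have hθ := hs.theta_pos i
    calc _ ≤ (1 + 3 * C * M + r ^ 2 * M * C) * τ * theta γ i * controlPhi N q z +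
          (r * C + 2 * C ^ 3 * M) * τ ^ 2 * theta γ i * controlPhi N q z :=
          (norm_sub_le _ _).trans (add_le_add he h2)
      _ ≤ (1 + 3 * C * M + r ^ 2 * M * C) * τ ^ 2 * theta γ i * controlPhi N q z +
          (r * C + 2 * C ^ 3 * M) * τ ^ 2 * theta γ i * controlPhi N q z := by
          gcongr; nlinarith
      _ = _ := by unfold errConst; ring
  · rw [den, ← sum_profile_mul]
    simp only [mul_sub, Finset.sum_sub_distrib]
    linear_combination heq

/-- Upper bound on the diagonal entries of the resolvents of minors. -/
lemma norm_minorG_diag_le (hg : IsGood γ q H z C τ) (hreg : IsReg γ H z C) (hC : 1 ≤ C)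
    (hτ : 1 ≤ τ) {c : ℝ} (hc : 0 < c)
    (him : c ≤ (1 / (N : ℝ)) * ∑ k, (resolvent H z k k).im)
    (hsmall : errConst r M C * τ ^ 2 * controlPhi N q z ≤ c / 4)
    (hsmall' : controlPhi N q z ^ 2 ≤ c / 8)
    (i j : Fin N) {T : Finset (Fin N)} (hj : j ∉ T) (hT : insert j T = {i, j}) :
    ‖minorG H T z j j‖ ≤ 2 / (c * theta γ j) := by
  obtain ⟨e, he, heq⟩ := hs.exists_schur_error hg hreg hC hτ i j hj hT
  have hθ := hs.theta_pos j
  have hN := hs.N_pos'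
  have hz := hs.im_pos
  have hM := hs.one_le_M
  have hΦ := hs.phi_pos
  set B := minorG H {i, j} z with hB
  set w := z + ∑ k, (profile γ j k : ℂ) * B k k + e with hw
  have hw0 : w ≠ 0 := by intro h0; rw [h0, mul_zero] at heq; norm_num at heq
  have heq' : minorG H T z j j = -1 / w := by rw [eq_div_iff hw0, heq]
  -- Removing two rows changes the normalised trace by at most `2 / (N η) ≤ 2 * Φ ^ 2 ≤ c / 4`.
  have htr : (1 / (N : ℝ)) * ∑ k, (resolvent H z k k).im - c / 4 ≤
      (1 / (N : ℝ)) * ∑ k, (B k k).im := by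
    have h1 := norm_trace_sub_pair_le hg.symm hz i j
    have h2 := (le_abs_self _).trans ((Complex.abs_im_le_norm _).trans h1)
    rw [Complex.sub_im, Complex.im_sum, Complex.im_sum] at h2
    have h3 : (1 / (N : ℝ)) * (2 * (1 / z.im)) ≤ c / 4 := by
      have h4 : (1 / (N : ℝ)) * (2 * (1 / z.im)) = 2 * (1 / √(N * z.im)) ^ 2 := by
        rw [hs.rho_sq]; field_simp
      have h5 : (1 / √(N * z.im)) ^ 2 ≤ controlPhi N q z ^ 2 := by
        have := hs.rho_pos
        gcongr; exact hs.rho_le_phi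
      linarith
    have h6 := mul_le_mul_of_nonneg_left h2 (by positivity : 0 ≤ 1 / (N : ℝ))
    rw [mul_sub] at h6
    linarith
  -- Of the `c` in the trace, a quarter is lost to the minor and a quarter to the Schur error.
  -- Positivity of the diagonal imaginary parts allows replacing the profile by `θ j / N`.
  have him2 : theta γ j * (c / 2) ≤ w.im := by
    have e1 : w.im = z.im + ∑ k, profile γ j k * (B k k).im + e.im := by
      simp [hw, Complex.im_sum]
    have e2 : theta γ j * ((1 / (N : ℝ)) * ∑ k, (B k k).im) ≤
        ∑ k, profile γ j k * (B k k).im := by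
      rw [← mul_assoc, Finset.mul_sum]
      refine Finset.sum_le_sum fun k _ => mul_le_mul_of_nonneg_right ?_
        (minorG_im_nonneg hg.symm hz k)
      rw [mul_one_div]; exact hs.adm.theta_div_le_profile j k
    have e3 : ‖e‖ ≤ theta γ j * (c / 4) := by
      calc ‖e‖ ≤ (1 + 3 * C * M + r ^ 2 * M * C) * τ * theta γ j * controlPhi N q z := he
        _ ≤ errConst r M C * τ ^ 2 * theta γ j * controlPhi N q z := by
            have h7 : 1 + 3 * C * M + r ^ 2 * M * C ≤ errConst r M C := by
              have : 0 ≤ (r * C + 2 * C ^ 3 * M) := by positivity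
              unfold errConst; linarith
            have h8 : τ ≤ τ ^ 2 := by nlinarith
            have h9 := (errConst_pos hM hC r).le
            gcongr
        _ = theta γ j * (errConst r M C * τ ^ 2 * controlPhi N q z) := by ring
        _ ≤ _ := by gcongr
    have e4 := (abs_le.1 ((Complex.abs_im_le_norm e).trans e3)).1
    have e5 := mul_le_mul_of_nonneg_left (him.trans (le_of_eq (by ring :
      _ = ((1 / (N : ℝ)) * ∑ k, (resolvent H z k k).im - c / 4) + c / 4))) hθ.le
    have e6 := mul_le_mul_of_nonneg_left htr hθ.le
    rw [e1]
    nlinarith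
  rw [heq']
  refine (norm_neg_one_div_le (mul_pos hθ (half_pos hc)) him2).trans (le_of_eq ?_)
  field_simp

/-- The two diagonal factors contribute `1 / (θ i * θ j)` and the bilinear form `√(θ i * θ j)`, so
the weights cancel exactly. -/
lemma offDiag_bound (hg : IsGood γ q H z C τ) (hreg : IsReg γ H z C) (hC : 1 ≤ C)
    (hτ : 1 ≤ τ) {c : ℝ} (hc : 0 < c)
    (him : c ≤ (1 / (N : ℝ)) * ∑ k, (resolvent H z k k).im)
    (hsmall : errConst r M C * τ ^ 2 * controlPhi N q z ≤ c / 4)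
    (hsmall' : controlPhi N q z ^ 2 ≤ c / 8) {i j : Fin N} (hij : i ≠ j) :
    √(theta γ i * theta γ j) * ‖resolvent H z i j‖ ≤
      4 / c ^ 2 * (1 + 3 * C * M) * τ ^ 2 * controlPhi N q z := by
  have hi := hs.one_le_theta i
  have hj := hs.one_le_theta j
  have hM := hs.one_le_M
  have hΦ := hs.phi_pos
  have h1 := hs.norm_minorG_diag_le hg hreg hC hτ hc him hsmall hsmall' i i (T := ∅) (by simp)
    (by simp)
  rw [minorG_empty] at h1
  have h2 := hs.norm_minorG_diag_le hg hreg hC hτ hc him hsmall hsmall' i j (T := {i})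
    (by simpa using hij.symm) (by ext; simp [or_comm])
  have h3 := hs.bilinear_bound hg hreg hC hτ hij
  rw [resolvent_offDiag hg.symm hs.im_pos hij, norm_mul, norm_mul, norm_neg]
  set p := √(theta γ i * theta γ j) with hp
  have hp1 : 1 ≤ p := Real.one_le_sqrt.2 (by nlinarith)
  have hpsq : p * p = theta γ i * theta γ j := Real.mul_self_sqrt (by nlinarith)
  have h4 : ‖(H i j : ℂ) - ∑ k, ∑ l, minorG H {i, j} z k l * (H i k * H j l : ℂ)‖ ≤
      (1 + 3 * C * M) * τ * p * controlPhi N q z := by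
    have h5 : ‖(H i j : ℂ)‖ ≤ 1 * τ * p * controlPhi N q z := by
      rw [Complex.norm_real]
      calc |H i j| ≤ 1 * 1 * 1 * (1 / √q) := by simpa using hg.entry i j
        _ ≤ _ := by
          have := hs.inv_sqrt_pos
          gcongr; exact hs.inv_sqrt_le_phi
    calc _ ≤ 1 * τ * p * controlPhi N q z + 3 * C * M * τ * p * controlPhi N q z :=
          (norm_sub_le _ _).trans (add_le_add h5 h3)
      _ = _ := by ring
  calc _ ≤ p * (2 / (c * theta γ i) * (2 / (c * theta γ j)) *
        ((1 + 3 * C * M) * τ * p * controlPhi N q z)) := by gcongr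
    _ = (p * p) / (theta γ i * theta γ j) *
        (4 / c ^ 2 * (1 + 3 * C * M) * τ * controlPhi N q z) := by field_simp; ring
    _ = 4 / c ^ 2 * (1 + 3 * C * M) * τ * controlPhi N q z := by
        rw [hpsq, div_self (by positivity), one_mul]
    _ ≤ _ := by gcongr; nlinarith

end Setting

/-- On the good event, a priori bounds on the resolvent imply the local law. -/
theorem local_law_of_isGood (hr : 0 < r) {c Z : ℝ} (hM : 1 ≤ M) (hc : 0 < c) (hZ : 0 ≤ Z)
    (hC : 1 ≤ C) :
    ∃ ψ₀ K : ℝ, 0 < ψ₀ ∧ 0 < K ∧ ∀ (N : ℕ) (γ : Fin r → Fin N → ℝ) (q : ℝ) (z : ℂ)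
      (u : Fin r → ℂ) (H : Matrix (Fin N) (Fin N) ℝ) (τ : ℝ), Setting γ M q z → ‖z‖ ≤ Z →
      dysonMap γ z u = u → (∀ k, c ≤ (u k).im) → IsGood γ q H z C τ → IsReg γ H z C →
      c ≤ (1 / (N : ℝ)) * ∑ k, (resolvent H z k k).im → 1 ≤ τ → τ ^ 2 * controlPhi N q z ≤ ψ₀ →
      (∀ i, theta γ i * ‖resolvent H z i i - -1 / den γ z u i‖ ≤
        K * (τ ^ 2 * controlPhi N q z)) ∧
      ∀ i j, i ≠ j → √(theta γ i * theta γ j) * ‖resolvent H z i j‖ ≤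
        K * (τ ^ 2 * controlPhi N q z) := by
  obtain ⟨ψ₁, K₁, hψ₁, hK₁, hstab⟩ := stability hr hM hc hZ
  have hE := errConst_pos hM hC r
  set E := errConst r M C
  -- The first threshold feeds the stability theorem, the second keeps the Schur error below `c /
  -- 4`, and the last two give `Φ ^ 2 ≤ c / 8`.
  refine ⟨min (min (ψ₁ / E) (c / 4 / E)) (min 1 (c / 8)), K₁ * E + 4 / c ^ 2 * (1 + 3 * C * M),
    by positivity, by positivity, ?_⟩
  intro N γ q z u H τ hs hzZ hu hcu hg hreg him hτ hψ
  have hΦ := hs.phi_pos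
  have h1 : τ ^ 2 * controlPhi N q z ≤ ψ₁ / E :=
    hψ.trans ((min_le_left _ _).trans (min_le_left _ _))
  have h2 : τ ^ 2 * controlPhi N q z ≤ c / 4 / E :=
    hψ.trans ((min_le_left _ _).trans (min_le_right _ _))
  have h3 : τ ^ 2 * controlPhi N q z ≤ 1 := hψ.trans ((min_le_right _ _).trans (min_le_left _ _))
  have h4 : τ ^ 2 * controlPhi N q z ≤ c / 8 :=
    hψ.trans ((min_le_right _ _).trans (min_le_right _ _))
  rw [le_div_iff₀ hE] at h1 h2
  have hτΦ : controlPhi N q z ≤ τ ^ 2 * controlPhi N q z := by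
    have : 1 ≤ τ ^ 2 := by nlinarith
    nlinarith
  have hsmall : E * τ ^ 2 * controlPhi N q z ≤ c / 4 := by linarith
  have hsmall' : controlPhi N q z ^ 2 ≤ c / 8 := by nlinarith
  have hnn : 0 ≤ τ ^ 2 * controlPhi N q z := hΦ.le.trans hτΦ
  constructor
  · choose e he heq using hs.exists_diag_error hg hreg hC hτ
    have hcG : ∀ k, c ≤ (avg γ (fun k => resolvent H z k k) k).im := fun k => by
      rw [avg_im]
      refine him.trans ?_
      gcongr with i _
      have := resolvent_im_nonneg hg.symm hs.im_pos i
      nlinarith [hs.adm.one_le k i]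
    intro i
    refine (hstab N γ q z u (fun k => resolvent H z k k) e (E * τ ^ 2 * controlPhi N q z) hs.N_pos
      hs.adm hs.im_pos hzZ hu hcu hcG heq he (by linarith) i).trans ?_
    have : 0 ≤ 4 / c ^ 2 * (1 + 3 * C * M) := by positivity
    nlinarith [mul_nonneg this hnn]
  · intro i j hij
    refine (hs.offDiag_bound hg hreg hC hτ hc him hsmall hsmall' hij).trans ?_
    have : 0 ≤ K₁ * E := by positivity
    nlinarith [mul_nonneg this hnn]

/-- `θₖ θₗ ≤ (θₖ² + θₗ²) / 2` and symmetry put the whole weight on one index; the Ward identity then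
sums over the other. -/
lemma Setting.frobenius_of_sum_le (hs : Setting γ M q z) (hH : H.IsSymm) (T : Finset (Fin N)) :
    ∑ k, ∑ l, theta γ k * theta γ l * ‖minorG H T z k l‖ ^ 2 ≤
      ∑ k, theta γ k ^ 2 * ((minorG H T z k k).im / z.im) := by
  have h1 : ∑ k, ∑ l, theta γ k * theta γ l * ‖minorG H T z k l‖ ^ 2 ≤
      ∑ k, ∑ l, (theta γ k ^ 2 + theta γ l ^ 2) / 2 * ‖minorG H T z k l‖ ^ 2 := by
    gcongr with k _ l _
    nlinarith [sq_nonneg (theta γ k - theta γ l)]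
  have h2 : ∑ k, ∑ l, theta γ l ^ 2 * ‖minorG H T z k l‖ ^ 2 =
      ∑ k, ∑ l, theta γ k ^ 2 * ‖minorG H T z k l‖ ^ 2 := by
    rw [Finset.sum_comm]
    simp only [minorG_symm hH]
  have h3 : ∑ k, ∑ l, (theta γ k ^ 2 + theta γ l ^ 2) / 2 * ‖minorG H T z k l‖ ^ 2 =
      ∑ k, ∑ l, theta γ k ^ 2 * ‖minorG H T z k l‖ ^ 2 := by
    have : ∑ k, ∑ l, (theta γ k ^ 2 + theta γ l ^ 2) / 2 * ‖minorG H T z k l‖ ^ 2 =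
        (∑ k, ∑ l, theta γ k ^ 2 * ‖minorG H T z k l‖ ^ 2 +
          ∑ k, ∑ l, theta γ l ^ 2 * ‖minorG H T z k l‖ ^ 2) / 2 := by
      simp only [Finset.sum_div, ← Finset.sum_add_distrib]
      exact Finset.sum_congr rfl fun k _ => Finset.sum_congr rfl fun l _ => by ring
    rw [this, h2]; ring
  rw [h3] at h1
  refine h1.trans (Finset.sum_le_sum fun k _ => ?_)
  rw [← Finset.mul_sum]
  gcongr
  have := sum_norm_sq_minorG_le (T := T) hH hs.im_pos k
  simpa only [minorG_symm hH k] using this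

lemma Setting.sum_theta_sq_le (hs : Setting γ M q z) :
    ∑ k, theta γ k ^ 2 ≤ N * (r * M) := by
  have h := hs.adm.mean_theta_sq_le
  rwa [one_div, inv_mul_le_iff₀ hs.N_pos'] at h

lemma Setting.theta_le (hs : Setting γ M q z) (i : Fin N) : theta γ i ≤ r * √N := by
  have h := hs.adm.mul_theta_sq_le (by linarith [hs.one_le_q]) hs.N_pos i
  have h1 := hs.one_le_q
  have hr := hs.one_le_r
  have hN := hs.N_pos'
  refine (sq_le_sq₀ (hs.theta_pos i).le (by positivity)).1 ?_
  rw [mul_pow, Real.sq_sqrt hN.le]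
  calc theta γ i ^ 2 ≤ q * theta γ i ^ 2 := by nlinarith [sq_nonneg (theta γ i)]
    _ ≤ (r : ℝ) * N := h
    _ ≤ (r : ℝ) ^ 2 * N := by gcongr; nlinarith

/-- The a priori bounds hold trivially at macroscopic distance from the real axis. -/
lemma Setting.isReg_of_one_le (hs : Setting γ M q z) (hH : H.IsSymm) (h1 : 1 ≤ z.im)
    (h10 : z.im ≤ 10) : IsReg γ H z (10 * r * M) := by
  have hM := hs.one_le_M
  have hr := hs.one_le_r
  have hN := hs.N_pos'
  have hinv : 1 / z.im ≤ 1 := by rw [div_le_one (by linarith)]; exact h1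
  have hrM : 1 ≤ r * M := by nlinarith
  refine ⟨fun i j k l => ?_, fun i j => ?_, fun i => ?_, fun i => ?_⟩
  · refine (norm_minorG_le hH hs.im_pos k l).trans (hinv.trans ?_); linarith
  · refine (hs.frobenius_of_sum_le hH _).trans ?_
    calc _ ≤ ∑ k, theta γ k ^ 2 * 1 := by
          gcongr with k _
          rw [div_le_one (by linarith)]
          refine le_trans ((le_abs_self _).trans (Complex.abs_im_le_norm _)) ?_
          exact (norm_minorG_le hH hs.im_pos k k).trans (hinv.trans h1)
      _ ≤ N * (r * M) := by simpa using hs.sum_theta_sq_le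
      _ ≤ _ := by
          rw [← mul_div_assoc, le_div_iff₀ hs.im_pos]
          calc N * (r * M) * z.im ≤ N * (r * M) * 10 := by gcongr
            _ = N * (r * M * 10) := by ring
            _ ≤ N * (100 * (r * M) * (r * M)) :=
                mul_le_mul_of_nonneg_left (by nlinarith) hN.le
            _ = _ := by ring
  · refine (norm_resolvent_diag_le hH hs.im_pos i).trans (hinv.trans ?_); linarith
  -- Without knowing that `G i i` is of size `1 / θ i`, only `θ i ≤ r * √N` is available;
  -- `weighted_diag` has the factor `√(N η)` so that this suffices at the start.
  · calc theta γ i * ‖resolvent H z i i‖ ≤ (r * √N) * 1 := by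
          gcongr
          · exact hs.theta_le i
          · exact (norm_resolvent_diag_le hH hs.im_pos i).trans hinv
      _ ≤ (10 * r * M) * √N := by
          have := Real.sqrt_nonneg N
          have h2 : (r : ℝ) ≤ 10 * r * M := by nlinarith
          nlinarith
      _ ≤ _ := by
          gcongr
          nlinarith

/-- Lower bound on the imaginary part of the normalised trace at macroscopic distance from the
real axis. -/
lemma Setting.le_trace_im_of_one_le (hs : Setting γ M q z) (hg : IsGood γ q H z C τ)
    (hreg : IsReg γ H z C) (hC : 1 ≤ C) (hτ : 1 ≤ τ) {Z : ℝ} (hzZ : ‖z‖ ≤ Z) (h1 : 1 ≤ z.im)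
    (hsmall : errConst r M C * τ ^ 2 * controlPhi N q z ≤ 1) :
    1 / (Z + C * M + 1) ^ 2 * (1 / (r * M)) ≤
      (1 / (N : ℝ)) * ∑ k, (resolvent H z k k).im := by
  have hM := hs.one_le_M
  have hN := hs.N_pos'
  have hZ : 0 ≤ Z := (norm_nonneg z).trans hzZ
  -- The self-consistent equation bounds `|G i i|` below by a multiple of `1 / θ i`, and the Ward
  -- identity gives `Im G i i ≥ η * |G i i| ^ 2` with `η ≥ 1`.
  have hlow : ∀ i, 1 / (Z + C * M + 1) ^ 2 * (1 / theta γ i ^ 2) ≤ (resolvent H z i i).im := by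
    intro i
    obtain ⟨e, he, heq⟩ := hs.exists_diag_error hg hreg hC hτ i
    have hθ := hs.one_le_theta i
    have hav : ∀ k, ‖avg γ (fun k => resolvent H z k k) k‖ ≤ C * M := fun k => by
      refine (norm_avg_le hs.adm.nonneg _ k).trans ?_
      calc _ ≤ (1 / (N : ℝ)) * ∑ i, γ k i * C := by
            gcongr with i _
            · exact hs.adm.nonneg k i
            · exact hreg.diag i
        _ = C * ((1 / (N : ℝ)) * ∑ i, γ k i) := by rw [← Finset.sum_mul]; ring
        _ ≤ _ := by gcongr; exact hs.adm.mean_le k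
    have hden := hs.adm.norm_den_le hs.r_pos hzZ hav i
    set w := den γ z (avg γ fun k => resolvent H z k k) i + e with hw
    have hwn : ‖w‖ ≤ theta γ i * (Z + C * M + 1) := by
      calc ‖w‖ ≤ theta γ i * (Z + C * M) + theta γ i * 1 := by
            refine (norm_add_le _ _).trans (add_le_add hden (he.trans ?_))
            gcongr
        _ = _ := by ring
    have hprod : ‖resolvent H z i i‖ * ‖w‖ = 1 := by
      rw [← norm_mul, heq]; simp
    have hpos : 0 < theta γ i * (Z + C * M + 1) := by positivity
    have hGn : 1 / (theta γ i * (Z + C * M + 1)) ≤ ‖resolvent H z i i‖ := by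
      rw [div_le_iff₀ hpos]
      calc 1 = ‖resolvent H z i i‖ * ‖w‖ := hprod.symm
        _ ≤ _ := by gcongr
    calc _ = (1 / (theta γ i * (Z + C * M + 1))) ^ 2 := by field_simp
      _ ≤ ‖resolvent H z i i‖ ^ 2 := by gcongr
      _ ≤ (resolvent H z i i).im / z.im := norm_sq_resolvent_le hg.symm hs.im_pos i i
      _ ≤ _ := div_le_self (resolvent_im_nonneg hg.symm hs.im_pos i) h1
  calc _ ≤ 1 / (Z + C * M + 1) ^ 2 * ((1 / (N : ℝ)) * ∑ i, 1 / theta γ i ^ 2) := by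
        gcongr; exact hs.adm.sum_inv_theta_sq hs.r_pos hs.N_pos
    _ = (1 / (N : ℝ)) * ∑ i, 1 / (Z + C * M + 1) ^ 2 * (1 / theta γ i ^ 2) := by
        rw [← Finset.mul_sum]; ring
    _ ≤ _ := by gcongr with i _; exact hlow i

end Deterministic

end ChungLu

/-! ### Bootstrap along a vertical grid -/

namespace ChungLu

section Bootstrap

variable {r N : ℕ} {γ : Fin r → Fin N → ℝ} {z : ℂ} {M q C τ : ℝ} {H : Matrix (Fin N) (Fin N) ℝ}
  {g : Fin N → ℂ} {T : Finset (Fin N)}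

lemma IsReg.mono (h : IsReg γ H z C) (hz : 0 < z.im) (hC : 0 ≤ C) {C' : ℝ} (hCC' : C ≤ C') :
    IsReg γ H z C' :=
  ⟨fun i j k l => (h.bound i j k l).trans hCC',
    fun i j => (h.frobenius i j).trans (by gcongr),
    fun i => (h.diag i).trans hCC', fun i => (h.weighted_diag i).trans (by gcongr)⟩

/-- The resolvent is entrywise close to a diagonal matrix, in weighted norm. -/
def IsClose (γ : Fin r → Fin N → ℝ) (H : Matrix (Fin N) (Fin N) ℝ) (z : ℂ) (g : Fin N → ℂ)
    (a : ℝ) : Prop :=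
  ∀ i j, √(theta γ i * theta γ j) * ‖resolvent H z i j - if i = j then g i else 0‖ ≤ a

lemma IsClose.diag (h : IsClose γ H z g C) (hθ : ∀ i, 0 ≤ theta γ i) (i : Fin N) :
    theta γ i * ‖resolvent H z i i - g i‖ ≤ C := by
  have := h i i
  rwa [if_pos rfl, Real.sqrt_mul_self (hθ i)] at this

lemma IsClose.offDiag (h : IsClose γ H z g C) {i j : Fin N} (hij : i ≠ j) :
    √(theta γ i * theta γ j) * ‖resolvent H z i j‖ ≤ C := by
  have := h i j
  rwa [if_neg hij, sub_zero] at this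

/-- In `minorG_sub` the weights combine as `√(θ k θ i) * √(θ i θ l) / θ i`. Weighted sup bounds
therefore survive the removal of a row whose weighted diagonal entry is bounded below. -/
lemma Setting.weighted_minorG_insert_le (hs : Setting γ M q z) (hH : H.IsSymm) {K b : ℝ}
    (hb : 0 < b) (hK : ∀ k l, √(theta γ k * theta γ l) * ‖minorG H T z k l‖ ≤ K) {i : Fin N}
    (hi : i ∉ T) (hlow : b ≤ theta γ i * ‖minorG H T z i i‖) (k l : Fin N) :
    √(theta γ k * theta γ l) * ‖minorG H (insert i T) z k l‖ ≤ K + K ^ 2 / b := by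
  have h1 := minorG_sub hH hs.im_pos hi k l
  have hK0 : 0 ≤ K := le_trans (by positivity) (hK k l)
  have h2 : minorG H (insert i T) z k l = minorG H T z k l -
      minorG H T z k i * minorG H T z i l / minorG H T z i i := by rw [← h1]; ring
  have hk := hs.theta_pos k
  have hl := hs.theta_pos l
  have hi' := hs.theta_pos i
  have h0 := norm_pos_iff.2 (minorG_diag_ne_zero hH hs.im_pos hi)
  have h3 : √(theta γ k * theta γ l) * ‖minorG H T z k i * minorG H T z i l / minorG H T z i i‖ ≤
      K ^ 2 / b := by
    have e : √(theta γ k * theta γ l) *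
        ‖minorG H T z k i * minorG H T z i l / minorG H T z i i‖ =
        (√(theta γ k * theta γ i) * ‖minorG H T z k i‖) *
          (√(theta γ i * theta γ l) * ‖minorG H T z i l‖) /
          (theta γ i * ‖minorG H T z i i‖) := by
      rw [norm_div, norm_mul, Real.sqrt_mul hk.le, Real.sqrt_mul hk.le, Real.sqrt_mul hi'.le]
      have h4 := Real.mul_self_sqrt hi'.le
      have h5 : 0 < √(theta γ i) := Real.sqrt_pos.2 hi'
      rw [eq_div_iff (mul_pos hi' h0).ne', ← mul_div_assoc, div_mul_eq_mul_div,
        div_eq_iff h0.ne']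
      linear_combination (-√(theta γ k) * √(theta γ l) * ‖minorG H T z k i‖ *
        ‖minorG H T z i l‖ * ‖minorG H T z i i‖) * h4
    rw [e, sq]
    have h6 := hK k i
    have h7 := hK i l
    gcongr
  rw [h2]
  calc _ ≤ √(theta γ k * theta γ l) * (‖minorG H T z k l‖ +
        ‖minorG H T z k i * minorG H T z i l / minorG H T z i i‖) := by
        gcongr; exact norm_sub_le _ _
    _ ≤ _ := by rw [mul_add]; exact add_le_add (hK k l) h3

/-- If the resolvent is close to a diagonal matrix, then the a priori bounds hold. -/
lemma Setting.isReg_of_isClose (hs : Setting γ M q z) (hH : H.IsSymm) (hη : 1 ≤ N * z.im)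
    {a c₁ C₁ : ℝ} (hc₁ : 0 < c₁) (hC₁ : 1 ≤ C₁) (hlow : ∀ i, c₁ ≤ theta γ i * ‖g i‖)
    (hup : ∀ i, theta γ i * ‖g i‖ ≤ C₁) (ha : a ≤ c₁ / 4) (ha1 : a ≤ 1)
    (h : IsClose γ H z g a) :
    ∃ K, K = C₁ + 1 + (C₁ + 1) ^ 2 / (c₁ / 4) ∧ IsReg γ H z ((K + K ^ 2 / (c₁ / 4)) * r * M) := by
  refine ⟨_, rfl, ?_⟩
  set K₀ := C₁ + 1 with hK₀
  set K := K₀ + K₀ ^ 2 / (c₁ / 4) with hK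
  have hθ := hs.theta_pos
  have hM := hs.one_le_M
  have hr := hs.one_le_r
  have hz := hs.im_pos
  have hN := hs.N_pos'
  have a0 : ∀ k l, √(theta γ k * theta γ l) * ‖minorG H ∅ z k l‖ ≤ K₀ := by
    intro k l
    rw [minorG_empty]
    by_cases hkl : k = l
    · subst hkl
      have h1 := h.diag (fun i => (hθ i).le) k
      rw [Real.sqrt_mul_self (hθ k).le]
      calc _ ≤ theta γ k * (‖resolvent H z k k - g k‖ + ‖g k‖) := by
            gcongr
            · exact (hθ k).le
            · simpa using norm_add_le (resolvent H z k k - g k) (g k)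
        _ ≤ _ := by rw [mul_add]; linarith [hup k]
    · exact (h.offDiag hkl).trans (by linarith)
  have b0 : ∀ i, c₁ / 2 ≤ theta γ i * ‖minorG H ∅ z i i‖ := by
    intro i
    rw [minorG_empty]
    have h1 := h.diag (fun i => (hθ i).le) i
    have h2 : ‖g i‖ ≤ ‖resolvent H z i i‖ + ‖resolvent H z i i - g i‖ := by
      have := norm_sub_le (resolvent H z i i) (resolvent H z i i - g i)
      simpa using this
    have h3 := mul_le_mul_of_nonneg_left h2 (hθ i).le
    rw [mul_add] at h3
    linarith [hlow i]
  have a1 : ∀ i k l, √(theta γ k * theta γ l) * ‖minorG H {i} z k l‖ ≤ K := fun i k l =>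
    hs.weighted_minorG_insert_le hH (by linarith : 0 < c₁ / 4) a0 (T := ∅) (i := i) (by simp)
      ((by linarith : c₁ / 4 ≤ c₁ / 2).trans (b0 i)) k l
  -- The second removal also needs a lower bound on the diagonal of the first minor. The correction
  -- is a square of a weighted off-diagonal entry over `θ i * |G i i|`, at most `c₁ / 4`.
  have b1 : ∀ i j, i ≠ j → c₁ / 4 ≤ theta γ j * ‖minorG H {i} z j j‖ := by
    intro i j hij
    have h1 := minorG_sub (T := ∅) hH hz (i := i) (by simp) j j
    rw [show insert i (∅ : Finset (Fin N)) = {i} from rfl, minorG_empty] at h1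
    have h2 : ‖resolvent H z j j‖ ≤ ‖minorG H {i} z j j‖ +
        ‖resolvent H z j i * resolvent H z i j / resolvent H z i i‖ := by
      rw [← h1]
      have := norm_add_le (minorG H {i} z j j) (resolvent H z j j - minorG H {i} z j j)
      simpa using this
    have hb := b0 i
    have hb' := b0 j
    rw [minorG_empty] at hb hb'
    have h3 : theta γ j * ‖resolvent H z j i * resolvent H z i j / resolvent H z i i‖ ≤
        c₁ / 4 := by
      have h4 := h.offDiag hij
      have ha0 : 0 ≤ a := le_trans (by positivity) h4
      have hsq : √(theta γ i * theta γ j) ^ 2 = theta γ i * theta γ j :=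
        Real.sq_sqrt (mul_pos (hθ i) (hθ j)).le
      have e : theta γ j * ‖resolvent H z j i * resolvent H z i j / resolvent H z i i‖ =
          (√(theta γ i * theta γ j) * ‖resolvent H z i j‖) ^ 2 /
            (theta γ i * ‖resolvent H z i i‖) := by
        rw [norm_div, norm_mul, resolvent_symm hH j i, mul_pow, hsq]
        have := (hθ i).ne'
        field_simp
      rw [e, div_le_iff₀ (by linarith)]
      calc _ ≤ (c₁ / 4) ^ 2 := by gcongr; exact h4.trans ha
        _ ≤ c₁ / 4 * (c₁ / 2) := by nlinarith
        _ ≤ _ := by gcongr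
    have h5 := mul_le_mul_of_nonneg_left h2 (hθ j).le
    rw [mul_add] at h5
    linarith
  have hK1 : 1 ≤ K := by
    have : 0 ≤ K₀ ^ 2 / (c₁ / 4) := by positivity
    linarith
  set K₂ := K + K ^ 2 / (c₁ / 4) with hK₂
  have hKK₂ : K ≤ K₂ := by
    have : 0 ≤ K ^ 2 / (c₁ / 4) := by positivity
    linarith
  have a2 : ∀ i j k l, √(theta γ k * theta γ l) * ‖minorG H {i, j} z k l‖ ≤ K₂ := by
    intro i j k l
    by_cases hij : i = j
    · subst hij
      rw [Finset.pair_eq_singleton]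
      exact (a1 i k l).trans hKK₂
    · have := hs.weighted_minorG_insert_le hH (by linarith : 0 < c₁ / 4) (a1 i) (T := {i}) (i := j)
        (by simpa using Ne.symm hij) (b1 i j hij) k l
      rwa [show insert j ({i} : Finset (Fin N)) = {i, j} by ext; simp [or_comm]] at this
  have hrM : 1 ≤ r * M := by nlinarith
  have hK₂C : K₂ ≤ K₂ * r * M := by
    rw [mul_assoc]; nlinarith
  have hone : ∀ k l, 1 ≤ √(theta γ k * theta γ l) := fun k l =>
    Real.one_le_sqrt.2 (by nlinarith [hs.one_le_theta k, hs.one_le_theta l])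
  refine ⟨fun i j k l => ?_, fun i j => ?_, fun i => ?_, fun i => ?_⟩
  · refine le_trans ?_ ((a2 i j k l).trans hK₂C)
    nlinarith [hone k l, norm_nonneg (minorG H {i, j} z k l)]
  · refine (hs.frobenius_of_sum_le hH _).trans ?_
    calc _ ≤ ∑ k, theta γ k ^ 2 * (K₂ / z.im) := by
          gcongr with k _
          refine ((le_abs_self _).trans (Complex.abs_im_le_norm _)).trans ?_
          refine le_trans ?_ (a2 i j k k)
          nlinarith [hone k k, norm_nonneg (minorG H {i, j} z k k)]
      _ = (∑ k, theta γ k ^ 2) * (K₂ / z.im) := by rw [Finset.sum_mul]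
      _ ≤ N * (r * M) * (K₂ / z.im) := by gcongr; exact hs.sum_theta_sq_le
      _ = (K₂ * r * M) * 1 * (N / z.im) := by ring
      _ ≤ (K₂ * r * M) * (K₂ * r * M) * (N / z.im) := by gcongr; linarith
      _ = _ := by ring
  · have := a0 i i
    rw [minorG_empty] at this
    refine le_trans ?_ (this.trans ((by linarith [show 0 ≤ K₀ ^ 2 / (c₁ / 4) by positivity] :
      K₀ ≤ K₂).trans hK₂C))
    nlinarith [hone i i, norm_nonneg (resolvent H z i i)]
  · have := a0 i i
    rw [minorG_empty, Real.sqrt_mul_self (hθ i).le] at this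
    refine this.trans ((by linarith [show 0 ≤ K₀ ^ 2 / (c₁ / 4) by positivity] :
      K₀ ≤ K₂).trans (hK₂C.trans ?_))
    have h1 : 1 ≤ √(N * z.im) := Real.one_le_sqrt.2 hη
    nlinarith

lemma Setting.le_trace_im_of_isClose (hs : Setting γ M q z) {a c : ℝ} (h : IsClose γ H z g a)
    (hc : c ≤ (1 / (N : ℝ)) * ∑ k, (g k).im) :
    c - a ≤ (1 / (N : ℝ)) * ∑ k, (resolvent H z k k).im := by
  have hN := hs.N_pos'
  have h1 : ∀ k, (g k).im - a ≤ (resolvent H z k k).im := fun k => by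
    have h2 := h.diag (fun i => (hs.theta_pos i).le) k
    have h3 : ‖resolvent H z k k - g k‖ ≤ a := le_trans (by
      nlinarith [hs.one_le_theta k, norm_nonneg (resolvent H z k k - g k)]) h2
    have h4 := (abs_le.1 ((Complex.abs_im_le_norm _).trans h3)).1
    rw [Complex.sub_im] at h4
    linarith
  calc c - a ≤ (1 / (N : ℝ)) * ∑ k, (g k).im - a := by linarith
    _ = (1 / (N : ℝ)) * ∑ k, ((g k).im - a) := by
        rw [Finset.sum_sub_distrib]; simp; field_simp
    _ ≤ _ := by gcongr with k _; exact h1 k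

/-- Closeness to a diagonal matrix is stable under small changes of the spectral parameter. -/
lemma Setting.isClose_of_near (hs : Setting γ M q z) {z' : ℂ} (hH : H.IsSymm) {a : ℝ}
    (h : IsClose γ H z' g a) (hη : 1 ≤ N * z.im) (hη' : 1 ≤ N * z'.im)
    (hzz' : ‖z - z'‖ ≤ 1 / (N : ℝ) ^ 4) : IsClose γ H z g (a + r / N) := by
  intro i j
  have hN := hs.N_pos'
  have hz := hs.im_pos
  have hz' : 0 < z'.im := by
    by_contra hcon; nlinarith
  have h1 := norm_resolvent_sub_le hH hz hz' i j
  have h2 : ‖resolvent H z i j - resolvent H z' i j‖ ≤ 1 / (N : ℝ) ^ 2 := by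
    calc _ ≤ 1 / (N : ℝ) ^ 4 * (N * N) := by
          refine h1.trans ?_
          have e1 : 1 / z.im ≤ N := by rw [div_le_iff₀ hz]; exact hη
          have e2 : 1 / z'.im ≤ N := by rw [div_le_iff₀ hz']; exact hη'
          gcongr
      _ = _ := by field_simp
  have h3 : √(theta γ i * theta γ j) ≤ r * N := by
    have hN1 : (1 : ℝ) ≤ N := by exact_mod_cast hs.N_pos
    have hsq : √(N : ℝ) ≤ N := by rw [Real.sqrt_le_left hN.le]; nlinarith
    have hr := hs.one_le_r
    have e : ∀ i, theta γ i ≤ r * N := fun i => (hs.theta_le i).trans (by gcongr)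
    rw [Real.sqrt_le_left (by positivity), sq]
    exact mul_le_mul (e i) (e j) (hs.theta_pos j).le (by positivity)
  calc _ ≤ √(theta γ i * theta γ j) * (‖resolvent H z' i j - if i = j then g i else 0‖ +
        ‖resolvent H z i j - resolvent H z' i j‖) := by
        gcongr
        have := norm_add_le (resolvent H z' i j - if i = j then g i else 0)
          (resolvent H z i j - resolvent H z' i j)
        rwa [show (resolvent H z' i j - if i = j then g i else 0) +
          (resolvent H z i j - resolvent H z' i j) =
          resolvent H z i j - if i = j then g i else 0 by ring] at this
    -- Spacing `N ^ (-4)` against two factors `1 / η ≤ N` and weights up to `r * N` leaves `r / N`.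
    -- The reference `g` stays the one at the old point, so no regularity of the solution in `z` is
    -- needed.
    _ ≤ a + (r * N) * (1 / (N : ℝ) ^ 2) := by
        rw [mul_add]
        gcongr
        exact h i j
    _ = _ := by field_simp

/-- The points of a fine grid above `z` on the vertical line through `z`. -/
noncomputable def gridPoint (z : ℂ) (N m : ℕ) : ℂ :=
  ⟨z.re, z.im + m / (N : ℝ) ^ 4 * max (1 - z.im) 0⟩

set_option maxHeartbeats 2000000 in
/-- The local law on the intersection of the good events over a grid. -/
theorem local_law_of_grid (hr : 0 < r) {c Z : ℝ} (hM : 1 ≤ M) (hc : 0 < c) (hZ : 0 ≤ Z) :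
    ∃ ψ₀ K C N₀ : ℝ, 0 < ψ₀ ∧ 0 < K ∧ 1 ≤ C ∧ ∀ (N : ℕ) (γ : Fin r → Fin N → ℝ) (q : ℝ) (z : ℂ)
      (H : Matrix (Fin N) (Fin N) ℝ) (τ : ℝ), N₀ ≤ N → Setting γ M q z → |z.re| ≤ Z →
      z.im ≤ 10 → 1 ≤ N * z.im →
      (∀ w : ℂ, w.re = z.re → 0 < w.im → w.im ≤ 1 → c < (mLim γ w).im) → 1 ≤ τ →
      τ ^ 2 * controlPhi N q z ≤ ψ₀ →
      (∀ m ≤ N ^ 4, IsGood γ q H (gridPoint z N m) C τ) →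
      IsClose γ H z (gLim γ z) (K * (τ ^ 2 * controlPhi N q z)) := by
  obtain ⟨c₂, hc₂, himu⟩ := exists_le_im_of_one_le_im hr hM (by linarith : 0 ≤ Z + 10)
  have hr' : (1 : ℝ) ≤ r := by exact_mod_cast hr
  have hrM : 1 ≤ r * M := by nlinarith
  set c₁ : ℝ := 1 / (Z + 10 + 1 / c) with hc₁
  have hc₁0 : 0 < c₁ := by positivity
  set C₁ : ℝ := max 1 (1 / c) with hC₁
  set K' := C₁ + 1 + (C₁ + 1) ^ 2 / (c₁ / 4) with hK'
  -- One constant for both the macroscopic start and every bootstrap step, so that nothing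
  -- deteriorates along the `N ^ 4` steps.
  set C : ℝ := max (10 * r * M) ((K' + K' ^ 2 / (c₁ / 4)) * r * M) with hC
  have hC1 : 1 ≤ C := le_trans (by nlinarith) (le_max_left _ _)
  set c₃ : ℝ := 1 / (Z + 10 + C * M + 1) ^ 2 * (1 / (r * M)) with hc₃
  have hc₃0 : 0 < c₃ := by positivity
  set c' : ℝ := min (c / 2) (min c₂ c₃) with hc'
  have hc'0 : 0 < c' := by positivity
  have hc'c : c' ≤ c := (min_le_left _ _).trans (by linarith)
  have hc'2 : c' ≤ c₂ := (min_le_right _ _).trans (min_le_left _ _)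
  have hc'3 : c' ≤ c₃ := (min_le_right _ _).trans (min_le_right _ _)
  obtain ⟨ψ₁, K, hψ₁, hK, hmain⟩ := local_law_of_isGood hr hM hc'0 (by linarith : 0 ≤ Z + 10) hC1
  have hE := errConst_pos hM hC1 r
  -- Closeness `a` is what `isReg_of_isClose` needs, and also keeps half of the trace's imaginary
  -- part. The local law may use `a / 2`; the move to the next grid point, `r / N`, uses the other
  -- half.
  set a : ℝ := min (min (c₁ / 4) 1) (c / 2) with ha
  have ha0 : 0 < a := by positivity
  refine ⟨min (min ψ₁ (1 / errConst r M C)) (a / 2 / K), K, C, r / (a / 2), by positivity, hK, hC1,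
    ?_⟩
  intro N γ q z H τ hN₀ hs hre him10 hη hbulk hτ hψ hgood
  have hN := hs.N_pos'
  have hψ1 : τ ^ 2 * controlPhi N q z ≤ ψ₁ :=
    hψ.trans ((min_le_left _ _).trans (min_le_left _ _))
  have hψ2 : τ ^ 2 * controlPhi N q z ≤ 1 / errConst r M C :=
    hψ.trans ((min_le_left _ _).trans (min_le_right _ _))
  have hψ3 : τ ^ 2 * controlPhi N q z ≤ a / 2 / K := hψ.trans (min_le_right _ _)
  have hz := hs.im_pos
  have hτ2 : 0 ≤ τ ^ 2 := sq_nonneg τ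
  have hphi : ∀ w : ℂ, z.im ≤ w.im → τ ^ 2 * controlPhi N q w ≤ τ ^ 2 * controlPhi N q z := by
    intro w hw
    unfold controlPhi
    gcongr
  have hset : ∀ w : ℂ, z.im ≤ w.im → Setting γ M q w := fun w hw =>
    ⟨hs.r_pos, hs.N_pos, hs.adm, hs.one_le_q, hs.q_sq_le, hz.trans_le hw⟩
  have hnorm : ∀ w : ℂ, w.re = z.re → z.im ≤ w.im → w.im ≤ 10 → ‖w‖ ≤ Z + 10 := by
    intro w h1 h2 h3
    refine (Complex.norm_le_abs_re_add_abs_im w).trans (add_le_add (h1 ▸ hre) ?_)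
    rw [abs_of_pos (hz.trans_le h2)]; exact h3
  have hsol : ∀ w : ℂ, z.im ≤ w.im → IsSolution γ w (solution γ w) := fun w hw =>
    solution_isSolution hs.r_pos hs.N_pos hs.adm.pos (hz.trans_le hw)
  have hfinish : ∀ w : ℂ, w.re = z.re → z.im ≤ w.im → w.im ≤ 10 → IsGood γ q H w C τ →
      IsReg γ H w C → c' ≤ (1 / (N : ℝ)) * ∑ k, (resolvent H w k k).im →
      IsClose γ H w (gLim γ w) (K * (τ ^ 2 * controlPhi N q z)) := by
    intro w h1 h2 h3 hg hreg htr
    have hu := hsol w h2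
    have hcu : ∀ k, c' ≤ (solution γ w k).im := fun k => by
      rcases le_total w.im 1 with h4 | h4
      · exact hc'c.trans ((hbulk w h1 (hz.trans_le h2) h4).le.trans
          (hs.adm.mLim_im_le (hz.trans_le h2) hu k))
      · exact hc'2.trans (himu N γ q w _ hs.N_pos hs.adm h4 (hnorm w h1 h2 h3) hu k)
    have hΦ := hphi w h2
    obtain ⟨hd, ho⟩ := hmain N γ q w (solution γ w) H τ (hset w h2) (hnorm w h1 h2 h3)
      hu.dysonMap_eq hcu hg hreg htr hτ (hΦ.trans hψ1)
    intro i j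
    by_cases hij : i = j
    · subst hij
      rw [if_pos rfl, Real.sqrt_mul_self (hs.theta_pos i).le]
      exact (hd i).trans (by gcongr)
    · rw [if_neg hij, sub_zero]
      exact (ho i j hij).trans (by gcongr)
  have hinit : ∀ w : ℂ, w.re = z.re → z.im ≤ w.im → 1 ≤ w.im → w.im ≤ 10 → IsGood γ q H w C τ →
      IsClose γ H w (gLim γ w) (K * (τ ^ 2 * controlPhi N q z)) := by
    intro w h1 h2 h4 h3 hg
    have hreg : IsReg γ H w C :=
      ((hset w h2).isReg_of_one_le hg.symm h4 h3).mono (by linarith) (by nlinarith)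
        (le_max_left _ _)
    refine hfinish w h1 h2 h3 hg hreg (hc'3.trans ?_)
    refine (hset w h2).le_trace_im_of_one_le hg hreg hC1 hτ (hnorm w h1 h2 h3) h4 ?_
    rw [mul_assoc, ← le_div_iff₀' hE]
    exact (hphi w h2).trans hψ2
  have hg0 : gridPoint z N 0 = z := by
    apply Complex.ext <;> simp [gridPoint]
  -- For `Im z ≥ 1` the grid collapses to the point `z` and the macroscopic bounds apply directly.
  rcases le_or_gt 1 z.im with h1 | h1
  · have hg := hgood 0 (Nat.zero_le _)
    rw [hg0] at hg
    exact hinit z rfl le_rfl h1 him10 hg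
  have hmax : max (1 - z.im) 0 = 1 - z.im := max_eq_left (by linarith)
  have hN4 : (0 : ℝ) < (N : ℝ) ^ 4 := by positivity
  have hgim : ∀ m : ℕ, (gridPoint z N m).im = z.im + m / (N : ℝ) ^ 4 * (1 - z.im) := fun m => by
    simp [gridPoint, hmax]
  have hgre : ∀ m : ℕ, (gridPoint z N m).re = z.re := fun m => rfl
  have hgle : ∀ m : ℕ, z.im ≤ (gridPoint z N m).im := fun m => by
    rw [hgim]
    have : 0 ≤ m / (N : ℝ) ^ 4 * (1 - z.im) := mul_nonneg (by positivity) (by linarith)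
    linarith
  have hgle1 : ∀ m : ℕ, m ≤ N ^ 4 → (gridPoint z N m).im ≤ 1 := fun m hm => by
    rw [hgim]
    have : (m : ℝ) / (N : ℝ) ^ 4 ≤ 1 := by
      rw [div_le_one hN4]; exact_mod_cast hm
    nlinarith
  -- Induction downwards from the top point, which has imaginary part `1`, to index `0`, which is
  -- `z`.
  have hall : ∀ k ≤ N ^ 4, IsClose γ H (gridPoint z N (N ^ 4 - k)) (gLim γ (gridPoint z N (N ^ 4 - k)))
      (K * (τ ^ 2 * controlPhi N q z)) := by
    intro k
    induction k with
    | zero =>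
      intro _
      rw [Nat.sub_zero]
      refine hinit _ (hgre _) (hgle _) ?_ ((hgle1 _ le_rfl).trans (by norm_num))
        (hgood _ le_rfl)
      rw [hgim]; push_cast
      rw [div_self hN4.ne']; linarith
    | succ k ih =>
      intro hk
      have ih' := ih (by omega)
      obtain ⟨m, hm⟩ : ∃ m, m = N ^ 4 - (k + 1) := ⟨_, rfl⟩
      have hm1 : N ^ 4 - k = m + 1 := by omega
      rw [← hm]; rw [hm1] at ih'
      have hmle : m ≤ N ^ 4 := by omega
      have hmle' : m + 1 ≤ N ^ 4 := by omega
      set w := gridPoint z N m with hw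
      set w' := gridPoint z N (m + 1) with hw'
      have hww' : ‖w - w'‖ ≤ 1 / (N : ℝ) ^ 4 := by
        refine (Complex.norm_le_abs_re_add_abs_im _).trans ?_
        rw [Complex.sub_re, Complex.sub_im, hgim, hgim, hgre, hgre, sub_self, abs_zero, zero_add]
        push_cast
        rw [show z.im + (m : ℝ) / (N : ℝ) ^ 4 * (1 - z.im) -
          (z.im + ((m : ℝ) + 1) / (N : ℝ) ^ 4 * (1 - z.im)) =
          -(1 / (N : ℝ) ^ 4 * (1 - z.im)) by ring, abs_neg, abs_of_nonneg
            (mul_nonneg (by positivity) (by linarith))]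
        have : 0 < 1 / (N : ℝ) ^ 4 := by positivity
        nlinarith
      have hηw : ∀ m : ℕ, 1 ≤ N * (gridPoint z N m).im := fun m => hη.trans (by
        gcongr; exact hgle m)
      have hg := hgood m hmle
      have hclose := (hset w (hgle m)).isClose_of_near hg.symm ih' (hηw m) (hηw (m + 1)) hww'
      have hsmall : K * (τ ^ 2 * controlPhi N q z) + r / N ≤ a := by
        have e1 : K * (τ ^ 2 * controlPhi N q z) ≤ a / 2 := by
          rwa [le_div_iff₀' hK] at hψ3
        have e2 : r / N ≤ a / 2 := by
          rw [div_le_iff₀ hN]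
          rwa [div_le_iff₀' (by positivity)] at hN₀
        linarith
      have hu := hsol w' (hgle _)
      have hcu : ∀ k, c ≤ (solution γ w' k).im := fun k =>
        (hbulk w' (hgre _) (hz.trans_le (hgle _)) (hgle1 _ hmle')).le.trans
          (hs.adm.mLim_im_le (hz.trans_le (hgle _)) hu k)
      have hzw' : 0 < w'.im := hz.trans_le (hgle _)
      have hup : ∀ i, theta γ i * ‖gLim γ w' i‖ ≤ 1 / c := fun i => by
        have h2 := hs.adm.norm_inv_den_le hr hzw'.le hc hcu i
        have := hs.theta_pos i
        calc _ ≤ theta γ i * (1 / (theta γ i * c)) := by gcongr; exact h2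
          _ = _ := by field_simp
      have hun : ∀ k, ‖solution γ w' k‖ ≤ 1 / c := fun k => by
        have := hs.adm.norm_avg_le_of_le hs.N_pos hup k
        rwa [show avg γ (gLim γ w') k = solution γ w' k from congrFun hu.dysonMap_eq k] at this
      -- The entries of `g` are comparable to `1 / θ i` from both sides in the bulk, because the
      -- denominators are at most `θ i * (Z + 10 + 1 / c)`.
      have hlow : ∀ i, c₁ ≤ theta γ i * ‖gLim γ w' i‖ := fun i => by
        have h2 := hs.adm.norm_den_le hr (hnorm w' (hgre _) (hgle _)
          ((hgle1 _ hmle').trans (by norm_num))) hun i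
        have h3 : ‖gLim γ w' i‖ = 1 / ‖den γ w' (solution γ w') i‖ := by
          rw [gLim, ← den, norm_div]; simp
        have h4 : 0 < ‖den γ w' (solution γ w') i‖ := norm_pos_iff.2 (ne_zero_of_im_pos
          (den_im_pos hs.adm.nonneg hzw' (fun k => (hu.1 k).le) i))
        rw [h3, mul_one_div, hc₁, div_le_div_iff₀ (by positivity) h4, one_mul]
        exact h2
      obtain ⟨K'', hK'', hreg⟩ := (hset w (hgle m)).isReg_of_isClose hg.symm (hηw m) hc₁0
        (le_max_left 1 (1 / c)) hlow (fun i => (hup i).trans (le_max_right _ _))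
        (hsmall.trans ((min_le_left _ _).trans (min_le_left _ _)))
        (hsmall.trans ((min_le_left _ _).trans (min_le_right _ _))) hclose
      have hreg' : IsReg γ H w C := by
        refine hreg.mono (hz.trans_le (hgle _)) ?_ ?_
        · rw [hK'']; positivity
        · rw [hK'']; exact le_max_right _ _
      refine hfinish w (hgre _) (hgle _) ((hgle1 _ hmle).trans (by norm_num)) hg hreg' ?_
      have htr : c ≤ (1 / (N : ℝ)) * ∑ k, (gLim γ w' k).im := by
        have h5 := hbulk w' (hgre _) hzw' (hgle1 _ hmle')
        have h6 : (mLim γ w').im = (1 / (N : ℝ)) * ∑ k, (gLim γ w' k).im := by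
          have : (1 / (N : ℂ)) = ((1 / (N : ℝ) : ℝ) : ℂ) := by push_cast; rfl
          rw [mLim_eq, this, Complex.im_ofReal_mul, Complex.im_sum]
          rfl
        rw [← h6]; exact h5.le
      have h7 := (hset w (hgle m)).le_trace_im_of_isClose hclose htr
      have h8 : a ≤ c / 2 := min_le_right _ _
      have h9 : c' ≤ c / 2 := min_le_left _ _
      linarith
  have := hall (N ^ 4) le_rfl
  rwa [Nat.sub_self, hg0] at this

end Bootstrap

end ChungLu

/-! ### Measurability, independence of rows and minors, probability of the good event -/

namespace ChungLu

section Measurability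

variable {N : ℕ} {α : Type*} [MeasurableSpace α]

/-- By Cramer's rule the entries are ratios of polynomials in the matrix entries. -/
lemma measurable_resolvent {A : α → Matrix (Fin N) (Fin N) ℝ}
    (hA : ∀ k l, Measurable fun x => A x k l) (z : ℂ) (k l : Fin N) :
    Measurable fun x => resolvent (A x) z k l := by
  let B : (Fin N → Fin N → ℝ) → Matrix (Fin N) (Fin N) ℂ := fun x =>
    Matrix.of (fun i j => (x i j : ℂ)) - z • (1 : Matrix (Fin N) (Fin N) ℂ)
  have hB : Continuous B := by
    refine Continuous.sub (continuous_matrix fun i j => ?_) continuous_const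
    simp only [Matrix.of_apply]
    fun_prop
  have hdet : Measurable fun x => (B x).det := hB.matrix_det.measurable
  have hadj : Measurable fun x => (B x).adjugate k l :=
    (hB.matrix_adjugate.matrix_elem k l).measurable
  have hmain : Measurable fun x => (B x)⁻¹ k l := by
    simp only [Matrix.inv_def, Ring.inverse_eq_inv', Matrix.smul_apply, smul_eq_mul]
    exact hdet.inv.mul hadj
  exact hmain.comp (measurable_pi_iff.2 fun i => measurable_pi_iff.2 fun j => hA i j)

lemma measurable_minorG {A : α → Matrix (Fin N) (Fin N) ℝ} (T : Finset (Fin N))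
    (hA : ∀ k l, Measurable fun x => zeroOut T (A x) k l) (z : ℂ) (k l : Fin N) :
    Measurable fun x => minorG (A x) T z k l := by
  unfold minorG
  split_ifs
  · exact measurable_const
  · exact measurable_resolvent hA z k l

end Measurability

section Adjacency

variable {Ω : Type*} [MeasurableSpace Ω] {P : Measure Ω} {r N : ℕ}
  {M q : ℝ} {γ : Fin r → Fin N → ℝ} {h : Fin N → Fin N → Ω → ℝ}

/-- The unordered pair `{k, l}`, as an index on or above the diagonal. -/
def edge (k l : Fin N) : {e : Fin N × Fin N // e.1 ≤ e.2} := ⟨(min k l, max k l), min_le_max⟩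

lemma edge_injective (i : Fin N) : Function.Injective (edge i) := by
  intro k l hkl
  simp only [edge, Subtype.mk.injEq, Prod.mk.injEq] at hkl
  obtain ⟨h1, h2⟩ := hkl
  rcases le_total i k with h3 | h3 <;> rcases le_total i l with h4 | h4 <;>
    simp [h3, h4] at h1 h2 <;> order

lemma edge_mem {T : Finset (Fin N)} {i : Fin N} (hi : i ∈ T) (k : Fin N) :
    (edge i k).1.1 ∈ T ∨ (edge i k).1.2 ∈ T := by
  rcases le_total i k with h3 | h3 <;> simp [edge, h3, hi]

namespace IsCenteredAdjacency

lemma edge_apply (hh : IsCenteredAdjacency P q γ h) (k l : Fin N) (ω : Ω) :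
    h (edge k l).1.1 (edge k l).1.2 ω = h k l ω := by
  rcases le_total k l with h1 | h1
  · simp [edge, h1]
  · simp only [edge, min_eq_right h1, max_eq_left h1]
    exact hh.symm l k ω

lemma measurable_minorG (hh : IsCenteredAdjacency P q γ h) (T : Finset (Fin N)) (z : ℂ)
    (k l : Fin N) : Measurable fun ω => minorG (Matrix.of fun i j => h i j ω) T z k l := by
  refine ChungLu.measurable_minorG T (fun k l => ?_) z k l
  simp only [zeroOut, Matrix.of_apply]
  split_ifs
  · exact measurable_const
  · exact hh.measurable _ _

variable [IsProbabilityMeasure P]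

/-- The two prescribed atoms are distinct and their masses add up to one, so the two point
probabilities determine the whole law. -/
lemma ae_eq_or (hh : IsCenteredAdjacency P q γ h) (ha : IsAdmissible M q γ) (hq : 0 < q)
    (i j : Fin N) : ∀ᵐ ω ∂P, h i j ω = (1 - q * profile γ i j) / √q ∨
      h i j ω = -(q * profile γ i j) / √q := by
  have hs := Real.sqrt_pos.2 hq
  have hm := hh.measurable i j
  have hp := ha.prob_le_one i j
  have hp0 : 0 ≤ q * profile γ i j := mul_nonneg hq.le (ha.profile_nonneg i j)
  have hdisj : Disjoint {ω | h i j ω = (1 - q * profile γ i j) / √q}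
      {ω | h i j ω = -(q * profile γ i j) / √q} := by
    rw [Set.disjoint_left]
    intro ω h1 h2
    rw [Set.mem_ofPred_eq] at h1 h2
    rw [h1, div_left_inj' hs.ne'] at h2
    linarith
  have hB : MeasurableSet {ω | h i j ω = -(q * profile γ i j) / √q} :=
    hm (measurableSet_singleton _)
  have hA : MeasurableSet {ω | h i j ω = (1 - q * profile γ i j) / √q} :=
    hm (measurableSet_singleton _)
  have h1 : P ({ω | h i j ω = (1 - q * profile γ i j) / √q} ∪
      {ω | h i j ω = -(q * profile γ i j) / √q}) = 1 := by
    rw [measure_union hdisj hB, hh.prob_edge, hh.prob_no_edge,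
      ← ENNReal.ofReal_add hp0 (by linarith)]
    simp
  exact (prob_compl_eq_zero_iff (hA.union hB)).2 h1

lemma integral_comp (hh : IsCenteredAdjacency P q γ h) (ha : IsAdmissible M q γ) (hq : 0 < q)
    (i j : Fin N) (f : ℝ → ℝ) :
    ∫ ω, f (h i j ω) ∂P = q * profile γ i j * f ((1 - q * profile γ i j) / √q) +
      (1 - q * profile γ i j) * f (-(q * profile γ i j) / √q) := by
  have hs := Real.sqrt_pos.2 hq
  have hm := hh.measurable i j
  have hp := ha.prob_le_one i j
  have hp0 : 0 ≤ q * profile γ i j := mul_nonneg hq.le (ha.profile_nonneg i j)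
  have hB : MeasurableSet {ω | h i j ω = -(q * profile γ i j) / √q} :=
    hm (measurableSet_singleton _)
  have hA : MeasurableSet {ω | h i j ω = (1 - q * profile γ i j) / √q} :=
    hm (measurableSet_singleton _)
  have hne : (1 - q * profile γ i j) / √q ≠ -(q * profile γ i j) / √q := by
    intro h2
    rw [div_left_inj' hs.ne'] at h2
    linarith
  have key : (fun ω => f (h i j ω)) =ᵐ[P] fun ω =>
      Set.indicator {ω | h i j ω = (1 - q * profile γ i j) / √q}
        (fun _ => f ((1 - q * profile γ i j) / √q)) ω +
      Set.indicator {ω | h i j ω = -(q * profile γ i j) / √q}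
        (fun _ => f (-(q * profile γ i j) / √q)) ω := by
    filter_upwards [hh.ae_eq_or ha hq i j] with ω hω
    rcases hω with hω | hω
    · simp [Set.indicator, hω, hne]
    · simp [Set.indicator, hω, hne.symm]
  rw [integral_congr_ae key, integral_add ((integrable_const _).indicator hA)
    ((integrable_const _).indicator hB), integral_indicator_const _ hA,
    integral_indicator_const _ hB, measureReal_def, measureReal_def, hh.prob_edge,
    hh.prob_no_edge, ENNReal.toReal_ofReal hp0, ENNReal.toReal_ofReal (by linarith)]
  simp

lemma integral_eq_zero (hh : IsCenteredAdjacency P q γ h) (ha : IsAdmissible M q γ) (hq : 0 < q)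
    (i j : Fin N) : ∫ ω, h i j ω ∂P = 0 := by
  rw [hh.integral_comp ha hq i j (fun x => x)]
  ring

lemma integral_sq (hh : IsCenteredAdjacency P q γ h) (ha : IsAdmissible M q γ) (hq : 0 < q)
    (i j : Fin N) :
    ∫ ω, h i j ω ^ 2 ∂P = profile γ i j * (1 - q * profile γ i j) := by
  rw [hh.integral_comp ha hq i j (fun x => x ^ 2), div_pow, div_pow, Real.sq_sqrt hq.le]
  field_simp
  ring

lemma ae_abs_le (hh : IsCenteredAdjacency P q γ h) (ha : IsAdmissible M q γ) (hq : 0 < q)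
    (i j : Fin N) : ∀ᵐ ω ∂P, |h i j ω| ≤ 1 / √q := by
  have hs := Real.sqrt_pos.2 hq
  have hp := ha.prob_le_one i j
  have hp0 : 0 ≤ q * profile γ i j := mul_nonneg hq.le (ha.profile_nonneg i j)
  filter_upwards [hh.ae_eq_or ha hq i j] with ω hω
  rcases hω with hω | hω <;> rw [hω, abs_div, abs_of_pos hs] <;> gcongr <;> rw [abs_le] <;>
    constructor <;> linarith

/-- The entries on and above the diagonal, as a family of independent noise variables. -/
lemma isNoise (hh : IsCenteredAdjacency P q γ h) (ha : IsAdmissible M q γ) (hq : 0 < q) :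
    IsNoise P (fun (e : {e : Fin N × Fin N // e.1 ≤ e.2}) => h e.1.1 e.1.2) (1 / √q)
      (fun e => profile γ e.1.1 e.1.2) where
  measurable e := hh.measurable _ _
  indep := hh.indep
  bdd e := hh.ae_abs_le ha hq _ _
  mean e := hh.integral_eq_zero ha hq _ _
  var e := by
    rw [hh.integral_sq ha hq]
    have := ha.profile_nonneg e.1.1 e.1.2
    nlinarith [mul_nonneg hq.le (mul_nonneg this this)]

/-- Only the upper triangle is assumed independent; a full row is an injective reindexing of it by
`edge i`. -/
lemma isNoise_row (hh : IsCenteredAdjacency P q γ h) (ha : IsAdmissible M q γ) (hq : 0 < q)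
    (i : Fin N) : IsNoise P (fun k => h i k) (1 / √q) (profile γ i) where
  measurable k := hh.measurable _ _
  indep := by
    have h1 := hh.indep.precomp (edge_injective i)
    convert h1 using 1
    funext k ω
    exact (hh.edge_apply i k ω).symm
  bdd k := hh.ae_abs_le ha hq _ _
  mean k := hh.integral_eq_zero ha hq _ _
  var k := by
    rw [hh.integral_sq ha hq]
    have := ha.profile_nonneg i k
    nlinarith [mul_nonneg hq.le (mul_nonneg this this)]

/-- Functions of the rows in `T` are independent of functions of the minor obtained by removing
the rows and columns in `T`. -/
lemma indepFun_rows_minorG (hh : IsCenteredAdjacency P q γ h) (ha : IsAdmissible M q γ)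
    (hq : 0 < q) (T : Finset (Fin N)) (z : ℂ) {β : Type*} [MeasurableSpace β] {Y : Ω → β}
    {φ : ({e : Fin N × Fin N // e.1 ≤ e.2} → ℝ) → β} (hφ : Measurable φ)
    (hY : ∀ ω, Y ω = φ fun e => if e.1.1 ∈ T ∨ e.1.2 ∈ T then h e.1.1 e.1.2 ω else 0) :
    IndepFun Y (fun ω k l => minorG (Matrix.of fun i j => h i j ω) T z k l) P := by
  classical
  have h1 := (hh.isNoise ha hq).indepFun_indicator (fun e => e.1.1 ∈ T ∨ e.1.2 ∈ T)
    (fun e => ¬ (e.1.1 ∈ T ∨ e.1.2 ∈ T)) fun k h h' => h' h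
  let ψ : ({e : Fin N × Fin N // e.1 ≤ e.2} → ℝ) → Fin N → Fin N → ℂ := fun x k l =>
    minorG (Matrix.of fun i j => x (edge i j)) T z k l
  have hψ : Measurable ψ := by
    refine measurable_pi_iff.2 fun k => measurable_pi_iff.2 fun l => ?_
    refine ChungLu.measurable_minorG T (fun k l => ?_) z k l
    simp only [zeroOut, Matrix.of_apply]
    split_ifs
    · exact measurable_const
    · exact measurable_pi_apply _
  have h2 := h1.comp hφ hψ
  convert h2 using 1
  · funext ω
    exact hY ω
  · funext ω k l
    simp only [Function.comp_apply, ψ]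
    -- The minor sees only edges avoiding `T`, so it is unchanged when the others are replaced by
    -- zero.
    have e : zeroOut T (Matrix.of fun i j => h i j ω) = zeroOut T (Matrix.of fun i j =>
        (if ¬ ((edge i j).1.1 ∈ T ∨ (edge i j).1.2 ∈ T) then
          h (edge i j).1.1 (edge i j).1.2 ω else 0)) := by
      ext i j
      simp only [zeroOut, Matrix.of_apply, hh.edge_apply]
      by_cases hij : i ∈ T ∨ j ∈ T
      · simp [hij]
      · have : ¬ ((edge i j).1.1 ∈ T ∨ (edge i j).1.2 ∈ T) := by
          push Not at hij
          rcases le_total i j with h3 | h3 <;> simp [edge, h3, hij]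
        simp [hij, this]
    simp only [minorG]
    rw [e]

lemma indepFun_row_minorG (hh : IsCenteredAdjacency P q γ h) (ha : IsAdmissible M q γ)
    (hq : 0 < q) {T : Finset (Fin N)} {i : Fin N} (hi : i ∈ T) (z : ℂ) :
    IndepFun (fun ω k => h i k ω)
      (fun ω k l => minorG (Matrix.of fun i j => h i j ω) T z k l) P := by
  refine hh.indepFun_rows_minorG ha hq T z (φ := fun x k => x (edge i k)) (by fun_prop) ?_
  intro ω
  funext k
  dsimp only
  rw [if_pos (edge_mem hi k), hh.edge_apply]

lemma prob_linear_le (hh : IsCenteredAdjacency P q γ h) (ha : IsAdmissible M q γ)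
    (hq : 0 < q) (z : ℂ) {C t : ℝ} (hC : 0 < C) (i k : Fin N) :
    P.real {ω | (∀ l, ‖minorG (Matrix.of fun i j => h i j ω) {i} z k l‖ ≤ C) ∧
      2 * t * (√(∑ l, profile γ i l *
        ‖minorG (Matrix.of fun i j => h i j ω) {i} z k l‖ ^ 2) + C * (1 / √q)) ≤
      ‖∑ l, minorG (Matrix.of fun i j => h i j ω) {i} z k l * (h i l ω : ℂ)‖} ≤
      4 * Real.exp (1 - t) := by
  have h1 := hh.indepFun_row_minorG ha hq (Finset.mem_singleton_self i) z
  have h2 := h1.comp measurable_id (measurable_pi_apply k)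
  exact (hh.isNoise_row ha hq i).linear_random (one_div_pos.2 (Real.sqrt_pos.2 hq)) hC
    (fun l => hh.measurable_minorG {i} z k l) h2

lemma prob_quadratic_le (hh : IsCenteredAdjacency P q γ h) (ha : IsAdmissible M q γ)
    (hq : 0 < q) (z : ℂ) {C t : ℝ} (hC : 0 < C) (ht : 1 ≤ t) {L : ℕ} (hL : N ≤ 2 ^ L)
    (i j : Fin N) :
    P.real {ω | (∀ k l, ‖minorG (Matrix.of fun i j => h i j ω) {i, j} z k l‖ ≤ C) ∧
      (12 * L + 2) * t ^ 2 * (√(∑ k, ∑ l, profile γ j k * profile γ j l *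
        ‖minorG (Matrix.of fun i j => h i j ω) {i, j} z k l‖ ^ 2) +
        2 * (C * (1 / √q) * √(∑ k, profile γ j k)) + C * (1 / √q) ^ 2) ≤
      ‖∑ k, ∑ l, minorG (Matrix.of fun i j => h i j ω) {i, j} z k l *
        (h j k ω * h j l ω : ℂ) - ∑ k, ((profile γ j k * (1 - q * profile γ j k) : ℝ) : ℂ) *
          minorG (Matrix.of fun i j => h i j ω) {i, j} z k k‖} ≤
      (8 * L * (N + 1) + 4) * Real.exp (1 - t) := by
  have h1 := hh.indepFun_row_minorG ha hq (show j ∈ ({i, j} : Finset (Fin N)) by simp) z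
  have h2 := (hh.isNoise_row ha hq j).quadratic_random hL
    (one_div_pos.2 (Real.sqrt_pos.2 hq)) hC ht
    (fun k l => hh.measurable_minorG {i, j} z k l) h1
  simp only [hh.integral_sq ha hq] at h2
  exact h2

/-- Rows `i` and `j` share the entry `h i j` and are not independent. The minor vanishes on the
indices `i` and `j`, so those entries may be set to zero in both rows, after which the rows depend
on disjoint sets of edges. -/
lemma prob_bilinear_le (hh : IsCenteredAdjacency P q γ h) (ha : IsAdmissible M q γ)
    (hq : 0 < q) (z : ℂ) {C t : ℝ} (hC : 0 < C) (ht : 0 < t) {i j : Fin N} (hij : i ≠ j) :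
    P.real {ω | (∀ k l, ‖minorG (Matrix.of fun i j => h i j ω) {i, j} z k l‖ ≤ C) ∧
      6 * t ^ 2 * (√(∑ k, ∑ l, profile γ i k * profile γ j l *
        ‖minorG (Matrix.of fun i j => h i j ω) {i, j} z k l‖ ^ 2) +
        C * (1 / √q) * √(∑ k, profile γ i k) + C * (1 / √q) * √(∑ k, profile γ j k) +
        C * (1 / √q) ^ 2) ≤
      ‖∑ k, ∑ l, minorG (Matrix.of fun i j => h i j ω) {i, j} z k l *
        (h i k ω * h j l ω : ℂ)‖} ≤
      (N + 1) * (4 * Real.exp (1 - t)) := by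
  classical
  have hR : 0 < 1 / √q := one_div_pos.2 (Real.sqrt_pos.2 hq)
  set T : Finset (Fin N) := {i, j} with hT
  have hX := (hh.isNoise_row ha hq i).indicator hR.le (fun k => k ∉ T)
  have hY := (hh.isNoise_row ha hq j).indicator hR.le (fun k => k ∉ T)
  have hiT : i ∈ T := by simp [hT]
  have hjT : j ∈ T := by simp [hT]
  have hmem : ∀ a k : Fin N, (edge a k).1.1 = a ∨ (edge a k).1.2 = a := fun a k => by
    rcases le_total a k with h3 | h3 <;> simp [edge, h3]
  have hmem' : ∀ a k b : Fin N, (edge a k).1.1 = b ∨ (edge a k).1.2 = b → b = a ∨ b = k := by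
    intro a k b hb
    rcases le_total a k with h3 | h3 <;> simp [edge, h3] at hb <;> tauto
  have hind : IndepFun (fun ω k => if k ∉ T then h i k ω else 0)
      (fun ω k => if k ∉ T then h j k ω else 0) P := by
    have h1 := (hh.isNoise ha hq).indepFun_indicator
      (fun e => (e.1.1 = i ∨ e.1.2 = i) ∧ ¬ (e.1.1 = j ∨ e.1.2 = j))
      (fun e => (e.1.1 = j ∨ e.1.2 = j)) fun k h h' => h.2 h'
    have hφ : ∀ a : Fin N, Measurable fun (x : {e : Fin N × Fin N // e.1 ≤ e.2} → ℝ) k =>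
        if k ∉ T then x (edge a k) else 0 := fun a => by
      refine measurable_pi_iff.2 fun k => ?_
      split_ifs
      · exact measurable_const
      · exact measurable_pi_apply _
    have h2 := h1.comp (hφ i) (hφ j)
    convert h2 using 1
    · funext ω k
      simp only [Function.comp_apply, hh.edge_apply]
      by_cases hk : k ∈ T
      · simp [hk]
      · rw [if_pos hk, if_pos hk, if_pos]
        refine ⟨hmem i k, fun hb => ?_⟩
        rcases hmem' i k j hb with rfl | rfl
        · exact hij rfl
        · exact hk hjT
    · funext ω k
      simp only [Function.comp_apply, hh.edge_apply]
      rw [if_pos (hmem j k)]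
  have hindB : IndepFun (fun ω => (fun k => if k ∉ T then h i k ω else 0,
      fun k => if k ∉ T then h j k ω else 0))
      (fun ω k l => minorG (Matrix.of fun i j => h i j ω) T z k l) P := by
    refine hh.indepFun_rows_minorG ha hq T z
      (φ := fun x => (fun k => if k ∉ T then x (edge i k) else 0,
        fun k => if k ∉ T then x (edge j k) else 0)) ?_ ?_
    · refine Measurable.prodMk ?_ ?_ <;> refine measurable_pi_iff.2 fun k => ?_ <;> split_ifs
      · exact measurable_const
      · exact measurable_pi_apply _
      · exact measurable_const
      · exact measurable_pi_apply _
    · intro ω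
      refine Prod.ext ?_ ?_ <;> funext k <;> by_cases hk : k ∈ T
      · simp [hk]
      · simp only [hk, not_false_eq_true, if_true]
        rw [if_pos (edge_mem hiT k), hh.edge_apply]
      · simp [hk]
      · simp only [hk, not_false_eq_true, if_true]
        rw [if_pos (edge_mem hjT k), hh.edge_apply]
  have hmain := hX.bilinear_random hY hR hC ht hind
    (fun k l => hh.measurable_minorG T z k l) hindB
  rw [Fintype.card_fin] at hmain
  convert hmain using 6 with ω
  refine congrArg norm (Finset.sum_congr rfl fun k _ => Finset.sum_congr rfl fun l _ => ?_)
  by_cases hk : k ∈ T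
  · simp [minorG, hk]
  by_cases hl : l ∈ T
  · simp [minorG, hl]
  simp [hk, hl]

/-- The good event holds with high probability. -/
theorem prob_not_isGood_le (hh : IsCenteredAdjacency P q γ h) (ha : IsAdmissible M q γ)
    (hq : 0 < q) (z : ℂ) {C t : ℝ} (hC : 0 < C) (ht : 1 ≤ t) {L : ℕ} (hL : N ≤ 2 ^ L)
    (hL1 : 1 ≤ L) :
    P.real {ω | ¬ IsGood γ q (Matrix.of fun i j => h i j ω) z C ((12 * L + 2) * t ^ 2)} ≤
      20 * L * (N + 1) ^ 3 * Real.exp (1 - t) := by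
  classical
  set H : Ω → Matrix (Fin N) (Fin N) ℝ := fun ω => Matrix.of fun i j => h i j ω with hH
  have hL1' : (1 : ℝ) ≤ L := by exact_mod_cast hL1
  have ht2 : t ≤ t ^ 2 := by nlinarith
  have hR : 0 < 1 / √q := one_div_pos.2 (Real.sqrt_pos.2 hq)
  set E1 : Fin N × Fin N → Set Ω := fun e => {ω | (∀ l, ‖minorG (H ω) {e.1} z e.2 l‖ ≤ C) ∧
      2 * t * (√(∑ l, profile γ e.1 l * ‖minorG (H ω) {e.1} z e.2 l‖ ^ 2) + C * (1 / √q)) ≤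
      ‖∑ l, minorG (H ω) {e.1} z e.2 l * (h e.1 l ω : ℂ)‖} with hE1
  set E2 : Fin N × Fin N → Set Ω := fun e =>
    {ω | (∀ k l, ‖minorG (H ω) {e.1, e.2} z k l‖ ≤ C) ∧
      (12 * L + 2) * t ^ 2 * (√(∑ k, ∑ l, profile γ e.2 k * profile γ e.2 l *
        ‖minorG (H ω) {e.1, e.2} z k l‖ ^ 2) +
        2 * (C * (1 / √q) * √(∑ k, profile γ e.2 k)) + C * (1 / √q) ^ 2) ≤
      ‖∑ k, ∑ l, minorG (H ω) {e.1, e.2} z k l *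
        (h e.2 k ω * h e.2 l ω : ℂ) - ∑ k, ((profile γ e.2 k * (1 - q * profile γ e.2 k) : ℝ) : ℂ) *
          minorG (H ω) {e.1, e.2} z k k‖} with hE2
  set E3 : Fin N × Fin N → Set Ω := fun e =>
    {ω | e.1 ≠ e.2 ∧ (∀ k l, ‖minorG (H ω) {e.1, e.2} z k l‖ ≤ C) ∧
      6 * t ^ 2 * (√(∑ k, ∑ l, profile γ e.1 k * profile γ e.2 l *
        ‖minorG (H ω) {e.1, e.2} z k l‖ ^ 2) +
        C * (1 / √q) * √(∑ k, profile γ e.1 k) + C * (1 / √q) * √(∑ k, profile γ e.2 k) +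
        C * (1 / √q) ^ 2) ≤
      ‖∑ k, ∑ l, minorG (H ω) {e.1, e.2} z k l *
        (h e.1 k ω * h e.2 l ω : ℂ)‖} with hE3
  have h3 : ∀ e, P.real (E3 e) ≤ (N + 1) * (4 * Real.exp (1 - t)) := fun e => by
    by_cases he : e.1 = e.2
    · simp only [hE3, he, ne_eq, not_true_eq_false, false_and]
      simp only [Set.ofPred_false, measureReal_empty]
      positivity
    · refine le_trans (measureReal_mono fun ω hω => ?_)
        (hh.prob_bilinear_le ha hq z hC (by linarith) he)
      exact hω.2
  have hae : ∀ᵐ ω ∂P, ∀ i j, |h i j ω| ≤ 1 / √q :=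
    ae_all_iff.2 fun i => ae_all_iff.2 fun j => hh.ae_abs_le ha hq i j
  -- Each bad event contains its coefficient bound, so outside it exactly the implication required
  -- by `IsGood` holds. The entry bound is only almost sure, hence the inclusion is too; the
  -- prefactors `2 * t` and `6 * t ^ 2` are dominated by the quadratic one.
  have hsub : ∀ᵐ ω ∂P, ω ∈ {ω | ¬ IsGood γ q (H ω) z C ((12 * L + 2) * t ^ 2)} →
      ω ∈ ⋃ e, (E1 e ∪ E2 e ∪ E3 e) := by
    filter_upwards [hae] with ω hω hbad
    by_contra hnot
    simp only [Set.mem_iUnion, Set.mem_union, not_exists, not_or] at hnot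
    refine hbad ⟨Matrix.IsSymm.ext fun i j => hh.symm j i ω, hω, ?_, ?_, ?_⟩
    · intro i k hb
      have h5 := (hnot (i, k)).1.1
      simp only [hE1, Set.mem_ofPred_eq, not_and, not_le] at h5
      refine (h5 hb).le.trans ?_
      refine mul_le_mul_of_nonneg_right ?_ (by positivity)
      nlinarith
    · intro i j hb
      have h5 := (hnot (i, j)).1.2
      simp only [hE2, Set.mem_ofPred_eq, not_and, not_le] at h5
      exact (h5 hb).le
    · intro i j hij hb
      have h5 := (hnot (i, j)).2
      simp only [hE3, Set.mem_ofPred_eq, not_and, not_le] at h5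
      refine (h5 hij hb).le.trans ?_
      refine mul_le_mul_of_nonneg_right ?_ (by positivity)
      nlinarith
  have hexp := Real.exp_pos (1 - t)
  calc P.real {ω | ¬ IsGood γ q (H ω) z C ((12 * L + 2) * t ^ 2)}
      ≤ P.real (⋃ e, (E1 e ∪ E2 e ∪ E3 e)) :=
        ENNReal.toReal_mono (measure_ne_top _ _) (measure_mono_ae hsub)
    _ ≤ ∑ e, P.real (E1 e ∪ E2 e ∪ E3 e) := measureReal_iUnion_fintype_le _
    _ ≤ ∑ e : Fin N × Fin N, (4 * Real.exp (1 - t) +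
        (8 * L * (N + 1) + 4) * Real.exp (1 - t) + (N + 1) * (4 * Real.exp (1 - t))) := by
        refine Finset.sum_le_sum fun e _ => (measureReal_union_le _ _).trans
          (add_le_add ((measureReal_union_le _ _).trans (add_le_add ?_ ?_)) (h3 e))
        · exact hh.prob_linear_le ha hq z hC e.1 e.2
        · exact hh.prob_quadratic_le ha hq z hC ht hL e.1 e.2
    _ = (N : ℝ) ^ 2 * (4 + (8 * L * (N + 1) + 4) + (N + 1) * 4) * Real.exp (1 - t) := by
        rw [Finset.sum_const, Finset.card_univ, Fintype.card_prod, Fintype.card_fin,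
          nsmul_eq_mul]
        push_cast
        ring
    _ ≤ _ := by
        have hN : (0 : ℝ) ≤ N := Nat.cast_nonneg N
        have e1 : (4 + (8 * L * (N + 1) + 4) + (N + 1) * 4 : ℝ) ≤ 20 * L * (N + 1) := by
          nlinarith [mul_nonneg (sub_nonneg.2 hL1') hN]
        have e2 : (N : ℝ) ^ 2 ≤ (N + 1) ^ 2 := by gcongr; linarith
        refine mul_le_mul_of_nonneg_right ?_ hexp.le
        calc _ ≤ ((N : ℝ) + 1) ^ 2 * (20 * L * (N + 1)) := by gcongr
          _ = _ := by ring

end IsCenteredAdjacency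

end Adjacency

end ChungLu

/-! ### Power counting and conclusion -/

namespace ChungLu

/-- The bound `b` must be nonnegative because the suprema may run over empty types, where they are
zero. -/
lemma abs_lambda_le {r N : ℕ} {γ : Fin r → Fin N → ℝ} {H : Matrix (Fin N) (Fin N) ℝ} {z : ℂ}
    {b : ℝ} (hθ : ∀ i, 0 ≤ theta γ i) (hb : 0 ≤ b) (h : IsClose γ H z (gLim γ z) b) :
    |lambda γ H z| ≤ b := by
  have h0 : 0 ≤ lambda γ H z :=
    le_max_of_le_left (Real.iSup_nonneg fun i => mul_nonneg (hθ i) (norm_nonneg _))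
  rw [abs_of_nonneg h0]
  exact max_le (Real.iSup_le (fun i => h.diag hθ i) hb)
    (Real.iSup_le (fun e => h.offDiag e.2) hb)

lemma eventually_le_natCast_rpow {a : ℝ} (ha : 0 < a) (A : ℝ) :
    ∀ᶠ N : ℕ in atTop, A ≤ (N : ℝ) ^ a :=
  ((tendsto_rpow_atTop ha).comp tendsto_natCast_atTop_atTop).eventually_ge_atTop A

lemma eventually_mul_rpow_le_exp {a b : ℝ} (ha : 0 < a) (hb : 0 < b) (A s : ℝ) :
    ∀ᶠ N : ℕ in atTop, A * (N : ℝ) ^ s ≤ Real.exp (b * (N : ℝ) ^ a) := by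
  have h := ((tendsto_exp_mul_div_rpow_atTop (s / a) b hb).comp
    ((tendsto_rpow_atTop ha).comp tendsto_natCast_atTop_atTop)).eventually_ge_atTop A
  filter_upwards [h, eventually_gt_atTop 0] with N hN hN0
  have hN' : (0 : ℝ) < N := by exact_mod_cast hN0
  simp only [Function.comp_apply] at hN
  rw [← Real.rpow_mul hN'.le, mul_div_cancel₀ _ ha.ne'] at hN
  exact (le_div_iff₀ (Real.rpow_pos_of_pos hN' s)).1 hN

/-- At most `2 * N ^ 4` grid points, `L ≤ 2 * N` and `(N + 1) ^ 3 ≤ 8 * N ^ 3` give `2 * 20 * 2 * 8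
= 640` times `N ^ 8`. -/
lemma union_bound_le {N L : ℕ} {y D : ℝ} (hN : 1 ≤ N) (hL : (L : ℝ) ≤ 2 * N)
    (h : 640 * Real.exp 1 * (N : ℝ) ^ (8 + D) ≤ Real.exp y) :
    ((N : ℝ) ^ 4 + 1) * (20 * L * (N + 1) ^ 3 * Real.exp (1 - y)) ≤ (N : ℝ) ^ (-D) := by
  have hN' : (1 : ℝ) ≤ N := by exact_mod_cast hN
  have hN0 : (0 : ℝ) < N := by linarith
  have e1 : (N : ℝ) ^ (8 + D) = (N : ℝ) ^ 8 * (N : ℝ) ^ D := by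
    rw [Real.rpow_add hN0]
    congr 1
    exact_mod_cast Real.rpow_natCast (N : ℝ) 8
  have hD := Real.rpow_pos_of_pos hN0 D
  have h1 : (N : ℝ) ^ 4 + 1 ≤ 2 * (N : ℝ) ^ 4 := by
    have := one_le_pow₀ hN' (n := 4); linarith
  have h2 : ((N : ℝ) + 1) ^ 3 ≤ (2 * N) ^ 3 := by gcongr; linarith
  rw [Real.rpow_neg hN0.le, Real.exp_sub, ← one_div, le_div_iff₀ hD]
  calc ((N : ℝ) ^ 4 + 1) * (20 * L * (N + 1) ^ 3 * (Real.exp 1 / Real.exp y)) * (N : ℝ) ^ D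
      ≤ (2 * (N : ℝ) ^ 4) * (20 * (2 * N) * (2 * N) ^ 3 * (Real.exp 1 / Real.exp y)) *
        (N : ℝ) ^ D := by gcongr
    _ = 640 * Real.exp 1 * ((N : ℝ) ^ 8 * (N : ℝ) ^ D) / Real.exp y := by ring
    _ ≤ 1 := by
        rw [div_le_one (Real.exp_pos y), ← e1]
        exact h

/-- The control parameters are compatible with the power counting of the local law. -/
lemma control_le {N L : ℕ} {κ δ ε y K ψ₀ : ℝ} {z : ℂ} (hN : 1 ≤ N) (hy : 1 ≤ y)
    (hκ : y ^ 14 ≤ (N : ℝ) ^ κ) (hδ : y ^ 14 ≤ (N : ℝ) ^ δ) (hε : y ^ 7 ≤ (N : ℝ) ^ ε)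
    (hz : (N : ℝ) ^ (δ - 1) ≤ z.im) (hL : (L : ℝ) ≤ 2 * y) (hK : 0 < K) (hKy : 676 * K ≤ y)
    (hψ₀ : 0 < ψ₀) (hψy : 1352 / ψ₀ ≤ y) :
    1 ≤ N * z.im ∧ ((12 * L + 2) * y ^ 2) ^ 2 * controlPhi N ((N : ℝ) ^ κ) z ≤ ψ₀ ∧
      K * (((12 * L + 2) * y ^ 2) ^ 2 * controlPhi N ((N : ℝ) ^ κ) z) ≤
        (N : ℝ) ^ ε * controlPhi N ((N : ℝ) ^ κ) z := by
  have hN' : (1 : ℝ) ≤ N := by exact_mod_cast hN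
  have hN0 : (0 : ℝ) < N := by linarith
  have hy0 : 0 < y := by linarith
  have h1 : (N : ℝ) ^ δ ≤ N * z.im := by
    calc (N : ℝ) ^ δ = N * (N : ℝ) ^ (δ - 1) := by
          rw [Real.rpow_sub_one hN0.ne']; field_simp
      _ ≤ _ := by gcongr
  have h2 : y ^ 14 ≤ N * z.im := hδ.trans h1
  have h3 : ∀ x : ℝ, y ^ 14 ≤ x → 1 / √x ≤ 1 / y ^ 7 := fun x hx => by
    have : y ^ 7 ≤ √x := Real.le_sqrt_of_sq_le (by rw [← pow_mul]; exact hx)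
    gcongr
  have hΦ0 : 0 ≤ controlPhi N ((N : ℝ) ^ κ) z := by unfold controlPhi; positivity
  have hΦ : controlPhi N ((N : ℝ) ^ κ) z ≤ 2 / y ^ 7 :=
    (add_le_add (h3 _ hκ) (h3 _ h2)).trans_eq (by ring)
  -- With `12 * L + 2 ≤ 26 * y` the loss is of order `y ^ 6`, while `Φ ≤ 2 / y ^ 7`. One spare power
  -- of `y` beats the constants, and `y ^ 7 ≤ N ^ ε` absorbs the loss in the final bound.
  have hτ : ((12 * L + 2) * y ^ 2) ^ 2 ≤ 676 * y ^ 6 := by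
    calc ((12 * L + 2) * y ^ 2) ^ 2 ≤ (26 * y * y ^ 2) ^ 2 := by gcongr; linarith
      _ = _ := by ring
  refine ⟨(one_le_pow₀ hy).trans h2, ?_, ?_⟩
  · calc ((12 * L + 2) * y ^ 2) ^ 2 * controlPhi N ((N : ℝ) ^ κ) z
        ≤ 676 * y ^ 6 * (2 / y ^ 7) := by gcongr
      _ = 1352 / y := by field_simp; norm_num
      _ ≤ ψ₀ := by rwa [div_le_comm₀ hy0 hψ₀]
  · rw [← mul_assoc]
    refine mul_le_mul_of_nonneg_right ?_ hΦ0
    calc K * ((12 * L + 2) * y ^ 2) ^ 2 ≤ K * (676 * y ^ 6) := by gcongr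
      _ = 676 * K * y ^ 6 := by ring
      _ ≤ y * y ^ 6 := by gcongr
      _ = y ^ 7 := by ring
      _ ≤ _ := hε

end ChungLu

theorem theorem6p1 {Ω : ℕ → Type*} [∀ N, MeasurableSpace (Ω N)]
    (P : ∀ N, Measure (Ω N)) [∀ N, IsProbabilityMeasure (P N)]
    (κ : ℝ) (hκ_pos : 0 < κ) (hκ_le : κ ≤ 1 / 2)
    (r : ℕ) (hr : 0 < r) (M : ℝ)
    (γ : ∀ N : ℕ, Fin r → Fin N → ℝ)
    (hγ : ∀ᶠ N : ℕ in atTop, ChungLu.IsAdmissible M ((N : ℝ) ^ κ) (γ N))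
    (h : ∀ N : ℕ, Fin N → Fin N → Ω N → ℝ)
    (hh : ∀ᶠ N : ℕ in atTop, ChungLu.IsCenteredAdjacency (P N) ((N : ℝ) ^ κ) (γ N) (h N))
    (I : Set ℝ) (hI : ChungLu.IsBulkInterval γ I)
    (δ : ℝ) (hδ : 0 < δ) :
    ChungLu.StochDom P (ChungLu.spectralDomain I δ)
      (fun N z ω => ChungLu.lambda (γ N) (Matrix.of fun i j => h N i j ω) z)
      (fun N z _ => ChungLu.controlPhi N ((N : ℝ) ^ κ) z) := by
  open ChungLu in
  intro ε hε D hD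
  obtain ⟨-, hbdd, c, hc, hbulk⟩ := hI
  obtain ⟨Z, hZ⟩ := isBounded_iff_forall_norm_le.1 hbdd
  -- Any single admissible size already forces `M ≥ 1`.
  obtain ⟨N₁, hN₁, hN₁0⟩ := (hγ.and (eventually_gt_atTop 0)).exists
  have hM : 1 ≤ M := hN₁.one_le_M hr hN₁0
  obtain ⟨ψ₀, K, C, N₀, hψ₀, hK, hC, hmain⟩ :=
    local_law_of_grid hr hM hc (le_max_right Z 0)
  -- The deviation parameter will be `t = y = N ^ a`; the exponent makes `y ^ 7 ≤ N ^ ε` and `y ^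
  -- 14` at most `N ^ κ` and `N ^ δ`, while `exp (-y)` beats every power of `N`.
  set a : ℝ := min ε (min (κ / 2) (δ / 2)) / 7 with ha_def
  have ha : 0 < a := by positivity
  have haε : 7 * a ≤ ε := by
    have := min_le_left ε (min (κ / 2) (δ / 2)); rw [ha_def]; linarith
  have haκ : 14 * a ≤ κ := by
    have := (min_le_right ε (min (κ / 2) (δ / 2))).trans (min_le_left _ _)
    rw [ha_def]; linarith
  have haδ : 14 * a ≤ δ := by
    have := (min_le_right ε (min (κ / 2) (δ / 2))).trans (min_le_right _ _)
    rw [ha_def]; linarith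
  filter_upwards [hγ, hh, hbulk, eventually_ge_atTop 1, eventually_ge_atTop ⌈N₀⌉₊,
    eventually_le_natCast_rpow ha (676 * K), eventually_le_natCast_rpow ha (1352 / ψ₀),
    eventually_mul_rpow_le_exp ha one_pos (640 * Real.exp 1) (8 + D),
    eventually_mul_rpow_le_exp ha (Real.log_pos one_lt_two) 1 1]
    with N hadm hadj hbulkN hN hNN₀ hyK hyψ hexp hpow z hz
  obtain ⟨hzI, hzlow, hzup⟩ := hz
  have hN' : (1 : ℝ) ≤ N := by exact_mod_cast hN
  have hN0 : (0 : ℝ) < N := by linarith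
  have hq1 : 1 ≤ (N : ℝ) ^ κ := Real.one_le_rpow hN' hκ_pos.le
  have hqN : ((N : ℝ) ^ κ) ^ 2 ≤ N := by
    rw [← Real.rpow_mul_natCast hN0.le]
    calc (N : ℝ) ^ (κ * (2 : ℕ)) ≤ (N : ℝ) ^ (1 : ℝ) :=
          Real.rpow_le_rpow_of_exponent_le hN' (by push_cast; linarith)
      _ = N := Real.rpow_one _
  have hz0 : 0 < z.im := (Real.rpow_pos_of_pos hN0 _).trans_le hzlow
  set y : ℝ := (N : ℝ) ^ a with hy_def
  have hy : 1 ≤ y := Real.one_le_rpow hN' ha.le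
  have hypow : ∀ (n : ℕ) (s : ℝ), n * a ≤ s → y ^ n ≤ (N : ℝ) ^ s := fun n s hs => by
    rw [hy_def, ← Real.rpow_mul_natCast hN0.le]
    exact Real.rpow_le_rpow_of_exponent_le hN' (by linarith)
  have hyN : y ≤ N := by
    have := hypow 1 1 (by push_cast; linarith)
    rwa [pow_one, Real.rpow_one] at this
  -- A logarithm would do for the number of binary digits; this cruder choice satisfies `N ≤ 2 ^ L`
  -- eventually and keeps `L` comparable to `y`.
  set L : ℕ := ⌈y⌉₊ with hL_def
  have hL1 : 1 ≤ L := Nat.one_le_ceil_iff.2 (by linarith)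
  have hLy : (L : ℝ) ≤ 2 * y := by
    have := (Nat.ceil_lt_add_one (by linarith : 0 ≤ y)).le
    linarith
  have hNL : N ≤ 2 ^ L := by
    have h1 : (N : ℝ) ≤ 2 ^ L := by
      rw [one_mul, Real.rpow_one, ← Real.rpow_def_of_pos two_pos] at hpow
      refine hpow.trans ?_
      rw [← Real.rpow_natCast]
      exact Real.rpow_le_rpow_of_exponent_le one_le_two (Nat.le_ceil y)
    exact_mod_cast h1
  obtain ⟨hη, hψ, hΦ⟩ := control_le (ε := ε) hN hy (hypow 14 κ (by exact_mod_cast haκ))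
    (hypow 14 δ (by exact_mod_cast haδ)) (hypow 7 ε (by exact_mod_cast haε)) hzlow hLy hK hyK
    hψ₀ hyψ
  set τ : ℝ := (12 * L + 2) * y ^ 2 with hτ_def
  have hτ1 : 1 ≤ τ := by
    have := one_le_pow₀ hy (n := 2)
    have hL0 : (0 : ℝ) ≤ L := Nat.cast_nonneg L
    nlinarith
  have hs : Setting (γ N) M ((N : ℝ) ^ κ) z := ⟨hr, hN, hadm, hq1, hqN, hz0⟩
  set B : ℕ → Set (Ω N) := fun m => {ω | ¬ IsGood (γ N) ((N : ℝ) ^ κ)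
    (Matrix.of fun i j => h N i j ω) (gridPoint z N m) C τ} with hB
  have hsub : {ω | |lambda (γ N) (Matrix.of fun i j => h N i j ω) z| >
      (N : ℝ) ^ ε * controlPhi N ((N : ℝ) ^ κ) z} ⊆ ⋃ m ∈ Finset.range (N ^ 4 + 1), B m := by
    intro ω hω
    by_contra hnot
    simp only [Set.mem_iUnion, not_exists, hB, Set.mem_ofPred_eq, not_not, Finset.mem_range,
      Nat.lt_succ_iff] at hnot
    have hclose := hmain N (γ N) _ z (Matrix.of fun i j => h N i j ω) τ
      (Nat.ceil_le.1 hNN₀) hs ((hZ z.re hzI).trans (le_max_left _ _)) hzup hη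
      (fun w hw => hbulkN w (hw ▸ hzI)) hτ1 hψ hnot
    have hΦ0 : 0 ≤ controlPhi N ((N : ℝ) ^ κ) z := by unfold controlPhi; positivity
    have := abs_lambda_le (fun i => (hs.theta_pos i).le) (by positivity) hclose
    exact absurd hω (not_lt.2 (this.trans hΦ))
  have hprob : (P N).real (⋃ m ∈ Finset.range (N ^ 4 + 1), B m) ≤ (N : ℝ) ^ (-D) := by
    refine (measureReal_biUnion_finset_le _ _).trans ((Finset.sum_le_sum fun m _ =>
      hadj.prob_not_isGood_le hadm (by linarith) (gridPoint z N m) (by linarith : 0 < C) hy hNL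
        hL1).trans ?_)
    rw [Finset.sum_const, Finset.card_range, nsmul_eq_mul]
    push_cast
    rw [one_mul] at hexp
    exact union_bound_le hN (hLy.trans (by linarith)) hexp
  calc _ ≤ P N (⋃ m ∈ Finset.range (N ^ 4 + 1), B m) := measure_mono hsub
    _ = ENNReal.ofReal ((P N).real (⋃ m ∈ Finset.range (N ^ 4 + 1), B m)) :=
        (ofReal_measureReal (measure_ne_top _ _)).symm
    _ ≤ _ := ENNReal.ofReal_le_ofReal hprob
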